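/- **Setting.** Let $\mathbb I=[-1,1]$, let $\mathcal F$ be the set of finitely supported multi-indices $\nu=(\nu_j)_{j\ge1}\in\mathbb N_0^{\mathbb N}$ with the componentwise order, and let $(a_j),(b_j)$ be bounded real sequences with $\inf_j a_j>-1$, $\inf_j b_j>-1$. Let $\mu=\bigotimes_j\mu_{a_j,b_j}$ on $\mathbb I^\infty$, where $\mu_{a,b}$ is the Jacobi probability measure with density $\frac{\Gamma(a+b+2)}{2^{a+b+1}\Gamma(a+1)\Gamma(b+1)}(1-y)^a(1+y)^b$ on $\mathbb I$; let $J^{(j)}_k$ be the polynomials of degree $k$, orthonormal with respect to $\mu_{a_j,b_j}$, with positive leading coefficient, and $J_\nu(\mathbf y)=\prod_jJ^{(j)}_{\nu_j}(y_j)$. Put $\theta_0=\max\{\sup_ja_j,\sup_jb_j,-\tfrac12\}+\tfrac12$, fix $\varepsilon>0$ and a constant $C_\varepsilon>0$ such that $$2\,\|J^{(j)}_k\|_{L_\infty(\mathbb I)}\log(2k+3)\le(C_\varepsilon k+1)^{\theta_0+\varepsilon}\qquad\text{for all } j\ge1,\ k\ge1,$$ and put $\theta=\theta_0+1+\varepsilon$,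 $\lambda=C_\varepsilon+1$, $p_\nu(\theta,\lambda)=\prod_j(1+\lambda\nu_j)^\theta$. **Assumptions.** (i) $X^1,X^2$ are Hilbert spaces, $X^2$ is a linear subspace of $X^1$, and $\|w\|_{X^1}\le C\|w\|_{X^2}$ on $X^2$. (ii) $v\in L_2(\mathbb I^\infty,X^2;\mu)$, with coefficients $v_\nu=\int vJ_\nu\,d\mu$. (iii) There are subspaces $V_m\subset X^1$ $(m\in\mathbb N_0)$ with $\dim V_m\le m$, $V_0=\{0\}$, linear maps $P_m:X^1\to V_m$, and $\alpha,C_1,C_2>0$ such that for all $w\in X^2$: $\|P_mw\|_{X^1}\le C_1\|w\|_{X^1}$ for $m\ge0$ and $\|w-P_mw\|_{X^1}\le C_2m^{-\alpha}\|w\|_{X^2}$ for $m\ge1$. (iv) There are $0<q_1\le q_2<2$ and, for $i=1,2$, increasing families $\sigma_i=(\sigma_{i;\nu})_{\nu\in\mathcal F}\subset(1,\infty)$ (that is, $\sigma_{i;\nu'}\le\sigma_{i;\nu}$ if $\nu'\le\nu$) with $$\sum_{\nu}(\sigma_{i;\nu}\|v_\nu\|_{X^i})^2<\infty,\qquad \big(p_\nu(\theta,\lambda)^{2/q_i}\sigma_{i;\nu}^{-1}\big)_\nu\in\ell_{q_i}(\mathcal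 F).$$ **Index sets and interpolant.** With $\tau=\frac{2\alpha}{2-q_2}$, $\vartheta=\frac{2}{2-q_2}(\frac1{q_1}-\frac12)$, $\eta=(\frac1{q_1}-\frac12)^{-1}$ and $\xi>1$, let $G(\xi)\subset\mathbb N_0\times\mathcal F$ be $\{2^k\sigma_{2;\nu}^{q_2}\le\xi\}$ if $\alpha\le\frac1{q_2}-\frac12$, and $\{\sigma_{1;\nu}^{q_1}\le\xi(\log\xi)^\eta,\ 2^{\tau k}\sigma_{2;\nu}\le\xi^\vartheta\}$ if $\alpha>\frac1{q_2}-\frac12$. Let $\mathcal V(G)=\{\sum_{(k,\nu)\in G}v_{k,\nu}J_\nu: v_{k,\nu}\in V_{2^k}\}$. Let $I_m$ be univariate Lagrange interpolation at the Chebyshev nodes $-\cos\frac{(2k+1)\pi}{2(m+1)}$, $k=0,\dots,m$, $I_{-1}=0$, $\Delta_\nu=\bigotimes_j(I_{\nu_j}-I_{\nu_j-1})$, $\delta_0=P_1$, $\delta_k=P_{2^k}-P_{2^{k-1}}$ for $k\ge1$, and $\mathcal I_G=\sum_{(k,\nu)\in G}\delta_k\otimes\Delta_\nu$. **Theorem.**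 Under these assumptions $v$ has a continuous representative in $C(\mathbb I^\infty,X^2)$, to which interpolation is applied. For every $n\in\mathbb N$ there is $\xi_n>1$ such that $G(\xi_n)$ is finite, $\dim\mathcal V(G(\xi_n))\le n$ and $\mathcal I_{G(\xi_n)}$ maps $C(\mathbb I^\infty,X^2)$ into $\mathcal V(G(\xi_n))$. Moreover there is a constant $C>0$, independent of $n$ and $p$, such that for all $0<p\le2$ $$\|v-\mathcal I_{G(\xi_n)}v\|_{L_p(\mathbb I^\infty,X^1;\mu)}\le C\begin{cases}n^{-\alpha}&\text{if }\alpha\le\frac1{q_2}-\frac12,\ n\ge1,\\ n^{-\beta}(\log n)^\kappa&\text{if }\alpha>\frac1{q_2}-\frac12,\ n\ge2,\end{cases}$$ where $\delta=\frac1{q_1}-\frac1{q_2}$, $\beta=\big(\frac1{q_1}-\frac12\big)\frac{\alpha}{\alpha+\delta}$ and, in the second case, $0<\kappa=\frac{\alpha+1/2-1/q_2}{\alpha+1/q_1-1/q_2}<1$. -/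

import Mathlib

open MeasureTheory Polynomial

noncomputable section

/-! ### Parameter domain and multi-indices

The parameter domain is the compact product `[-1,1]^ℕ`.  Finitely supported multi-indices are
the elements of `ℕ →₀ ℕ`, which carries the pointwise order. -/

/-- The interval `[-1,1]`. -/
abbrev II : Type := Set.Icc (-1 : ℝ) 1

/-- The parameter domain `[-1,1]^ℕ`, with the product topology and product sigma-algebra. -/
abbrev IIinf : Type := ℕ → II

/-- Finitely supported multi-indices. -/
abbrev MultiIdx : Type := ℕ →₀ ℕ

/-! ### Jacobi measures and Jacobi polynomials -/

/-- The normalizing constant of the Jacobi weight. -/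
def jacobiConst (a b : ℝ) : ℝ :=
  Real.Gamma (a + b + 2) / ((2 : ℝ) ^ (a + b + 1) * Real.Gamma (a + 1) * Real.Gamma (b + 1))

/-- The Jacobi weight `c_{a,b} (1 - y)^a (1 + y)^b`. -/
def jacobiWeight (a b y : ℝ) : ℝ :=
  jacobiConst a b * (1 - y) ^ a * (1 + y) ^ b

/-- The Jacobi measure on `[-1,1]`: density `jacobiWeight a b` with respect to Lebesgue measure. -/
def jacobiMeasure (a b : ℝ) : Measure II :=
  ((volume : Measure ℝ).comap ((↑) : II → ℝ)).withDensity fun y => ENNReal.ofReal (jacobiWeight a b (y : ℝ))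

/-- For `a, b > -1` the Jacobi measure is a probability measure. -/
theorem isProbabilityMeasure_jacobiMeasure {a b : ℝ} (ha : -1 < a) (hb : -1 < b) :
    IsProbabilityMeasure (jacobiMeasure a b) := by
  have h1 : ∫⁻ y : II, ENNReal.ofReal (jacobiWeight a b (y : ℝ))
        ∂((volume : Measure ℝ).comap ((↑) : II → ℝ))
      = ∫⁻ y in Set.Icc (-1 : ℝ) 1, ENNReal.ofReal (jacobiWeight a b y) :=
    lintegral_subtype_comap measurableSet_Icc fun y : ℝ => ENNReal.ofReal (jacobiWeight a b y)
  have himg : (fun t : ℝ => 2 * t - 1) '' Set.Ioo 0 1 = Set.Ioo (-1 : ℝ) 1 := by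
    ext y
    constructor
    · rintro ⟨t, ⟨h0, h1⟩, rfl⟩
      constructor <;> dsimp only <;> linarith
    · rintro ⟨h0, h1⟩
      exact ⟨(y + 1) / 2, ⟨by linarith, by linarith⟩, by ring⟩
  have h2 : ∫⁻ y in Set.Ioo (-1 : ℝ) 1, ENNReal.ofReal (jacobiWeight a b y)
      = ∫⁻ t in Set.Ioo (0 : ℝ) 1,
          ENNReal.ofReal |(2 : ℝ)| * ENNReal.ofReal (jacobiWeight a b (2 * t - 1)) := by
    rw [← himg]
    refine lintegral_image_eq_lintegral_abs_deriv_mul measurableSet_Ioo (f' := fun _ => 2)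
      (fun t _ => ?_) (fun s _ t _ h => ?_) _
    · simpa using (((hasDerivAt_id t).const_mul 2).sub_const 1).hasDerivWithinAt
    · linarith
  have h3 : ∀ t ∈ Set.Ioo (0 : ℝ) 1,
      ENNReal.ofReal |(2 : ℝ)| * ENNReal.ofReal (jacobiWeight a b (2 * t - 1))
        = ENNReal.ofReal (1 / ProbabilityTheory.beta (b + 1) (a + 1)
            * t ^ (b + 1 - 1) * (1 - t) ^ (a + 1 - 1)) := by
    rintro t ⟨h0, h1⟩
    rw [← ENNReal.ofReal_mul (abs_nonneg _), abs_of_pos (by norm_num : (0 : ℝ) < 2)]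
    congr 1
    have e1 : (1 : ℝ) - (2 * t - 1) = 2 * (1 - t) := by ring
    have e2 : (1 : ℝ) + (2 * t - 1) = 2 * t := by ring
    have hga := (Real.Gamma_pos_of_pos (by linarith : 0 < a + 1)).ne'
    have hgb := (Real.Gamma_pos_of_pos (by linarith : 0 < b + 1)).ne'
    have hg := (Real.Gamma_pos_of_pos (by linarith : 0 < a + b + 2)).ne'
    have hpa : (2 : ℝ) ^ a ≠ 0 := (Real.rpow_pos_of_pos (by norm_num) a).ne'
    have hpb : (2 : ℝ) ^ b ≠ 0 := (Real.rpow_pos_of_pos (by norm_num) b).ne'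
    rw [jacobiWeight, jacobiConst, ProbabilityTheory.beta, e1, e2,
      Real.mul_rpow (by norm_num) (by linarith), Real.mul_rpow (by norm_num) h0.le,
      show b + 1 + (a + 1) = a + b + 2 by ring, Real.rpow_add (by norm_num),
      Real.rpow_add (by norm_num), Real.rpow_one, add_sub_cancel_right, add_sub_cancel_right]
    field_simp
  constructor
  rw [jacobiMeasure, withDensity_apply _ MeasurableSet.univ, Measure.restrict_univ, h1,
    setLIntegral_congr (Ioo_ae_eq_Icc (a := (-1 : ℝ)) (b := 1) (μ := volume)).symm, h2,
    setLIntegral_congr_fun measurableSet_Ioo h3, ← ProbabilityTheory.lintegral_betaPDF]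
  exact ProbabilityTheory.lintegral_betaPDF_eq_one (by linarith) (by linarith)

/-- The `L²` pairing of two polynomials with respect to the Jacobi measure. -/
def jacobiPairing (a b : ℝ) (p q : ℝ[X]) : ℝ :=
  ∫ y : II, p.eval (y : ℝ) * q.eval (y : ℝ) ∂jacobiMeasure a b

/-- The monic Jacobi polynomials: Gram-Schmidt orthogonalization of `1, X, X², …` with respect
to the Jacobi measure. -/
def jacobiMonic (a b : ℝ) (k : ℕ) : ℝ[X] :=
  X ^ k - ∑ i : Fin k,
    C (jacobiPairing a b (X ^ k) (jacobiMonic a b i) /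
      jacobiPairing a b (jacobiMonic a b i) (jacobiMonic a b i)) * jacobiMonic a b i
termination_by k
decreasing_by exact i.2

/-- The Jacobi polynomials that are orthonormal with respect to the Jacobi probability measure
and have a positive leading coefficient. -/
def jacobi (a b : ℝ) (k : ℕ) : ℝ[X] :=
  C (1 / Real.sqrt (jacobiPairing a b (jacobiMonic a b k) (jacobiMonic a b k))) *
    jacobiMonic a b k

/-- The infinite product of the Jacobi probability measures on `[-1,1]^ℕ`. -/
def jacobiProdMeasure (a b : ℕ → ℝ) : Measure IIinf :=
  Measure.infinitePi fun j => jacobiMeasure (a j) (b j)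

/-- The tensor product Jacobi polynomial of a multi-index (factors of degree `0` equal `1`). -/
def jacobiTensor (a b : ℕ → ℝ) (ν : MultiIdx) (y : IIinf) : ℝ :=
  ν.prod fun j k => (jacobi (a j) (b j) k).eval (y j : ℝ)

/-- The Jacobi generalized polynomial chaos coefficient `∫ v J_ν dμ`. -/
def gpcCoeff {X : Type*} [NormedAddCommGroup X] [NormedSpace ℝ X]
    (a b : ℕ → ℝ) (v : IIinf → X) (ν : MultiIdx) : X :=
  ∫ y, jacobiTensor a b ν y • v y ∂jacobiProdMeasure a b

/-! ### Weights -/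

/-- `θ₀ = max {sup a_j, sup b_j, -1/2} + 1/2`. -/
def jacobiTheta0 (a b : ℕ → ℝ) : ℝ :=
  max (max (⨆ j, a j) (⨆ j, b j)) (-1 / 2) + 1 / 2

/-- `C` is an admissible choice of the constant `C_ε` for the given `ε`:
`2 ‖J_k‖_∞ log(2k+3) ≤ (C k + 1)^(θ₀ + ε)` for all `k ≥ 1`, for the Jacobi polynomials `J_k` of
each of the parameter pairs `(a_j, b_j)`. -/
def IsAdmissibleConst (a b : ℕ → ℝ) (ε C : ℝ) : Prop :=
  0 < C ∧ ∀ j k : ℕ, 1 ≤ k → ∀ y : II,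
    2 * |(jacobi (a j) (b j) k).eval (y : ℝ)| * Real.log (2 * (k : ℝ) + 3)
      ≤ (C * (k : ℝ) + 1) ^ (jacobiTheta0 a b + ε)

/-- The weights `p_ν(θ,λ) = ∏_j (1 + λ ν_j)^θ`. -/
def pWeight (θ lam : ℝ) (ν : MultiIdx) : ℝ :=
  ν.prod fun _ k => (1 + lam * (k : ℝ)) ^ θ

/-- Weighted summability of a family of coefficient norms `c ν = ‖v_ν‖`: the weights `σ` are
increasing and larger than `1`, `∑ (σ_ν c_ν)² < ∞`, and `(p_ν(θ,λ)^(2/q) σ_ν⁻¹)_ν ∈ ℓ_q`. -/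
structure WeightedSummable (θ lam q : ℝ) (σ : MultiIdx → ℝ) (c : MultiIdx → ℝ) : Prop where
  one_lt : ∀ ν, 1 < σ ν
  increasing : Monotone σ
  summable_sq : Summable fun ν => (σ ν * c ν) ^ 2
  summable_weight : Summable fun ν => (pWeight θ lam ν ^ (2 / q) * (σ ν)⁻¹) ^ q

/-! ### Interpolation in the parameters -/

/-- The Chebyshev nodes `y_{m,k} = -cos ((2k+1)π / (2(m+1)))`, `k = 0, …, m`. -/
def chebNode (m k : ℕ) : II :=
  ⟨-Real.cos ((2 * (k : ℝ) + 1) * Real.pi / (2 * ((m : ℝ) + 1))),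
    neg_le_neg (Real.cos_le_one _), neg_le.mpr (Real.neg_one_le_cos _)⟩

/-- The Lagrange basis polynomial `L_{m,k}` of the nodes `y_{m,0}, …, y_{m,m}`. -/
def chebLagrange (m k : ℕ) : ℝ[X] :=
  Lagrange.basis (Finset.range (m + 1)) (fun i => (chebNode m i : ℝ)) k

section Operators

variable {X : Type*} [AddCommGroup X] [Module ℝ X]

/-- The univariate interpolation operator `I_m`, acting on the variable `y_j` with the other
variables held fixed. -/
def interpAt (j m : ℕ) (w : IIinf → X) : IIinf → X := fun y =>
  ∑ k ∈ Finset.range (m + 1),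
    (chebLagrange m k).eval (y j : ℝ) • w (Function.update y j (chebNode m k))

/-- The univariate increment `I_m - I_{m-1}` (with `I_{-1} = 0`), acting on the variable `y_j`. -/
def deltaAt (j : ℕ) : ℕ → (IIinf → X) → (IIinf → X)
  | 0, w => interpAt j 0 w
  | m + 1, w => interpAt j (m + 1) w - interpAt j m w

/-- Replace every coordinate outside `S` by the single node `y_{0,0}` of `I_0`. -/
def freezeOutside (S : Finset ℕ) (y : IIinf) : IIinf := fun j =>
  if j ∈ S then y j else chebNode 0 0

/-- The tensor product increment `⨂_j (I_{ν_j} - I_{ν_j - 1})`: in each of the infinitely many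
variables outside the support of `ν` the operator is `I_0`, that is, evaluation at the node
`y_{0,0}`; in the variables of the support the univariate increments are applied one after the
other. -/
def deltaTensor (ν : MultiIdx) (w : IIinf → X) : IIinf → X :=
  (ν.support.sort (· ≤ ·)).foldl (fun u j => deltaAt j (ν j) u)
    fun y => w (freezeOutside ν.support y)

end Operators

/-! ### Spatial increments, thresholded index sets and the fully discrete interpolant -/

section Discretization

variable {𝕜 : Type*} [RCLike 𝕜]
  {X₁ : Type*} [NormedAddCommGroup X₁] [InnerProductSpace 𝕜 X₁] [NormedSpace ℝ X₁]
  {X₂ : Type*} [NormedAddCommGroup X₂] [InnerProductSpace 𝕜 X₂] [NormedSpace ℝ X₂]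

/-- The dyadic spatial increments: `δ_0 = P_1` and `δ_k = P_{2^k} - P_{2^(k-1)}` for `k ≥ 1`,
on `X₂`, which is regarded as a subspace of `X₁` through the embedding `emb`. -/
def spatialIncr (emb : X₂ →L[𝕜] X₁) (P : ℕ → X₁ →ₗ[𝕜] X₁) : ℕ → X₂ → X₁
  | 0, w => P 1 (emb w)
  | k + 1, w => P (2 ^ (k + 1)) (emb w) - P (2 ^ k) (emb w)

/-- The approximation space of all sums `∑_{(k,ν) ∈ G} v_{k,ν} J_ν` with `v_{k,ν} ∈ V_{2^k}`. -/
def approxSpace (a b : ℕ → ℝ) (V : ℕ → Submodule 𝕜 X₁) (G : Set (ℕ × MultiIdx)) :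
    Submodule 𝕜 (IIinf → X₁) :=
  Submodule.span 𝕜
    {f | ∃ k ν w, (k, ν) ∈ G ∧ w ∈ V (2 ^ k) ∧ f = fun y => jacobiTensor a b ν y • w}

/-- The sparse-grid tensor product interpolant `∑_{(k,ν) ∈ G} (δ_k ⊗ Δ_ν) w` for a finite index
set `G` (for an infinite one the sum is meaningless). -/
def sparseInterp (emb : X₂ →L[𝕜] X₁) (P : ℕ → X₁ →ₗ[𝕜] X₁) (G : Set (ℕ × MultiIdx))
    (w : IIinf → X₂) : IIinf → X₁ := fun y =>
  ∑ᶠ i ∈ G, spatialIncr emb P i.1 (deltaTensor i.2 w y)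

end Discretization

open Classical in
/-- The thresholded index sets `G(ξ)`. -/
def thresholdSet (α q₁ q₂ : ℝ) (σ₁ σ₂ : MultiIdx → ℝ) (ξ : ℝ) : Set (ℕ × MultiIdx) :=
  let τ : ℝ := 2 * α / (2 - q₂)
  let ϑ : ℝ := 2 / (2 - q₂) * (1 / q₁ - 1 / 2)
  let η : ℝ := (1 / q₁ - 1 / 2)⁻¹
  if α ≤ 1 / q₂ - 1 / 2 then
    {i | (2 : ℝ) ^ i.1 * σ₂ i.2 ^ q₂ ≤ ξ}
  else
    {i | σ₁ i.2 ^ q₁ ≤ ξ * Real.log ξ ^ η ∧ (2 : ℝ) ^ (τ * (i.1 : ℝ)) * σ₂ i.2 ≤ ξ ^ ϑ}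

/-- The algebraic rate `β = (1/q₁ - 1/2) α / (α + δ)` with `δ = 1/q₁ - 1/q₂`. -/
def rateBeta (α q₁ q₂ : ℝ) : ℝ :=
  (1 / q₁ - 1 / 2) * (α / (α + (1 / q₁ - 1 / q₂)))

/-- The exponent `κ = (α + 1/2 - 1/q₂) / (α + 1/q₁ - 1/q₂)` of the logarithm. -/
def rateKappa (α q₁ q₂ : ℝ) : ℝ :=
  (α + 1 / 2 - 1 / q₂) / (α + 1 / q₁ - 1 / q₂)

end

/-! The error is estimated in the supremum norm, which on a probability space dominates all the
$L_p$ norms. The expansion $v=\sum_\mu v_\mu J_\mu$ converges uniformly because $\|J_\mu\|_\infty\le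
p_\mu$, so the interpolant may be studied term by term.

For one term, $\Delta_\nu J_\mu=0$ unless $\nu\le\mu$, and $\sum_{\nu\le\mu}\Delta_\nu J_\mu=J_\mu$.
If the lower set $G$ has fibres $\{k<N(\nu)\}$, the spatial increments telescope and the error is
$\sum_{\nu\le\mu}\Delta_\nu J_\mu\,(v_\mu-P_{2^{N(\nu)-1}}v_\mu)$, where the projection is dropped
if $N(\nu)=0$. As $N$ is decreasing, each bracket is bounded by the spatial error at level $N(\mu)$,
and the error of the term is at most $p_\mu$ times that (`norm_sub_sparseInterp_le`).

The weight comes from $\sum_{m\le k}|\Delta_mJ_k|\le(1+2\sum_{m<k}\Lambda_m)\|J_k\|_\infty\le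
2(k+1)\log(2k+3)\|J_k\|_\infty$ with Chebyshev Lebesgue constants $\Lambda_m$; the logarithm is
absorbed by the choice of $C_\varepsilon$. A constant factor here would be raised to the size of the
support of $\mu$, hence the explicit estimates (`lebesgueBound_le`,
`one_add_two_mul_sum_interpBound_le`).

By the arithmetic-geometric inequality $\sum_\nu
p_\nu\sigma_{i;\nu}^{1-q_i/2}\|v_\nu\|_{X^i}<\infty$ (`WeightedSummable.summable_mul`). Since
$(N(\nu),\nu)\notin G(\xi)$, a threshold inequality fails there, which bounds the spatial error by a
negative power of $\xi$ times these summands (`err_le_of_le`, `err_le_of_lt`). The dimension is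
controlled by $\sum_G2^k$, hence by $\sum_\nu\sigma_{i;\nu}^{-q_i}$, with Hölder's inequality in the
second case. Choosing $\xi$ as large as the budget $n$ permits gives the rates (`exists_threshold`).
-/

/-! ### Lebesgue constants of Chebyshev interpolation -/

/-- The angle of the Chebyshev node `chebNode m k`. -/
noncomputable def chebAngle (m k : ℕ) : ℝ := (2 * (k : ℝ) + 1) * Real.pi / (2 * ((m : ℝ) + 1))

theorem coe_chebNode (m k : ℕ) : (chebNode m k : ℝ) = -Real.cos (chebAngle m k) := rfl

theorem chebAngle_mem_Ioo {m k : ℕ} (hk : k < m + 1) : chebAngle m k ∈ Set.Ioo 0 Real.pi := by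
  have hk' : (k : ℝ) + 1 ≤ m + 1 := by exact_mod_cast hk
  have hm : (0 : ℝ) ≤ m := Nat.cast_nonneg m
  have h0 : (0 : ℝ) ≤ k := Nat.cast_nonneg k
  have hpi := Real.pi_pos
  constructor
  · unfold chebAngle; positivity
  · unfold chebAngle
    rw [div_lt_iff₀ (by positivity)]
    nlinarith

theorem chebNode_injOn (m : ℕ) :
    Set.InjOn (fun i => (chebNode m i : ℝ)) (Finset.range (m + 1) : Set ℕ) := by
  intro i hi j hj hij
  simp only [Finset.coe_range, Set.mem_Iio] at hi hj
  simp only [coe_chebNode, neg_inj] at hij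
  have h := Real.injOn_cos ⟨(chebAngle_mem_Ioo hi).1.le, (chebAngle_mem_Ioo hi).2.le⟩
    ⟨(chebAngle_mem_Ioo hj).1.le, (chebAngle_mem_Ioo hj).2.le⟩ hij
  unfold chebAngle at h
  have hm : (0 : ℝ) < 2 * ((m : ℝ) + 1) := by positivity
  rw [div_left_inj' hm.ne', mul_left_inj' Real.pi_pos.ne'] at h
  exact_mod_cast (by linarith : (i : ℝ) = j)

theorem cos_mul_chebAngle (m k : ℕ) : Real.cos (((m : ℝ) + 1) * chebAngle m k) = 0 := by
  rw [Real.cos_eq_zero_iff]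
  refine ⟨k, ?_⟩
  unfold chebAngle
  have hm : ((m : ℝ) + 1) ≠ 0 := by positivity
  field_simp
  push_cast
  ring

theorem abs_eval_T_neg_cos (m : ℕ) (φ : ℝ) :
    |(Chebyshev.T ℝ ((m : ℤ) + 1)).eval (-Real.cos φ)| = |Real.cos (((m : ℝ) + 1) * φ)| := by
  rw [← Real.cos_pi_sub, Chebyshev.T_real_cos]
  have h : (((m : ℤ) + 1 : ℤ) : ℝ) * (Real.pi - φ)
      = -(((m : ℝ) + 1) * φ) + ((m + 1 : ℕ) : ℝ) * Real.pi := by push_cast; ring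
  rw [h, Real.cos_add_nat_mul_pi, abs_mul, abs_pow, abs_neg, abs_one, one_pow, one_mul,
    Real.cos_neg]

/-- $T_{m+1}'=(m+1)U_m$ and $U_m(\cos t)\sin t=\sin((m+1)t)$, which is $\pm1$ at a node because the
cosine of the same angle vanishes. -/
theorem abs_eval_derivative_T_chebNode {m k : ℕ} (hk : k < m + 1) :
    |(derivative (Chebyshev.T ℝ ((m : ℤ) + 1))).eval (chebNode m k : ℝ)|
      * Real.sin (chebAngle m k) = (m : ℝ) + 1 := by
  have hs : 0 < Real.sin (chebAngle m k) :=
    Real.sin_pos_of_pos_of_lt_pi (chebAngle_mem_Ioo hk).1 (chebAngle_mem_Ioo hk).2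
  have hU := Chebyshev.U_real_cos (Real.pi - chebAngle m k) (m : ℤ)
  rw [Real.sin_pi_sub, Real.cos_pi_sub] at hU
  have h1 : |Real.sin (((m : ℤ) + 1 : ℝ) * (Real.pi - chebAngle m k))| = 1 := by
    have h : ((m : ℤ) + 1 : ℝ) * (Real.pi - chebAngle m k)
      = -(((m : ℝ) + 1) * chebAngle m k) + ((m + 1 : ℕ) : ℝ) * Real.pi := by push_cast; ring
    rw [h, Real.sin_add_nat_mul_pi, abs_mul, abs_pow, abs_neg, abs_one, one_pow, one_mul,
      Real.sin_neg, abs_neg]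
    have := Real.sin_sq_add_cos_sq (((m : ℝ) + 1) * chebAngle m k)
    rw [cos_mul_chebAngle] at this
    rw [← sq_eq_sq₀ (abs_nonneg _) zero_le_one, sq_abs]
    linarith
  rw [Chebyshev.T_derivative_eq_U, coe_chebNode, eval_mul, abs_mul, mul_assoc]
  conv_lhs => rw [← abs_of_pos hs]
  rw [← abs_mul]
  simp only [add_sub_cancel_right]
  rw [hU, h1]
  simp
  positivity

/-- The $m+1$ distinct nodes are zeros of $T_{m+1}$, which has degree $m+1$, so the quotient by the
nodal polynomial is constant. -/
theorem exists_T_eq_C_mul_nodal (m : ℕ) :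
    ∃ c : ℝ, c ≠ 0 ∧ Chebyshev.T ℝ ((m : ℤ) + 1)
      = C c * Lagrange.nodal (Finset.range (m + 1)) (fun i => (chebNode m i : ℝ)) := by
  have hdvd : Lagrange.nodal (Finset.range (m + 1)) (fun i => (chebNode m i : ℝ))
      ∣ Chebyshev.T ℝ ((m : ℤ) + 1) := by
    unfold Lagrange.nodal
    refine Finset.prod_dvd_of_coprime (fun i hi j hj hij => ?_) fun i hi => ?_
    · exact isCoprime_X_sub_C_of_isUnit_sub
        (sub_ne_zero.2 fun h => hij (chebNode_injOn m hi hj h)).isUnit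
    · rw [dvd_iff_isRoot, IsRoot.def, ← abs_eq_zero]
      beta_reduce
      rw [coe_chebNode, abs_eval_T_neg_cos,
        cos_mul_chebAngle, abs_zero]
  obtain ⟨q, hq⟩ := hdvd
  have hT : (Chebyshev.T ℝ ((m : ℤ) + 1)).degree = ((m + 1 : ℕ) : WithBot ℕ) := by
    rw [Chebyshev.degree_T]; norm_cast
  have hT0 : Chebyshev.T ℝ ((m : ℤ) + 1) ≠ 0 := by
    intro h; rw [h, degree_zero] at hT; exact absurd hT (WithBot.bot_ne_coe)
  have hq0 : q ≠ 0 := by rintro rfl; exact hT0 (by simpa using hq)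
  have hdeg : q.natDegree = 0 := by
    have := natDegree_eq_of_degree_eq_some hT
    rw [hq, natDegree_mul Lagrange.nodal_ne_zero hq0, Lagrange.natDegree_nodal,
      Finset.card_range] at this
    omega
  obtain ⟨c, rfl⟩ := natDegree_eq_zero.1 hdeg
  exact ⟨c, by simpa using hq0, by rw [hq, mul_comm]⟩

/-- This is $\ell_k(x)=T_{m+1}(x)/(T_{m+1}'(x_k)(x-x_k))$ in the angle variable; the constant
relating $T_{m+1}$ to the nodal polynomial cancels. -/
theorem abs_eval_chebLagrange {m k : ℕ} (hk : k < m + 1) {φ : ℝ}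
    (hφ : Real.cos φ ≠ Real.cos (chebAngle m k)) :
    |(chebLagrange m k).eval (-Real.cos φ)| = |Real.cos (((m : ℝ) + 1) * φ)| / ((m : ℝ) + 1) *
      (Real.sin (chebAngle m k) / |Real.cos φ - Real.cos (chebAngle m k)|) := by
  obtain ⟨c, hc, hT⟩ := exists_T_eq_C_mul_nodal m
  have hk' := Finset.mem_range.2 hk
  have hd := abs_eval_derivative_T_chebNode hk
  have he := abs_eval_T_neg_cos m φ
  have hs : 0 < Real.sin (chebAngle m k) :=
    Real.sin_pos_of_pos_of_lt_pi (chebAngle_mem_Ioo hk).1 (chebAngle_mem_Ioo hk).2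
  rw [hT, eval_mul, eval_C, abs_mul] at he
  rw [hT, derivative_C_mul, eval_mul, eval_C, abs_mul] at hd
  have hne : -Real.cos φ ≠ (fun i => (chebNode m i : ℝ)) k := by
    simpa [coe_chebNode] using hφ
  rw [chebLagrange, Lagrange.eval_basis_not_at_node hk' hne,
    Lagrange.nodalWeight_eq_eval_derivative_nodal hk', abs_mul, abs_mul, abs_inv, abs_inv]
  have hx : |-Real.cos φ - (fun i => (chebNode m i : ℝ)) k|
      = |Real.cos φ - Real.cos (chebAngle m k)| := by
    rw [← abs_neg]; congr 1; simp [coe_chebNode]; ring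
  rw [hx, ← he, ← hd]
  have hm : (0 : ℝ) < (m : ℝ) + 1 := by positivity
  have hc' : |c| ≠ 0 := by simpa using hc
  have hD : |eval ((chebNode m k : ℝ))
      (derivative (Lagrange.nodal (Finset.range (m + 1)) fun i => (chebNode m i : ℝ)))| ≠ 0 := by
    intro h
    rw [h] at hd
    simp at hd
    linarith
  have hn0 : |Real.cos φ - Real.cos (chebAngle m k)| ≠ 0 := by simpa [sub_eq_zero] using hφ
  field_simp

/-! ### Sums of half-angle cotangents -/

/-- The function `|cot (t/2)|`. -/
noncomputable def absHalfCot (t : ℝ) : ℝ := |Real.cos (t / 2)| / |Real.sin (t / 2)|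

theorem absHalfCot_neg (t : ℝ) : absHalfCot (-t) = absHalfCot t := by
  simp [absHalfCot, neg_div]

theorem absHalfCot_add_two_pi (t : ℝ) : absHalfCot (t + 2 * Real.pi) = absHalfCot t := by
  have h : (t + 2 * Real.pi) / 2 = t / 2 + Real.pi := by ring
  simp [absHalfCot, h, Real.cos_add_pi, Real.sin_add_pi]

/-- Equivalent to $x<\tan x$ on $(0,\pi/2)$; at $t=\pi$ the cotangent vanishes. -/
theorem absHalfCot_le {t : ℝ} (h0 : 0 < t) (h1 : t ≤ Real.pi) : absHalfCot t ≤ 2 / t := by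
  have hs : 0 < Real.sin (t / 2) :=
    Real.sin_pos_of_pos_of_lt_pi (by linarith) (by linarith [Real.pi_pos])
  have hc : 0 ≤ Real.cos (t / 2) :=
    Real.cos_nonneg_of_neg_pi_div_two_le_of_le (by linarith [Real.pi_pos]) (by linarith)
  rw [absHalfCot, abs_of_pos hs, abs_of_nonneg hc, div_le_div_iff₀ hs h0]
  rcases hc.eq_or_lt with hc | hc
  · rw [← hc]; simp [hs.le]
  · have h2 : t / 2 < Real.pi / 2 := by
      rcases h1.eq_or_lt with h1 | h1
      · rw [h1, Real.cos_pi_div_two] at hc; exact absurd hc (lt_irrefl _)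
      · linarith
    have := Real.lt_tan (by linarith : 0 < t / 2) h2
    rw [Real.tan_eq_sin_div_cos, lt_div_iff₀ hc] at this
    linarith

/-- Up to signs the quotient is half the sum of the cotangents of $(\theta\pm\varphi)/2$: expand
$\sin\theta$ as the sine of the sum of these two angles and factor the difference of cosines. -/
theorem sin_div_abs_cos_sub_cos_le {θ φ : ℝ} (hθ : 0 ≤ Real.sin θ)
    (h : Real.cos φ ≠ Real.cos θ) :
    Real.sin θ / |Real.cos φ - Real.cos θ|
      ≤ (absHalfCot (θ - φ) + absHalfCot (θ + φ)) / 2 := by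
  have e1 : Real.cos φ - Real.cos θ = 2 * Real.sin ((θ + φ) / 2) * Real.sin ((θ - φ) / 2) := by
    rw [Real.cos_sub_cos]
    have : (φ - θ) / 2 = -((θ - φ) / 2) := by ring
    rw [this, Real.sin_neg, add_comm φ θ]; ring
  have e2 : Real.sin θ = Real.sin ((θ + φ) / 2) * Real.cos ((θ - φ) / 2)
      + Real.cos ((θ + φ) / 2) * Real.sin ((θ - φ) / 2) := by
    rw [← Real.sin_add]; congr 1; ring
  have hne : Real.cos φ - Real.cos θ ≠ 0 := sub_ne_zero.2 h
  rw [e1] at hne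
  have hA : Real.sin ((θ + φ) / 2) ≠ 0 := fun h => hne (by rw [h]; simp)
  have hB : Real.sin ((θ - φ) / 2) ≠ 0 := fun h => hne (by rw [h]; simp)
  have hA' := abs_pos.2 hA
  have hB' := abs_pos.2 hB
  rw [← abs_of_nonneg hθ, e1, e2, abs_mul, abs_mul, abs_two]
  have : |Real.sin ((θ + φ) / 2) * Real.cos ((θ - φ) / 2)
      + Real.cos ((θ + φ) / 2) * Real.sin ((θ - φ) / 2)|
      ≤ |Real.sin ((θ + φ) / 2)| * |Real.cos ((θ - φ) / 2)|
      + |Real.cos ((θ + φ) / 2)| * |Real.sin ((θ - φ) / 2)| := by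
    rw [← abs_mul, ← abs_mul]; exact abs_add_le _ _
  unfold absHalfCot
  rw [div_le_iff₀ (by positivity)]
  refine this.trans (le_of_eq ?_)
  field_simp

theorem sum_range_periodic {h : ℤ → ℝ} {N : ℕ} (hper : ∀ k, h (k + N) = h k) (a : ℤ) :
    ∑ k ∈ Finset.range N, h (a + k) = ∑ k ∈ Finset.range N, h k := by
  have step : ∀ b : ℤ, ∑ k ∈ Finset.range N, h (b + 1 + k) = ∑ k ∈ Finset.range N, h (b + k) := by
    intro b
    have h1 := Finset.sum_range_succ' (fun k : ℕ => h (b + k)) N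
    have h2 := Finset.sum_range_succ (fun k : ℕ => h (b + k)) N
    rw [h1] at h2
    have h3 : h (b + N) = h (b + (0 : ℕ)) := by rw [hper]; simp
    simp only [h3] at h2
    have h4 := add_right_cancel h2
    rw [← h4]
    refine Finset.sum_congr rfl fun k _ => ?_
    congr 1; push_cast; ring
  induction a using Int.induction_on with
  | zero => simp
  | succ i ih => rw [step, ih]
  | pred i ih => rw [← step, sub_add_cancel, ih]

/-- An upper bound for the Lebesgue constant of the Chebyshev nodes. -/
noncomputable def lebesgueBound (m : ℕ) : ℝ :=
  2 + 1 / Real.pi * ∑ j ∈ Finset.range m, (1 / ((j : ℝ) + 1) + 1 / ((j : ℝ) + 2))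

/-- In the pair $j=0$ each singular term is compensated by $\sin(\pi u)\le\pi u$ or $\sin(\pi
u)\le\pi(1-u)$, which accounts for the summand 2. In the other pairs the sine is bounded by 1; their
denominators have a sum independent of $u$, so the pair is largest in the limit $u\to0$. -/
theorem sin_mul_sum_le (m : ℕ) {u : ℝ} (h0 : 0 < u) (h1 : u < 1) :
    Real.sin (Real.pi * u) / Real.pi *
      ∑ j ∈ Finset.range (m + 1), (1 / (u + j) + 1 / ((j : ℝ) + 1 - u)) ≤ lebesgueBound m := by
  have hpi := Real.pi_pos
  have hs0 : 0 ≤ Real.sin (Real.pi * u) :=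
    Real.sin_nonneg_of_nonneg_of_le_pi (by positivity) (by nlinarith)
  have hs1 : Real.sin (Real.pi * u) ≤ Real.pi * u := Real.sin_le (by positivity)
  have hs2 : Real.sin (Real.pi * u) ≤ Real.pi * (1 - u) := by
    have : Real.sin (Real.pi * u) = Real.sin (Real.pi * (1 - u)) := by
      rw [← Real.sin_pi_sub]; congr 1; ring
    rw [this]; exact Real.sin_le (by nlinarith)
  have hu : 0 < 1 - u := by linarith
  rw [Finset.sum_range_succ', mul_add, lebesgueBound, add_comm]
  refine add_le_add ?_ ?_
  · have e : Real.sin (Real.pi * u) / Real.pi * (1 / (u + (0 : ℕ)) + 1 / (((0 : ℕ) : ℝ) + 1 - u))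
        = Real.sin (Real.pi * u) / (Real.pi * u)
          + Real.sin (Real.pi * u) / (Real.pi * (1 - u)) := by
      simp only [Nat.cast_zero, add_zero, zero_add]
      field_simp
    rw [e]
    have a1 := (div_le_one (by positivity : 0 < Real.pi * u)).2 hs1
    have a2 := (div_le_one (by positivity : 0 < Real.pi * (1 - u))).2 hs2
    linarith
  · refine mul_le_mul (by gcongr; exact Real.sin_le_one _) (Finset.sum_le_sum fun j _ => ?_)
      (Finset.sum_nonneg fun j _ => ?_) (by positivity)
    · have hj : (0 : ℝ) ≤ j := Nat.cast_nonneg j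
      push_cast
      have p1 : 0 < u + ((j : ℝ) + 1) := by positivity
      have p2 : 0 < (j : ℝ) + 1 + 1 - u := by linarith
      rw [div_add_div _ _ p1.ne' p2.ne', div_add_div _ _ (by positivity) (by positivity),
        div_le_div_iff₀ (by positivity) (by positivity)]
      have : ((j : ℝ) + 1) * (j + 2) ≤ (u + (j + 1)) * (j + 1 + 1 - u) := by nlinarith
      nlinarith
    · have hj : (0 : ℝ) ≤ j := Nat.cast_nonneg j
      have p2 : 0 < ((j + 1 : ℕ) : ℝ) + 1 - u := by push_cast; linarith
      positivity

theorem one_le_lebesgueBound (m : ℕ) : 1 ≤ lebesgueBound m := by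
  have : 0 ≤ 1 / Real.pi * ∑ j ∈ Finset.range m, (1 / ((j : ℝ) + 1) + 1 / ((j : ℝ) + 2)) := by
    have := Real.pi_pos
    positivity
  unfold lebesgueBound; linarith

/-- The $2(m+1)$ angles are equally spaced modulo $2\pi$. Centring them at $\varphi$ makes the
distances $(u+j)$ and $(j+1-u)$ times the mesh width, and the cosine in front is $\sin(\pi u)$ up to
sign. -/
theorem sum_absHalfCot_le (m : ℕ) {φ : ℝ} (hφ : Real.cos (((m : ℝ) + 1) * φ) ≠ 0) :
    |Real.cos (((m : ℝ) + 1) * φ)| / (2 * ((m : ℝ) + 1)) *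
      ∑ k ∈ Finset.range (2 * (m + 1)), absHalfCot (chebAngle m k - φ) ≤ lebesgueBound m := by
  have hpi := Real.pi_pos
  have hm : (0 : ℝ) < (m : ℝ) + 1 := by positivity
  set h : ℤ → ℝ := fun k =>
    absHalfCot ((2 * (k : ℝ) + 1) * Real.pi / (2 * ((m : ℝ) + 1)) - φ) with hh
  have hper : ∀ k, h (k + (2 * (m + 1) : ℕ)) = h k := by
    intro k
    simp only [hh]
    refine Eq.trans ?_ (absHalfCot_add_two_pi _)
    congr 1
    push_cast
    field_simp
    ring
  -- `k₀` indexes the first angle that is not smaller than $\varphi$, and `u` is its distance from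
  -- $\varphi$ in units of the mesh width $\pi/(m+1)$.
  set k₀ : ℤ := ⌈((m : ℝ) + 1) * φ / Real.pi - 1 / 2⌉ with hk₀
  set u : ℝ := k₀ + 1 / 2 - ((m : ℝ) + 1) * φ / Real.pi with hu
  have hcos : |Real.cos (((m : ℝ) + 1) * φ)| = |Real.sin (Real.pi * u)| := by
    have : ((m : ℝ) + 1) * φ = (Real.pi / 2 - Real.pi * u) + k₀ * Real.pi := by
      rw [hu]; field_simp; ring
    rw [this, Real.cos_add_int_mul_pi, abs_mul, abs_zpow, abs_neg, abs_one, one_zpow, one_mul,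
      Real.cos_pi_div_two_sub]
  have hu0 : 0 ≤ u := by have := Int.le_ceil (((m : ℝ) + 1) * φ / Real.pi - 1 / 2); linarith
  have hu1 : u < 1 := by
    have := Int.ceil_lt_add_one (((m : ℝ) + 1) * φ / Real.pi - 1 / 2); linarith
  have hu0 : 0 < u := by
    refine hu0.lt_of_ne fun h0 => ?_
    rw [← h0] at hcos
    simp at hcos
    exact hφ hcos
  have hsum : ∑ k ∈ Finset.range (2 * (m + 1)), absHalfCot (chebAngle m k - φ)
      = ∑ j ∈ Finset.range (m + 1), (h (k₀ + j) + h (k₀ - 1 - j)) := by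
    have e1 : ∑ k ∈ Finset.range (2 * (m + 1)), absHalfCot (chebAngle m k - φ)
        = ∑ k ∈ Finset.range (2 * (m + 1)), h k :=
      Finset.sum_congr rfl fun k _ => by simp [hh, chebAngle]
    rw [e1, ← sum_range_periodic hper (k₀ - (m + 1 : ℕ)), two_mul, Finset.sum_range_add,
      Finset.sum_add_distrib, add_comm]
    congr 1
    · refine Finset.sum_congr rfl fun j _ => ?_
      congr 1; push_cast; ring
    · rw [← Finset.sum_range_reflect]
      refine Finset.sum_congr rfl fun j hj => ?_
      have := Finset.mem_range.1 hj
      congr 1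
      omega
  have hbd : ∀ j ∈ Finset.range (m + 1), h (k₀ + j) + h (k₀ - 1 - j)
      ≤ 2 * ((m : ℝ) + 1) / Real.pi * (1 / (u + j) + 1 / ((j : ℝ) + 1 - u)) := by
    intro j hj
    have hj' : (j : ℝ) + 1 ≤ m + 1 := by exact_mod_cast Finset.mem_range.1 hj
    have hj0 : (0 : ℝ) ≤ j := Nat.cast_nonneg j
    have p1 : 0 < u + j := by positivity
    have p2 : 0 < (j : ℝ) + 1 - u := by linarith
    have e1 : h (k₀ + j) = absHalfCot ((u + j) * Real.pi / ((m : ℝ) + 1)) := by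
      simp only [hh]
      congr 1
      rw [hu]; push_cast; field_simp; ring
    have e2 : h (k₀ - 1 - j) = absHalfCot (((j : ℝ) + 1 - u) * Real.pi / ((m : ℝ) + 1)) := by
      rw [← absHalfCot_neg]
      simp only [hh]
      congr 1
      rw [hu]; push_cast; field_simp; ring
    have b1 : absHalfCot ((u + j) * Real.pi / ((m : ℝ) + 1))
        ≤ 2 / ((u + j) * Real.pi / ((m : ℝ) + 1)) :=
      absHalfCot_le (by positivity) (by rw [div_le_iff₀ hm]; nlinarith)
    have b2 : absHalfCot (((j : ℝ) + 1 - u) * Real.pi / ((m : ℝ) + 1))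
        ≤ 2 / (((j : ℝ) + 1 - u) * Real.pi / ((m : ℝ) + 1)) :=
      absHalfCot_le (by positivity) (by rw [div_le_iff₀ hm]; nlinarith)
    rw [e1, e2]
    refine (add_le_add b1 b2).trans (le_of_eq ?_)
    field_simp
  rw [hsum, hcos]
  have hs0 : 0 ≤ Real.sin (Real.pi * u) :=
    Real.sin_nonneg_of_nonneg_of_le_pi (by positivity) (by nlinarith)
  rw [abs_of_nonneg hs0]
  refine (mul_le_mul_of_nonneg_left (Finset.sum_le_sum hbd) (by positivity)).trans ?_
  rw [← Finset.mul_sum]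
  refine le_trans (le_of_eq ?_) (sin_mul_sum_le m hu0 hu1)
  field_simp

theorem sum_abs_chebLagrange_le (m : ℕ) (y : II) :
    ∑ k ∈ Finset.range (m + 1), |(chebLagrange m k).eval (y : ℝ)| ≤ lebesgueBound m := by
  obtain ⟨φ, hφ⟩ : ∃ φ, (y : ℝ) = -Real.cos φ :=
    ⟨Real.arccos (-y), by rw [Real.cos_arccos (by linarith [y.2.2]) (by linarith [y.2.1]), neg_neg]⟩
  -- At a node the quotient formula is not available, but there the basis polynomials take the
  -- values 0 and 1 and the sum is 1.
  by_cases hnode : ∃ i < m + 1, (y : ℝ) = chebNode m i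
  · obtain ⟨i, hi, hy⟩ := hnode
    have : ∑ k ∈ Finset.range (m + 1), |(chebLagrange m k).eval (y : ℝ)| = 1 := by
      rw [Finset.sum_eq_single_of_mem i (Finset.mem_range.2 hi)]
      · rw [hy, chebLagrange, Lagrange.eval_basis_self (v := fun i => (chebNode m i : ℝ))
          (chebNode_injOn m) (Finset.mem_range.2 hi), abs_one]
      · intro k _ hki
        rw [hy, chebLagrange, Lagrange.eval_basis_of_ne (v := fun i => (chebNode m i : ℝ)) hki
          (Finset.mem_range.2 hi), abs_zero]
    rw [this]; exact one_le_lebesgueBound m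
  · push Not at hnode
    have hne : ∀ i < m + 1, Real.cos φ ≠ Real.cos (chebAngle m i) := by
      intro i hi h
      exact hnode i hi (by rw [hφ, coe_chebNode, h])
    have hcos : Real.cos (((m : ℝ) + 1) * φ) ≠ 0 := by
      rw [← abs_ne_zero, ← abs_eval_T_neg_cos, abs_ne_zero]
      obtain ⟨c, hc, hT⟩ := exists_T_eq_C_mul_nodal m
      rw [hT, eval_mul, eval_C, Lagrange.eval_nodal]
      refine mul_ne_zero hc (Finset.prod_ne_zero_iff.2 fun i hi => sub_ne_zero.2 ?_)
      rw [← hφ]; exact hnode i (Finset.mem_range.1 hi)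
    have hm : (0 : ℝ) < (m : ℝ) + 1 := by positivity
    refine le_trans ?_ (sum_absHalfCot_le m hcos)
    have key : ∀ k ∈ Finset.range (m + 1), |(chebLagrange m k).eval (y : ℝ)| ≤
        |Real.cos (((m : ℝ) + 1) * φ)| / (2 * ((m : ℝ) + 1)) *
          (absHalfCot (chebAngle m k - φ) + absHalfCot (chebAngle m k + φ)) := by
      intro k hk
      have hk := Finset.mem_range.1 hk
      rw [hφ, abs_eval_chebLagrange hk (hne k hk)]
      have := sin_div_abs_cos_sub_cos_le (Real.sin_pos_of_pos_of_lt_pi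
        (chebAngle_mem_Ioo hk).1 (chebAngle_mem_Ioo hk).2).le (hne k hk)
      refine (mul_le_mul_of_nonneg_left this (by positivity)).trans (le_of_eq ?_)
      field_simp
    -- Modulo $2\pi$ the negatives of the $m+1$ node angles are the next $m+1$ angles of the same
    -- progression, so both families of cotangents form one sum over the full circle.
    have hrefl : ∑ k ∈ Finset.range (m + 1), absHalfCot (chebAngle m k + φ)
        = ∑ k ∈ Finset.range (m + 1), absHalfCot (chebAngle m (m + 1 + k) - φ) := by
      rw [← Finset.sum_range_reflect (fun k => absHalfCot (chebAngle m k + φ))]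
      refine Finset.sum_congr rfl fun k hk => ?_
      have hk := Finset.mem_range.1 hk
      rw [← absHalfCot_neg (chebAngle m (m + 1 - 1 - k) + φ)]
      refine (absHalfCot_add_two_pi _).symm.trans ?_
      congr 1
      have hc : ((m + 1 - 1 - k : ℕ) : ℝ) = (m : ℝ) - k := by
        rw [Nat.add_sub_cancel, Nat.cast_sub (by omega)]
      unfold chebAngle
      rw [hc]
      push_cast
      field_simp
      ring
    refine (Finset.sum_le_sum key).trans (le_of_eq ?_)
    rw [← Finset.mul_sum, Finset.sum_add_distrib, two_mul (m + 1),
      Finset.sum_range_add _ (m + 1), hrefl]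

/-- The right-hand side is shaped for the induction in `one_add_two_mul_sum_interpBound_le`: it lies
below the increment from $k$ to $k+1$ of $(k+1)\log(2k+3)$. -/
theorem lebesgueBound_le {k : ℕ} (hk : 1 ≤ k) :
    lebesgueBound k ≤ Real.log (2 * k + 5) + 2 * (k + 1) / (2 * k + 5) := by
  have hpi : 1 / Real.pi ≤ 1 / 3 := one_div_le_one_div_of_le (by norm_num) Real.pi_gt_three.le
  induction k, hk using Nat.le_induction with
  | base =>
    have h8 : Real.log 8 = 3 * Real.log 2 := by
      rw [show (8 : ℝ) = 2 ^ 3 by norm_num, Real.log_pow]; norm_num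
    have h87 : Real.log 8 - Real.log 7 ≤ 1 / 7 := by
      rw [← Real.log_div (by norm_num) (by norm_num)]
      refine (Real.log_le_sub_one_of_pos (by norm_num)).trans (by norm_num)
    have h2 := Real.log_two_gt_d9
    simp only [lebesgueBound, Finset.sum_range_one]
    norm_num
    norm_num at hpi
    linarith
  | succ k hk ih =>
    have hk' : (1 : ℝ) ≤ k := by exact_mod_cast hk
    have hL : lebesgueBound (k + 1)
        = lebesgueBound k + 1 / Real.pi * (1 / ((k : ℝ) + 1) + 1 / ((k : ℝ) + 2)) := by
      simp only [lebesgueBound, Finset.sum_range_succ]; ring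
    have hlog : 2 / (2 * (k : ℝ) + 7) ≤ Real.log (2 * k + 7) - Real.log (2 * k + 5) := by
      rw [← Real.log_div (by positivity) (by positivity)]
      refine le_trans (le_of_eq ?_) (Real.one_sub_inv_le_log_of_pos (by positivity))
      field_simp
      ring
    have hrat : 1 / 3 * (1 / ((k : ℝ) + 1) + 1 / ((k : ℝ) + 2))
        ≤ 2 / (2 * (k : ℝ) + 7) + (2 * ((k : ℝ) + 2) / (2 * k + 7) - 2 * (k + 1) / (2 * k + 5)) := by
      -- In terms of $t=k-1\ge0$ the numerator of the difference has only positive coefficients.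
      obtain ⟨t, ht, hkt⟩ : ∃ t : ℝ, 0 ≤ t ∧ (k : ℝ) = t + 1 := ⟨k - 1, by linarith, by ring⟩
      rw [hkt, ← sub_nonneg]
      have : 2 / (2 * (t + 1) + 7) + (2 * (t + 1 + 2) / (2 * (t + 1) + 7)
          - 2 * (t + 1 + 1) / (2 * (t + 1) + 5)) - 1 / 3 * (1 / (t + 1 + 1) + 1 / (t + 1 + 2))
          = (4 * t ^ 3 + 36 * t ^ 2 + 86 * t + 45) /
            (3 * (2 * t + 9) * (2 * t + 7) * (t + 2) * (t + 3)) := by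
        field_simp
        ring
      rw [this]
      positivity
    have hmul := mul_le_mul_of_nonneg_right hpi
      (by positivity : 0 ≤ 1 / ((k : ℝ) + 1) + 1 / ((k : ℝ) + 2))
    rw [hL]
    push_cast
    rw [show 2 * ((k : ℝ) + 1) + 5 = 2 * k + 7 by ring, show (k : ℝ) + 1 + 1 = k + 2 by ring]
    linarith

/-- A bound for the interpolation operators that is sharp for `I_0`. -/
noncomputable def interpBound (m : ℕ) : ℝ := if m = 0 then 1 else lebesgueBound m

theorem sum_abs_chebLagrange_le_interpBound (m : ℕ) (y : II) :
    ∑ k ∈ Finset.range (m + 1), |(chebLagrange m k).eval (y : ℝ)| ≤ interpBound m := by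
  unfold interpBound
  split_ifs with hm
  · subst hm
    simp [chebLagrange]
  · exact sum_abs_chebLagrange_le m y

theorem one_add_two_mul_sum_interpBound_le {k : ℕ} (hk : 1 ≤ k) :
    1 + 2 * ∑ m ∈ Finset.range k, interpBound m
      ≤ 2 * ((k : ℝ) + 1) * Real.log (2 * k + 3) := by
  induction k, hk using Nat.le_induction with
  | base =>
    have : 1 ≤ Real.log 5 := by
      rw [Real.le_log_iff_exp_le (by norm_num)]
      linarith [Real.exp_one_lt_d9]
    simp [interpBound]
    norm_num
    linarith
  | succ k hk ih =>
    have hk0 : k ≠ 0 := by omega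
    have hL := lebesgueBound_le hk
    have hlog : 2 / (2 * (k : ℝ) + 5) ≤ Real.log (2 * k + 5) - Real.log (2 * k + 3) := by
      rw [← Real.log_div (by positivity) (by positivity)]
      refine le_trans (le_of_eq ?_) (Real.one_sub_inv_le_log_of_pos (by positivity))
      field_simp
      ring
    have hmul := mul_le_mul_of_nonneg_left hlog (by positivity : 0 ≤ (k : ℝ) + 1)
    have e : ((k : ℝ) + 1) * (2 / (2 * (k : ℝ) + 5)) = 2 * (k + 1) / (2 * k + 5) := by ring
    rw [e] at hmul
    rw [Finset.sum_range_succ, interpBound, if_neg hk0]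
    push_cast
    rw [show 2 * ((k : ℝ) + 1) + 3 = 2 * k + 5 by ring]
    nlinarith

/-! ### Univariate interpolation of polynomials -/

/-- The Chebyshev interpolation operator on polynomials. -/
noncomputable def polyInterp (m : ℕ) (p : ℝ[X]) : ℝ[X] :=
  ∑ k ∈ Finset.range (m + 1), C (p.eval (chebNode m k : ℝ)) * chebLagrange m k

/-- The increments of the Chebyshev interpolation operators on polynomials. -/
noncomputable def polyIncr : ℕ → ℝ[X] → ℝ[X]
  | 0, p => polyInterp 0 p
  | m + 1, p => polyInterp (m + 1) p - polyInterp m p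

theorem polyInterp_eq_self {m : ℕ} {p : ℝ[X]} (hp : p.natDegree ≤ m) : polyInterp m p = p := by
  have h := Lagrange.eq_interpolate (f := p) (chebNode_injOn m)
    (by
      rw [Finset.card_range]
      exact (degree_le_natDegree).trans_lt (by exact_mod_cast Nat.lt_succ_of_le hp))
  rw [Lagrange.interpolate_apply] at h
  exact h.symm

theorem polyIncr_eq_zero {m : ℕ} {p : ℝ[X]} (hp : p.natDegree < m) : polyIncr m p = 0 := by
  cases m with
  | zero => omega
  | succ m => rw [polyIncr, polyInterp_eq_self (by omega), polyInterp_eq_self (by omega), sub_self]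

theorem polyIncr_zero_one : polyIncr 0 1 = 1 := polyInterp_eq_self (by simp)

theorem sum_polyIncr (k : ℕ) (p : ℝ[X]) :
    ∑ m ∈ Finset.range (k + 1), polyIncr m p = polyInterp k p := by
  induction k with
  | zero => simp [polyIncr]
  | succ k ih => rw [Finset.sum_range_succ, ih, polyIncr]; ring

theorem sum_polyIncr_eq_self {k : ℕ} {p : ℝ[X]} (hp : p.natDegree ≤ k) :
    ∑ m ∈ Finset.range (k + 1), polyIncr m p = p := by
  rw [sum_polyIncr, polyInterp_eq_self hp]

theorem abs_eval_polyInterp_le (m : ℕ) {p : ℝ[X]} {M : ℝ} (hM : ∀ y : II, |p.eval (y : ℝ)| ≤ M)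
    (y : II) : |(polyInterp m p).eval (y : ℝ)| ≤ interpBound m * M := by
  rw [polyInterp, eval_finsetSum]
  refine (Finset.abs_sum_le_sum_abs _ _).trans ?_
  have h0 : 0 ≤ M := (abs_nonneg _).trans (hM y)
  refine le_trans ?_ (mul_le_mul_of_nonneg_right (sum_abs_chebLagrange_le_interpBound m y) h0)
  rw [Finset.sum_mul]
  refine Finset.sum_le_sum fun k _ => ?_
  rw [eval_mul, eval_C, abs_mul, mul_comm]
  exact mul_le_mul_of_nonneg_left (hM _) (abs_nonneg _)

/-- Each $I_m$ with $m<k$ occurs in two increments, $I_k$ in only one. This matters because $I_k$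
reproduces polynomials of degree $k$ and costs no Lebesgue constant. -/
theorem sum_abs_eval_polyIncr_le (k : ℕ) (p : ℝ[X]) (y : ℝ) :
    ∑ m ∈ Finset.range (k + 1), |(polyIncr m p).eval y|
      ≤ 2 * ∑ m ∈ Finset.range k, |(polyInterp m p).eval y| + |(polyInterp k p).eval y| := by
  induction k with
  | zero => simp [polyIncr]
  | succ k ih =>
    rw [Finset.sum_range_succ, Finset.sum_range_succ (fun m => |(polyInterp m p).eval y|) k,
      polyIncr, eval_sub]
    have := abs_sub (eval y (polyInterp (k + 1) p)) (eval y (polyInterp k p))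
    linarith

/-! ### Jacobi polynomials -/

section Jacobi

variable {a b : ℝ}

theorem integrable_jacobiMeasure (ha : -1 < a) (hb : -1 < b) {f : II → ℝ} (hf : Continuous f) :
    Integrable f (jacobiMeasure a b) := by
  have := isProbabilityMeasure_jacobiMeasure ha hb
  exact hf.integrable_of_hasCompactSupport (HasCompactSupport.of_compactSpace f)

theorem continuous_eval_coe (p : ℝ[X]) : Continuous fun y : II => p.eval (y : ℝ) :=
  p.continuous.comp continuous_subtype_val

theorem jacobiPairing_comm (p q : ℝ[X]) : jacobiPairing a b p q = jacobiPairing a b q p := by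
  simp only [jacobiPairing, mul_comm]

theorem jacobiPairing_C_mul (c : ℝ) (p q : ℝ[X]) :
    jacobiPairing a b (C c * p) q = c * jacobiPairing a b p q := by
  simp only [jacobiPairing, eval_mul, eval_C, mul_assoc]
  exact integral_const_mul _ _

theorem jacobiPairing_sub_sum (ha : -1 < a) (hb : -1 < b) {ι : Type*} (s : Finset ι) (p r : ℝ[X])
    (c : ι → ℝ) (q : ι → ℝ[X]) :
    jacobiPairing a b (p - ∑ i ∈ s, C (c i) * q i) r
      = jacobiPairing a b p r - ∑ i ∈ s, c i * jacobiPairing a b (q i) r := by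
  have hI : ∀ p q : ℝ[X], Integrable (fun y : II => p.eval (y : ℝ) * q.eval (y : ℝ))
      (jacobiMeasure a b) := fun p q =>
    integrable_jacobiMeasure ha hb ((continuous_eval_coe p).mul (continuous_eval_coe q))
  simp only [← jacobiPairing_C_mul]
  simp only [jacobiPairing, eval_sub, eval_finsetSum, sub_mul, Finset.sum_mul]
  rw [integral_sub (hI _ _) (integrable_finsetSum _ fun i _ => hI _ _),
    integral_finsetSum _ fun i _ => hI _ _]

theorem jacobiMeasure_finite_eq_zero {s : Set II} (hs : s.Finite) : jacobiMeasure a b s = 0 := by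
  have h : ((volume : Measure ℝ).comap ((↑) : II → ℝ)) s = 0 := by
    rw [(MeasurableEmbedding.subtype_coe measurableSet_Icc).comap_apply]
    exact (hs.image _).measure_zero _
  exact withDensity_absolutelyContinuous _ _ h

/-- A nonzero polynomial has finitely many zeros, and finite sets are null for a measure with a
density. -/
theorem jacobiPairing_self_pos (ha : -1 < a) (hb : -1 < b) {p : ℝ[X]} (hp : p ≠ 0) :
    0 < jacobiPairing a b p p := by
  have := isProbabilityMeasure_jacobiMeasure ha hb
  have hcont := (continuous_eval_coe p).mul (continuous_eval_coe p)
  have h0 : 0 ≤ fun y : II => p.eval (y : ℝ) * p.eval (y : ℝ) := fun y => mul_self_nonneg _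
  refine (integral_nonneg h0).lt_of_ne fun h => ?_
  have h1 := (integral_eq_zero_iff_of_nonneg h0 (integrable_jacobiMeasure ha hb hcont)).1 h.symm
  have hfin : {y : II | p.eval (y : ℝ) = 0}.Finite := by
    refine Set.Finite.of_finite_image (f := ((↑) : II → ℝ)) ?_ Subtype.val_injective.injOn
    refine (p.roots.toFinset.finite_toSet).subset ?_
    rintro _ ⟨y, hy, rfl⟩
    simpa [hp] using hy
  have h2 : jacobiMeasure a b {y : II | p.eval (y : ℝ) = 0}ᶜ = 0 := by
    refine measure_mono_null (fun y hy => ?_) h1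
    simpa using hy
  have h3 : jacobiMeasure a b Set.univ = 0 := by
    rw [← Set.union_compl_self {y : II | p.eval (y : ℝ) = 0}]
    exact measure_union_null (jacobiMeasure_finite_eq_zero hfin) h2
  rw [measure_univ] at h3
  exact one_ne_zero h3

theorem monic_and_natDegree_jacobiMonic (a b : ℝ) (k : ℕ) :
    (jacobiMonic a b k).Monic ∧ (jacobiMonic a b k).natDegree = k := by
  induction k using Nat.strong_induction_on with
  | _ k ih =>
    have hlt : (-∑ i : Fin k,
        C (jacobiPairing a b (X ^ k) (jacobiMonic a b i) /
          jacobiPairing a b (jacobiMonic a b i) (jacobiMonic a b i)) * jacobiMonic a b i).degree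
        < k := by
      rw [degree_neg]
      refine (degree_sum_le _ _).trans_lt ((Finset.sup_lt_iff (WithBot.bot_lt_coe k)).2
        fun i _ => ?_)
      rw [← smul_eq_C_mul]
      refine (degree_smul_le _ _).trans_lt ?_
      rw [degree_eq_natDegree (ih i i.2).1.ne_zero, (ih i i.2).2]
      exact Nat.cast_lt.2 i.2
    have hm : (jacobiMonic a b k).Monic := by
      rw [jacobiMonic, sub_eq_add_neg]; exact monic_X_pow_add hlt
    refine ⟨hm, ?_⟩
    have : (jacobiMonic a b k).degree = k := by
      rw [jacobiMonic, sub_eq_add_neg, degree_add_eq_left_of_degree_lt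
        (by rw [degree_X_pow]; exact hlt), degree_X_pow]
    exact natDegree_eq_of_degree_eq_some this

theorem jacobiPairing_monic_of_lt (ha : -1 < a) (hb : -1 < b) {k i : ℕ} (hi : i < k) :
    jacobiPairing a b (jacobiMonic a b k) (jacobiMonic a b i) = 0 := by
  induction k using Nat.strong_induction_on generalizing i with
  | _ k ih =>
    rw [jacobiMonic, jacobiPairing_sub_sum ha hb, Finset.sum_eq_single (⟨i, hi⟩ : Fin k)]
    · rw [div_mul_cancel₀ _ (jacobiPairing_self_pos ha hb
        (monic_and_natDegree_jacobiMonic a b i).1.ne_zero).ne', sub_self]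
    · intro j _ hj
      have hj' : (j : ℕ) ≠ i := fun h => hj (Fin.ext h)
      rcases lt_or_gt_of_ne hj' with h | h
      · rw [jacobiPairing_comm (jacobiMonic a b j) (jacobiMonic a b i), ih i hi h, mul_zero]
      · rw [ih j j.2 h, mul_zero]
    · simp

theorem jacobiPairing_jacobi (ha : -1 < a) (hb : -1 < b) (k i : ℕ) :
    jacobiPairing a b (jacobi a b k) (jacobi a b i) = if k = i then 1 else 0 := by
  rw [jacobi, jacobi, jacobiPairing_C_mul, jacobiPairing_comm (jacobiMonic a b k) (C _ * _),
    jacobiPairing_C_mul]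
  split_ifs with h
  · subst h
    have hp := jacobiPairing_self_pos ha hb (monic_and_natDegree_jacobiMonic a b k).1.ne_zero
    have := Real.mul_self_sqrt hp.le
    have hs := Real.sqrt_pos.2 hp
    field_simp
    rw [sq, this]
  · rcases lt_or_gt_of_ne h with h | h
    · rw [jacobiPairing_monic_of_lt ha hb h]; simp
    · rw [jacobiPairing_comm (jacobiMonic a b i) (jacobiMonic a b k),
        jacobiPairing_monic_of_lt ha hb h]
      simp

theorem jacobi_zero (ha : -1 < a) (hb : -1 < b) : jacobi a b 0 = 1 := by
  have := isProbabilityMeasure_jacobiMeasure ha hb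
  have : jacobiMonic a b 0 = 1 := by rw [jacobiMonic]; simp
  simp [jacobi, this, jacobiPairing]

theorem natDegree_jacobi (ha : -1 < a) (hb : -1 < b) (k : ℕ) : (jacobi a b k).natDegree = k := by
  have hp := jacobiPairing_self_pos ha hb (monic_and_natDegree_jacobiMonic a b k).1.ne_zero
  rw [jacobi, natDegree_C_mul (one_div_ne_zero (Real.sqrt_pos.2 hp).ne'),
    (monic_and_natDegree_jacobiMonic a b k).2]

/-- Every polynomial of degree at most `n` is a combination of the Jacobi polynomials of degree
at most `n`. -/
theorem exists_eq_sum_jacobi (ha : -1 < a) (hb : -1 < b) {n : ℕ} {p : ℝ[X]}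
    (hp : p.natDegree ≤ n) :
    ∃ c : ℕ → ℝ, p = ∑ i ∈ Finset.range (n + 1), C (c i) * jacobi a b i := by
  induction n generalizing p with
  | zero =>
    obtain ⟨x, rfl⟩ := natDegree_eq_zero.1 (Nat.le_zero.1 hp)
    exact ⟨fun _ => x, by simp [jacobi_zero ha hb]⟩
  | succ n ih =>
    have hl : (jacobi a b (n + 1)).coeff (n + 1) ≠ 0 := by
      have h := natDegree_jacobi ha hb (n + 1)
      have h0 : jacobi a b (n + 1) ≠ 0 := by
        intro h0; rw [h0] at h; simp at h
      have := leadingCoeff_ne_zero.2 h0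
      rwa [leadingCoeff, h] at this
    set x := p.coeff (n + 1) / (jacobi a b (n + 1)).coeff (n + 1) with hx
    have hd : (p - C x * jacobi a b (n + 1)).natDegree ≤ n := by
      rw [natDegree_le_iff_coeff_eq_zero]
      intro N hN
      rw [coeff_sub, coeff_C_mul]
      rcases (Nat.succ_le_of_lt hN).eq_or_lt with h | h
      · rw [← h, hx, Nat.succ_eq_add_one, div_mul_cancel₀ _ hl, sub_self]
      · rw [coeff_eq_zero_of_natDegree_lt (hp.trans_lt h), coeff_eq_zero_of_natDegree_lt
          (by rw [natDegree_jacobi ha hb]; exact h)]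
        simp
    obtain ⟨c, hc⟩ := ih hd
    refine ⟨fun i => if i = n + 1 then x else c i, ?_⟩
    simp only [Finset.sum_range_succ _ (n + 1), if_true]
    rw [← sub_eq_iff_eq_add, hc]
    refine Finset.sum_congr rfl fun i hi => ?_
    rw [if_neg (by have := Finset.mem_range.1 hi; omega)]

end Jacobi

theorem jacobiTheta0_nonneg (a b : ℕ → ℝ) : 0 ≤ jacobiTheta0 a b := by
  have := le_max_right (max (⨆ j, a j) (⨆ j, b j)) (-1 / 2)
  unfold jacobiTheta0
  linarith

section Admissible

variable {a b : ℕ → ℝ} {ε Cε : ℝ}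

/-- The factor $2(k+1)\log(2k+3)$ from the Lebesgue constants meets the bound $(C_\varepsilon
k+1)^{\theta_0+\varepsilon}/(2\log(2k+3))$ for $J_k$. The remaining $k+1$ raises the exponent by one
and replaces $C_\varepsilon$ by $C_\varepsilon+1$. For $k=0$ both sides equal 1, so unused variables
contribute nothing. -/
theorem sum_abs_polyIncr_jacobi_le (hε : 0 < ε) (hCε : IsAdmissibleConst a b ε Cε)
    (ha : ∀ j, -1 < a j) (hb : ∀ j, -1 < b j) (j k : ℕ) (y : II) :
    ∑ m ∈ Finset.range (k + 1), |(polyIncr m (jacobi (a j) (b j) k)).eval (y : ℝ)|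
      ≤ (1 + (Cε + 1) * k) ^ (jacobiTheta0 a b + 1 + ε) := by
  have hC := hCε.1
  have hθ := jacobiTheta0_nonneg a b
  rcases Nat.eq_zero_or_pos k with rfl | hk
  · simp [jacobi_zero (ha j) (hb j), polyIncr_zero_one]
  · have hk' : (1 : ℝ) ≤ k := by exact_mod_cast hk
    have hl : 0 < Real.log (2 * k + 3) := Real.log_pos (by linarith)
    set R := (Cε * (k : ℝ) + 1) ^ (jacobiTheta0 a b + ε) with hR
    have hM : ∀ y : II, |(jacobi (a j) (b j) k).eval (y : ℝ)| ≤ R / (2 * Real.log (2 * k + 3)) := by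
      intro y
      rw [le_div_iff₀ (by positivity)]
      linarith [hCε.2 j k hk y]
    set M := R / (2 * Real.log (2 * k + 3)) with hMdef
    have hR0 : 0 ≤ R := by positivity
    have hM0 : 0 ≤ M := by positivity
    have hdeg := natDegree_jacobi (ha j) (hb j) k
    have h1 := sum_abs_eval_polyIncr_le k (jacobi (a j) (b j) k) (y : ℝ)
    rw [polyInterp_eq_self hdeg.le] at h1
    have h2 : ∑ m ∈ Finset.range k, |(polyInterp m (jacobi (a j) (b j) k)).eval (y : ℝ)|
        ≤ (∑ m ∈ Finset.range k, interpBound m) * M := by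
      rw [Finset.sum_mul]
      exact Finset.sum_le_sum fun m _ => abs_eval_polyInterp_le m hM y
    have h3 := mul_le_mul_of_nonneg_right (one_add_two_mul_sum_interpBound_le hk) hM0
    have h4 : 2 * ((k : ℝ) + 1) * Real.log (2 * k + 3) * M = (k + 1) * R := by
      rw [hMdef]; field_simp
    have h5 := hM y
    have h6 : ((k : ℝ) + 1) * R ≤ (1 + (Cε + 1) * k) ^ (jacobiTheta0 a b + 1 + ε) := by
      have e : jacobiTheta0 a b + 1 + ε = 1 + (jacobiTheta0 a b + ε) := by ring
      rw [e, Real.rpow_add (by positivity), Real.rpow_one]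
      refine mul_le_mul (by nlinarith) (Real.rpow_le_rpow (by positivity) (by nlinarith)
        (by linarith)) hR0 (by positivity)
    nlinarith

end Admissible

/-! ### Increments of tensor product polynomials -/

/-- The multi-indices below $\nu$ form a product of intervals over the support of $\nu$, so the
identity is distributivity. -/
theorem sum_Iic_prod {R : Type*} [CommSemiring R] (ν : MultiIdx) (g : ℕ → ℕ → R) :
    ∑ μ ∈ Finset.Iic ν, ∏ j ∈ ν.support, g j (μ j)
      = ∏ j ∈ ν.support, ∑ k ∈ Finset.range (ν j + 1), g j k := by
  classical
  have h : Finset.Iic ν = ν.support.finsupp fun j => Finset.range (ν j + 1) := by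
    ext μ
    rw [Finset.mem_Iic, Finset.mem_finsupp_iff]
    constructor
    · intro h
      refine ⟨fun j hj => ?_, fun j _ => Finset.mem_range.2 (Nat.lt_succ_of_le (h j))⟩
      have := h j
      simp only [Finsupp.mem_support_iff] at hj ⊢
      omega
    · rintro ⟨h1, h2⟩ j
      by_cases hj : j ∈ ν.support
      · exact Nat.lt_succ_iff.1 (Finset.mem_range.1 (h2 j hj))
      · rw [Finsupp.notMem_support_iff.1 (fun h => hj (h1 h))]
        exact Nat.zero_le _
  rw [h, Finset.finsupp, Finset.sum_map, Finset.prod_sum]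
  refine Finset.sum_congr (by congr!) fun p _ => ?_
  rw [← Finset.prod_attach]
  refine Finset.prod_congr rfl fun j _ => ?_
  simp only [Function.Embedding.coeFn_mk]
  rw [Finsupp.indicator_of_mem j.2]

theorem jacobiTensor_eq_prod {a b : ℕ → ℝ} (ha : ∀ j, -1 < a j) (hb : ∀ j, -1 < b j)
    {ν : MultiIdx} {S : Finset ℕ} (hS : ν.support ⊆ S) (y : IIinf) :
    jacobiTensor a b ν y = ∏ j ∈ S, (jacobi (a j) (b j) (ν j)).eval (y j : ℝ) := by
  rw [jacobiTensor, Finsupp.prod]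
  refine Finset.prod_subset hS fun j _ hj => ?_
  rw [Finsupp.notMem_support_iff.1 hj, jacobi_zero (ha j) (hb j), eval_one]

section Tensor

variable {X : Type*} [AddCommGroup X] [Module ℝ X]

theorem interpAt_smul {j m : ℕ} (p : ℝ[X]) {h : IIinf → ℝ}
    (hh : ∀ y t, h (Function.update y j t) = h y) (x : X) :
    interpAt j m (fun y => (p.eval (y j : ℝ) * h y) • x)
      = fun y => ((polyInterp m p).eval (y j : ℝ) * h y) • x := by
  funext y
  simp only [interpAt, hh, Function.update_self, polyInterp, eval_finsetSum, eval_mul, eval_C,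
    Finset.sum_mul, Finset.sum_smul, smul_smul]
  refine Finset.sum_congr rfl fun k _ => ?_
  congr 1; ring

theorem deltaAt_smul {j m : ℕ} (p : ℝ[X]) {h : IIinf → ℝ}
    (hh : ∀ y t, h (Function.update y j t) = h y) (x : X) :
    deltaAt j m (fun y => (p.eval (y j : ℝ) * h y) • x)
      = fun y => ((polyIncr m p).eval (y j : ℝ) * h y) • x := by
  cases m with
  | zero => rw [deltaAt, interpAt_smul p hh]; rfl
  | succ m =>
    rw [deltaAt, interpAt_smul p hh, interpAt_smul p hh]
    funext y
    simp only [Pi.sub_apply, polyIncr, eval_sub, sub_mul, sub_smul]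

theorem foldl_deltaAt_prod (d : ℕ → ℕ) (S : Finset ℕ) (x : X) (l : List ℕ) (hl : l.Nodup)
    (hlS : ∀ j ∈ l, j ∈ S) (q : ℕ → ℝ[X]) :
    l.foldl (fun u j => deltaAt j (d j) u) (fun y => (∏ j ∈ S, (q j).eval (y j : ℝ)) • x)
      = fun y => (∏ j ∈ S, (if j ∈ l then polyIncr (d j) (q j) else q j).eval (y j : ℝ)) • x := by
  classical
  induction l generalizing q with
  | nil => simp
  | cons i l ih =>
    have hi : i ∈ S := hlS i (by simp)
    rw [List.nodup_cons] at hl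
    have e : ∀ q : ℕ → ℝ[X], (fun y : IIinf => (∏ j ∈ S, (q j).eval (y j : ℝ)) • x)
        = fun y => ((q i).eval (y i : ℝ) * ∏ j ∈ S.erase i, (q j).eval (y j : ℝ)) • x := by
      intro q; funext y
      rw [Finset.mul_prod_erase S (fun j => (q j).eval (y j : ℝ)) hi]
    have e2 : deltaAt i (d i) (fun y : IIinf => (∏ j ∈ S, (q j).eval (y j : ℝ)) • x)
        = fun y => (∏ j ∈ S,
          (Function.update q i (polyIncr (d i) (q i)) j).eval (y j : ℝ)) • x := by
      rw [e, deltaAt_smul, e]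
      · funext y
        rw [Function.update_self]
        congr 2
        refine Finset.prod_congr rfl fun j hj => ?_
        rw [Function.update_of_ne (Finset.ne_of_mem_erase hj)]
      · intro y t
        refine Finset.prod_congr rfl fun j hj => ?_
        rw [Function.update_of_ne (Finset.ne_of_mem_erase hj)]
    rw [List.foldl_cons, e2, ih hl.2 fun j hj => hlS j (by simp [hj])]
    funext y
    congr 1
    refine Finset.prod_congr rfl fun j _ => ?_
    congr 1
    by_cases hji : j = i
    · subst hji; simp [hl.1]
    · simp [hji]

/-- The increment `Δ_ν J_μ` of a tensor product Jacobi polynomial. -/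
noncomputable def jacobiIncr (a b : ℕ → ℝ) (ν μ : MultiIdx) (y : IIinf) : ℝ :=
  ∏ j ∈ ν.support ∪ μ.support, (polyIncr (ν j) (jacobi (a j) (b j) (μ j))).eval (y j : ℝ)

variable {a b : ℕ → ℝ}

theorem deltaTensor_jacobiTensor (ha : ∀ j, -1 < a j) (hb : ∀ j, -1 < b j) (ν μ : MultiIdx)
    (x : X) :
    deltaTensor ν (fun y => jacobiTensor a b μ y • x) = fun y => jacobiIncr a b ν μ y • x := by
  classical
  set S := ν.support ∪ μ.support with hS
  -- Freezing a coordinate at the only node of $I_0$ has the effect of $\Delta_0=I_0$ on the factor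
  -- in that variable.
  set q : ℕ → ℝ[X] := fun j => if j ∈ ν.support then jacobi (a j) (b j) (μ j)
    else polyIncr 0 (jacobi (a j) (b j) (μ j)) with hq
  have h0 : (fun y => jacobiTensor a b μ (freezeOutside ν.support y) • x)
      = fun y => (∏ j ∈ S, (q j).eval (y j : ℝ)) • x := by
    funext y
    rw [jacobiTensor_eq_prod ha hb (Finset.subset_union_right : μ.support ⊆ S)]
    congr 1
    refine Finset.prod_congr rfl fun j _ => ?_
    simp only [hq, freezeOutside]
    split_ifs with hj
    · rfl
    · simp [polyIncr, polyInterp, chebLagrange]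
  rw [deltaTensor, h0, foldl_deltaAt_prod _ _ _ _ (Finset.sort_nodup _ _)]
  · funext y
    congr 1
    refine Finset.prod_congr rfl fun j _ => ?_
    congr 1
    simp only [hq, Finset.mem_sort]
    split_ifs with hj
    · rfl
    · rw [Finsupp.notMem_support_iff.1 hj]
  · intro j hj
    exact Finset.mem_union_left _ ((Finset.mem_sort _).1 hj)

/-- In a coordinate with $\nu_j>\mu_j$ both $I_{\nu_j}$ and $I_{\nu_j-1}$ reproduce the factor of
degree $\mu_j$. -/
theorem jacobiIncr_eq_zero (ha : ∀ j, -1 < a j) (hb : ∀ j, -1 < b j) {ν μ : MultiIdx}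
    (h : ¬ν ≤ μ) (y : IIinf) : jacobiIncr a b ν μ y = 0 := by
  rw [Finsupp.le_def] at h
  push Not at h
  obtain ⟨j, hj⟩ := h
  refine Finset.prod_eq_zero (i := j) (Finset.mem_union_left _ ?_) ?_
  · rw [Finsupp.mem_support_iff]; omega
  · rw [polyIncr_eq_zero (by rwa [natDegree_jacobi (ha j) (hb j)]), eval_zero]

theorem jacobiIncr_of_le {ν μ : MultiIdx} (h : ν ≤ μ) (y : IIinf) :
    jacobiIncr a b ν μ y
      = ∏ j ∈ μ.support, (polyIncr (ν j) (jacobi (a j) (b j) (μ j))).eval (y j : ℝ) := by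
  rw [jacobiIncr, Finset.union_eq_right.2 (Finsupp.support_mono h)]

/-- The sum factorizes over the coordinates and telescopes in each of them to $I_{\mu_j}$, which
reproduces $J_{\mu_j}$. -/
theorem sum_jacobiIncr (ha : ∀ j, -1 < a j) (hb : ∀ j, -1 < b j) (μ : MultiIdx) (y : IIinf) :
    ∑ ν ∈ Finset.Iic μ, jacobiIncr a b ν μ y = jacobiTensor a b μ y := by
  rw [Finset.sum_congr rfl fun ν hν => jacobiIncr_of_le (Finset.mem_Iic.1 hν) y,
    sum_Iic_prod μ fun j k => (polyIncr k (jacobi (a j) (b j) (μ j))).eval (y j : ℝ)]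
  refine Finset.prod_congr rfl fun j _ => ?_
  rw [← eval_finsetSum, sum_polyIncr_eq_self (natDegree_jacobi (ha j) (hb j) _).le]

variable {ε Cε : ℝ}

theorem sum_abs_jacobiIncr_le (hε : 0 < ε) (hCε : IsAdmissibleConst a b ε Cε)
    (ha : ∀ j, -1 < a j) (hb : ∀ j, -1 < b j) (μ : MultiIdx) (y : IIinf) :
    ∑ ν ∈ Finset.Iic μ, |jacobiIncr a b ν μ y|
      ≤ pWeight (jacobiTheta0 a b + 1 + ε) (Cε + 1) μ := by
  have h : ∀ ν ∈ Finset.Iic μ, |jacobiIncr a b ν μ y|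
      = ∏ j ∈ μ.support, |(polyIncr (ν j) (jacobi (a j) (b j) (μ j))).eval (y j : ℝ)| :=
    fun ν hν => by rw [jacobiIncr_of_le (Finset.mem_Iic.1 hν), Finset.abs_prod]
  rw [Finset.sum_congr rfl h,
    sum_Iic_prod μ fun j k => |(polyIncr k (jacobi (a j) (b j) (μ j))).eval (y j : ℝ)|]
  exact Finset.prod_le_prod (fun j _ => Finset.sum_nonneg fun k _ => abs_nonneg _)
    fun j _ => sum_abs_polyIncr_jacobi_le hε hCε ha hb j _ _

theorem abs_jacobiTensor_le (hε : 0 < ε) (hCε : IsAdmissibleConst a b ε Cε)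
    (ha : ∀ j, -1 < a j) (hb : ∀ j, -1 < b j) (μ : MultiIdx) (y : IIinf) :
    |jacobiTensor a b μ y| ≤ pWeight (jacobiTheta0 a b + 1 + ε) (Cε + 1) μ := by
  rw [← sum_jacobiIncr ha hb]
  exact (Finset.abs_sum_le_sum_abs _ _).trans (sum_abs_jacobiIncr_le hε hCε ha hb μ y)

theorem one_le_pWeight {θ lam : ℝ} (hθ : 0 ≤ θ) (hlam : 0 ≤ lam) (ν : MultiIdx) :
    1 ≤ pWeight θ lam ν := by
  refine Finset.prod_induction _ (fun x => 1 ≤ x) (fun _ _ => one_le_mul_of_one_le_of_one_le)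
    le_rfl fun j _ => Real.one_le_rpow ?_ hθ
  have : 0 ≤ lam * (ν j : ℝ) := by positivity
  linarith

theorem continuous_jacobiTensor (a b : ℕ → ℝ) (ν : MultiIdx) :
    Continuous (jacobiTensor a b ν) :=
  continuous_finsetProd _ fun j _ => (continuous_eval_coe _).comp (continuous_apply j)

/-! ### Convergence of interpolants -/

theorem hasSum_deltaAt [TopologicalSpace X] [IsTopologicalAddGroup X] [ContinuousConstSMul ℝ X]
    {ι : Type*} {f : ι → IIinf → X} {g : IIinf → X} (h : ∀ y, HasSum (fun i => f i y) (g y))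
    (j m : ℕ) (y : IIinf) : HasSum (fun i => deltaAt j m (f i) y) (deltaAt j m g y) := by
  have hI : ∀ m, HasSum (fun i => interpAt j m (f i) y) (interpAt j m g y) := fun m =>
    hasSum_sum fun k _ => (h _).const_smul _
  cases m with
  | zero => exact hI 0
  | succ m => exact (hI (m + 1)).sub (hI m)

/-- $\Delta_\nu$ combines finitely many point evaluations, so pointwise convergence passes through
it. -/
theorem hasSum_deltaTensor [TopologicalSpace X] [IsTopologicalAddGroup X] [ContinuousConstSMul ℝ X]
    {ι : Type*} {f : ι → IIinf → X} {g : IIinf → X} (h : ∀ y, HasSum (fun i => f i y) (g y))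
    (ν : MultiIdx) (y : IIinf) :
    HasSum (fun i => deltaTensor ν (f i) y) (deltaTensor ν g y) := by
  have key : ∀ (l : List ℕ) (f : ι → IIinf → X) (g : IIinf → X),
      (∀ y, HasSum (fun i => f i y) (g y)) → ∀ y,
      HasSum (fun i => l.foldl (fun u j => deltaAt j (ν j) u) (f i) y)
        (l.foldl (fun u j => deltaAt j (ν j) u) g y) := by
    intro l
    induction l with
    | nil => intro f g h; exact h
    | cons j l ih =>
      intro f g h
      exact ih (fun i => deltaAt j (ν j) (f i)) _ (hasSum_deltaAt h j (ν j))
  exact key _ _ _ (fun y => h _) y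

/-! ### The range of the increments -/

theorem deltaAt_add (j m : ℕ) (u w : IIinf → X) :
    deltaAt j m (u + w) = deltaAt j m u + deltaAt j m w := by
  have hI : ∀ m, interpAt j m (u + w) = interpAt j m u + interpAt j m w := fun m => by
    funext y; simp [interpAt, Finset.sum_add_distrib]
  cases m with
  | zero => exact hI 0
  | succ m => simp only [deltaAt, hI]; abel

theorem deltaAt_const_smul (j m : ℕ) (c : ℝ) (u : IIinf → X) :
    deltaAt j m (c • u) = c • deltaAt j m u := by
  have hI : ∀ m, interpAt j m (c • u) = c • interpAt j m u := fun m => by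
    funext y; simp [interpAt, Finset.smul_sum, smul_comm c]
  cases m with
  | zero => exact hI 0
  | succ m => simp only [deltaAt, hI, smul_sub]

/-- Functions that are polynomials of degrees at most `ν` in the variables of `T`, with
coefficients that are functions of the variables of `ν.support \ T`. -/
def partialPolys (X : Type*) [AddCommGroup X] [Module ℝ X] (ν : MultiIdx) (T : Finset ℕ) :
    Submodule ℝ (IIinf → X) :=
  Submodule.span ℝ {f | ∃ (p : ℕ → ℝ[X]) (w : IIinf → X), (∀ j, (p j).natDegree ≤ ν j) ∧
    DependsOn w (↑(ν.support \ T) : Set ℕ) ∧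
    f = fun y => (∏ j ∈ T, (p j).eval (y j : ℝ)) • w y}

theorem natDegree_chebLagrange {m k : ℕ} (hk : k ∈ Finset.range (m + 1)) :
    (chebLagrange m k).natDegree = m := by
  rw [chebLagrange, natDegree_eq_of_degree_eq_some
    (Lagrange.degree_basis (v := fun i => (chebNode m i : ℝ)) (chebNode_injOn m) hk)]
  simp

/-- Evaluation at the nodes removes $y_j$ from the variables of the coefficient `w`, while the
Lagrange polynomials supply a factor of degree $m$ in $y_j$. -/
theorem interpAt_mem_partialPolys {ν : MultiIdx} {T : Finset ℕ} {j m : ℕ} (hj : j ∉ T)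
    (hm : m ≤ ν j) {p : ℕ → ℝ[X]} (hp : ∀ j, (p j).natDegree ≤ ν j) {w : IIinf → X}
    (hw : DependsOn w (↑(ν.support \ T) : Set ℕ)) :
    interpAt j m (fun y => (∏ j ∈ T, (p j).eval (y j : ℝ)) • w y)
      ∈ partialPolys X ν (insert j T) := by
  classical
  have : interpAt j m (fun y => (∏ j ∈ T, (p j).eval (y j : ℝ)) • w y)
      = ∑ k ∈ Finset.range (m + 1), fun y : IIinf =>
        (∏ i ∈ insert j T, (Function.update p j (chebLagrange m k) i).eval (y i : ℝ))
          • w (Function.update y j (chebNode m k)) := by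
    funext y
    rw [Finset.sum_apply, interpAt]
    refine Finset.sum_congr rfl fun k _ => ?_
    rw [Finset.prod_insert hj, Function.update_self, smul_smul]
    congr 2
    refine Finset.prod_congr rfl fun i hi => ?_
    have hij : i ≠ j := fun h => hj (h ▸ hi)
    rw [Function.update_of_ne hij, Function.update_of_ne hij]
  rw [this]
  refine Submodule.sum_mem _ fun k hk => Submodule.subset_span
    ⟨Function.update p j (chebLagrange m k), fun y => w (Function.update y j (chebNode m k)),
      fun i => ?_, ?_, rfl⟩
  · by_cases hij : i = j
    · subst hij; rw [Function.update_self, natDegree_chebLagrange hk]; exact hm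
    · rw [Function.update_of_ne hij]; exact hp i
  · intro y z hyz
    refine hw fun i hi => ?_
    by_cases hij : i = j
    · subst hij; simp
    · rw [Function.update_of_ne hij, Function.update_of_ne hij]
      refine hyz i ?_
      simp only [Finset.coe_sdiff, Set.mem_sdiff, Finset.mem_coe, Finset.mem_insert] at hi ⊢
      tauto

theorem deltaAt_mem_partialPolys {ν : MultiIdx} {T : Finset ℕ} {j : ℕ} (hj : j ∉ T)
    {u : IIinf → X} (hu : u ∈ partialPolys X ν T) :
    deltaAt j (ν j) u ∈ partialPolys X ν (insert j T) := by
  refine Submodule.span_induction (p := fun u _ => deltaAt j (ν j) u ∈ partialPolys X ν (insert j T))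
    ?_ ?_ ?_ ?_ hu
  · rintro _ ⟨p, w, hp, hw, rfl⟩
    rcases hm : ν j with _ | m
    · exact interpAt_mem_partialPolys hj (Nat.zero_le _) hp hw
    · exact Submodule.sub_mem _ (interpAt_mem_partialPolys hj hm.ge hp hw)
        (interpAt_mem_partialPolys hj (by omega) hp hw)
  · have := deltaAt_const_smul j (ν j) 0 (0 : IIinf → X)
    rw [zero_smul, zero_smul] at this
    rw [this]; exact Submodule.zero_mem _
  · intro u w _ _ hu hw
    rw [deltaAt_add]; exact Submodule.add_mem _ hu hw
  · intro c u _ hu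
    rw [deltaAt_const_smul]; exact Submodule.smul_mem _ _ hu

theorem deltaTensor_mem_partialPolys (ν : MultiIdx) (w : IIinf → X) :
    deltaTensor ν w ∈ partialPolys X ν ν.support := by
  classical
  have key : ∀ (l : List ℕ) (T : Finset ℕ) (u : IIinf → X), l.Nodup → (∀ j ∈ l, j ∉ T) →
      u ∈ partialPolys X ν T →
      l.foldl (fun u j => deltaAt j (ν j) u) u ∈ partialPolys X ν (T ∪ l.toFinset) := by
    intro l
    induction l with
    | nil => intro T u _ _ hu; simpa using hu
    | cons j l ih =>
      intro T u hl hT hu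
      rw [List.nodup_cons] at hl
      have := ih (insert j T) _ hl.2 (fun i hi => ?_) (deltaAt_mem_partialPolys (hT j (by simp)) hu)
      · rw [List.foldl_cons]
        convert this using 2
        ext i; simp
      · rw [Finset.mem_insert, not_or]
        exact ⟨fun h => hl.1 (h ▸ hi), hT i (by simp [hi])⟩
  have h0 : (fun y => w (freezeOutside ν.support y)) ∈ partialPolys X ν ∅ := by
    refine Submodule.subset_span ⟨fun _ => 1, fun y => w (freezeOutside ν.support y),
      fun j => by simp, fun y z hyz => ?_, by simp⟩
    dsimp only
    congr 1
    funext j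
    unfold freezeOutside
    split_ifs with hj
    · exact hyz j (by simpa using hj)
    · rfl
  have := key (ν.support.sort (· ≤ ·)) ∅ _ (Finset.sort_nodup _ _) (by simp) h0
  rwa [Finset.empty_union, Finset.sort_toFinset] at this

/-- Products of univariate polynomials are combinations of tensor product Jacobi polynomials. -/
theorem exists_prod_eval_eq_sum (ha : ∀ j, -1 < a j) (hb : ∀ j, -1 < b j) {ν : MultiIdx}
    {p : ℕ → ℝ[X]} (hp : ∀ j, (p j).natDegree ≤ ν j) :
    ∃ d : MultiIdx → ℝ, ∀ y : IIinf, ∏ j ∈ ν.support, (p j).eval (y j : ℝ)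
      = ∑ μ ∈ Finset.Iic ν, d μ * jacobiTensor a b μ y := by
  choose c hc using fun j => exists_eq_sum_jacobi (ha j) (hb j) (hp j)
  refine ⟨fun μ => ∏ j ∈ ν.support, c j (μ j), fun y => ?_⟩
  have h1 : ∀ j, (p j).eval (y j : ℝ) = ∑ k ∈ Finset.range (ν j + 1),
      c j k * (jacobi (a j) (b j) k).eval (y j : ℝ) := by
    intro j
    conv_lhs => rw [hc j]
    simp [eval_finsetSum]
  simp only [h1]
  rw [← sum_Iic_prod ν fun j k => c j k * (jacobi (a j) (b j) k).eval (y j : ℝ)]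
  refine Finset.sum_congr rfl fun μ hμ => ?_
  rw [Finset.prod_mul_distrib,
    jacobiTensor_eq_prod ha hb (Finsupp.support_mono (Finset.mem_Iic.1 hμ))]

theorem deltaTensor_mem_span (ha : ∀ j, -1 < a j) (hb : ∀ j, -1 < b j) (ν : MultiIdx)
    (w : IIinf → X) :
    deltaTensor ν w ∈ Submodule.span ℝ
      {f | ∃ μ ≤ ν, ∃ x : X, f = fun y => jacobiTensor a b μ y • x} := by
  refine Submodule.span_le.2 ?_ (deltaTensor_mem_partialPolys ν w)
  rintro _ ⟨p, w, hp, hw, rfl⟩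
  obtain ⟨d, hd⟩ := exists_prod_eval_eq_sum ha hb hp
  -- Once all variables of the support are processed, `w` depends on no variable, so it is constant
  -- and the evaluation point is arbitrary.
  set x := w fun _ => chebNode 0 0 with hx
  have hwx : ∀ y, w y = x := fun y => hw fun i hi => by simp at hi
  have e : (fun y : IIinf => (∏ j ∈ ν.support, (p j).eval (y j : ℝ)) • w y)
      = ∑ μ ∈ Finset.Iic ν, d μ • fun y : IIinf => jacobiTensor a b μ y • x := by
    funext y
    rw [Finset.sum_apply, hwx, hd, Finset.sum_smul]
    refine Finset.sum_congr rfl fun μ hμ => ?_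
    rw [Pi.smul_apply, smul_smul]
  change (fun y : IIinf => (∏ j ∈ ν.support, (p j).eval (y j : ℝ)) • w y) ∈ _
  rw [e]
  exact Submodule.sum_mem _ fun μ hμ => Submodule.smul_mem _ _
    (Submodule.subset_span ⟨μ, Finset.mem_Iic.1 hμ, x, rfl⟩)

end Tensor

/-! ### The sparse-grid interpolant -/

section Sparse

set_option linter.unusedSectionVars false

variable {𝕜 : Type*} [RCLike 𝕜]
  {X₁ : Type*} [NormedAddCommGroup X₁] [InnerProductSpace 𝕜 X₁] [NormedSpace ℝ X₁]
  [IsScalarTower ℝ 𝕜 X₁]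
  {X₂ : Type*} [NormedAddCommGroup X₂] [InnerProductSpace 𝕜 X₂] [NormedSpace ℝ X₂]
  [IsScalarTower ℝ 𝕜 X₂]
  {emb : X₂ →L[𝕜] X₁} {P : ℕ → X₁ →ₗ[𝕜] X₁} {V : ℕ → Submodule 𝕜 X₁}
  {a b : ℕ → ℝ} {G : Set (ℕ × MultiIdx)}

theorem map_real_smul_of_isScalarTower {E F : Type*} [AddCommGroup E] [Module 𝕜 E] [Module ℝ E]
    [IsScalarTower ℝ 𝕜 E] [AddCommGroup F] [Module 𝕜 F] [Module ℝ F] [IsScalarTower ℝ 𝕜 F]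
    (f : E →ₗ[𝕜] F) (r : ℝ) (x : E) : f (r • x) = r • f x := by
  rw [← algebraMap_smul 𝕜 r x, map_smul, algebraMap_smul]

theorem spatialIncr_zero_right (emb : X₂ →L[𝕜] X₁) (P : ℕ → X₁ →ₗ[𝕜] X₁) (k : ℕ) :
    spatialIncr emb P k 0 = 0 := by
  cases k <;> simp [spatialIncr]

theorem spatialIncr_add (emb : X₂ →L[𝕜] X₁) (P : ℕ → X₁ →ₗ[𝕜] X₁) (k : ℕ) (x y : X₂) :
    spatialIncr emb P k (x + y) = spatialIncr emb P k x + spatialIncr emb P k y := by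
  cases k with
  | zero => simp [spatialIncr]
  | succ k => simp only [spatialIncr, map_add]; abel

theorem spatialIncr_smul (emb : X₂ →L[𝕜] X₁) (P : ℕ → X₁ →ₗ[𝕜] X₁) (k : ℕ) (r : ℝ) (x : X₂) :
    spatialIncr emb P k (r • x) = r • spatialIncr emb P k x := by
  have h : ∀ m, P m (emb (r • x)) = r • P m (emb x) := fun m =>
    map_real_smul_of_isScalarTower ((P m).comp emb.toLinearMap) r x
  cases k with
  | zero => exact h 1
  | succ k => simp only [spatialIncr, h, smul_sub]

/-- The sum of the first `N` spatial increments. -/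
def spatialTrunc (emb : X₂ →L[𝕜] X₁) (P : ℕ → X₁ →ₗ[𝕜] X₁) : ℕ → X₂ → X₁
  | 0, _ => 0
  | N + 1, w => P (2 ^ N) (emb w)

theorem sum_spatialIncr (emb : X₂ →L[𝕜] X₁) (P : ℕ → X₁ →ₗ[𝕜] X₁) (N : ℕ) (x : X₂) :
    ∑ k ∈ Finset.range N, spatialIncr emb P k x = spatialTrunc emb P N x := by
  induction N with
  | zero => rfl
  | succ N ih =>
    rw [Finset.sum_range_succ, ih]
    cases N <;> simp [spatialTrunc, spatialIncr]

theorem sparseInterp_eq_sum (hfin : G.Finite) (w : IIinf → X₂) (y : IIinf) :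
    sparseInterp emb P G w y
      = ∑ i ∈ hfin.toFinset, spatialIncr emb P i.1 (deltaTensor i.2 w y) :=
  finsum_mem_eq_finite_toFinset_sum _ hfin

theorem jacobiTensor_smul_mem_approxSpace {k : ℕ} {ν : MultiIdx} (h : (k, ν) ∈ G) {w : X₁}
    (hw : w ∈ V (2 ^ k)) : (fun y => jacobiTensor a b ν y • w) ∈ approxSpace a b V G :=
  Submodule.subset_span ⟨k, ν, w, h, hw, rfl⟩

/-- The lower set property is needed in both directions: $\Delta_\nu w$ involves all $J_\mu$ with
$\mu\le\nu$, and $\delta_k$ takes values in $V_{2^k}+V_{2^{k-1}}$. -/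
theorem sparseInterp_mem_approxSpace (ha : ∀ j, -1 < a j) (hb : ∀ j, -1 < b j)
    (hP : ∀ m w, P m w ∈ V m) (hfin : G.Finite) (hlow : IsLowerSet G) (w : IIinf → X₂) :
    sparseInterp emb P G w ∈ approxSpace a b V G := by
  have e : sparseInterp emb P G w = ∑ i ∈ hfin.toFinset,
      fun y => spatialIncr emb P i.1 (deltaTensor i.2 w y) := by
    funext y; rw [sparseInterp_eq_sum hfin, Finset.sum_apply]
  rw [e]
  refine Submodule.sum_mem _ fun i hi => ?_
  obtain ⟨k, ν⟩ := i
  have hi : (k, ν) ∈ G := by simpa using hi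
  refine Submodule.span_induction
    (p := fun u _ => (fun y => spatialIncr emb P k (u y)) ∈ approxSpace a b V G) ?_ ?_ ?_ ?_
    (deltaTensor_mem_span ha hb ν w)
  · rintro _ ⟨μ, hμ, x, rfl⟩
    simp only [spatialIncr_smul]
    have hk : (k, μ) ∈ G := hlow (Prod.mk_le_mk.2 ⟨le_rfl, hμ⟩) hi
    cases k with
    | zero => exact jacobiTensor_smul_mem_approxSpace hk (by simpa [spatialIncr] using hP 1 (emb x))
    | succ k =>
      have hk' : (k, μ) ∈ G := hlow (Prod.mk_le_mk.2 ⟨Nat.le_succ k, le_rfl⟩) hk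
      simp only [spatialIncr, smul_sub]
      exact Submodule.sub_mem _ (jacobiTensor_smul_mem_approxSpace hk (hP _ _))
        (jacobiTensor_smul_mem_approxSpace hk' (hP _ _))
  · simp only [Pi.zero_apply, spatialIncr_zero_right]
    exact Submodule.zero_mem _
  · intro u w _ _ hu hw
    simp only [Pi.add_apply, spatialIncr_add]
    exact Submodule.add_mem _ hu hw
  · intro c u _ hu
    simp only [Pi.smul_apply, spatialIncr_smul]
    have := Submodule.smul_mem _ (c : 𝕜) hu
    convert this using 1
    funext y
    exact (algebraMap_smul 𝕜 c _).symm

/-- The space lies in the image of $\prod_{(k,\nu)\in G}V_{2^k}$ under $(w_{k,\nu})\mapsto\sum J_\nu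
w_{k,\nu}$; independence of the $J_\nu$ is not needed for an upper bound. -/
theorem finrank_approxSpace_le
    (hV : ∀ m, FiniteDimensional 𝕜 (V m) ∧ Module.finrank 𝕜 (V m) ≤ m) (hfin : G.Finite) :
    FiniteDimensional 𝕜 (approxSpace a b V G) ∧
      Module.finrank 𝕜 (approxSpace a b V G) ≤ ∑ i ∈ hfin.toFinset, 2 ^ i.1 := by
  classical
  have hfd : ∀ m, FiniteDimensional 𝕜 (V m) := fun m => (hV m).1
  let J : MultiIdx → X₁ →ₗ[𝕜] (IIinf → X₁) := fun ν =>
    LinearMap.pi fun y => ((jacobiTensor a b ν y : ℝ) : 𝕜) • LinearMap.id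
  let T : (Π i : hfin.toFinset, V (2 ^ i.1.1)) →ₗ[𝕜] (IIinf → X₁) :=
    ∑ i : hfin.toFinset, (J i.1.2).comp ((V (2 ^ i.1.1)).subtype.comp (LinearMap.proj i))
  have hle : approxSpace a b V G ≤ LinearMap.range T := by
    refine Submodule.span_le.2 ?_
    rintro _ ⟨k, ν, w, hG, hw, rfl⟩
    let i : hfin.toFinset := ⟨(k, ν), by simpa using hG⟩
    refine ⟨Pi.single i ⟨w, hw⟩, ?_⟩
    simp only [T, LinearMap.sum_apply, LinearMap.comp_apply, LinearMap.proj_apply]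
    rw [Finset.sum_eq_single i]
    · funext y
      simp [J, i]
    · intro j _ hj
      simp [Pi.single_eq_of_ne hj]
    · simp
  refine ⟨Submodule.finiteDimensional_of_le hle, ?_⟩
  refine (Submodule.finrank_mono hle).trans ((LinearMap.finrank_range_le T).trans ?_)
  rw [Module.finrank_pi_fintype, ← Finset.sum_coe_sort hfin.toFinset fun i => 2 ^ i.1]
  exact Finset.sum_le_sum fun i _ => (hV _).2

/-! ### Pointwise error of the sparse-grid interpolant -/

/-- A bound for the spatial error at level `N`. -/
noncomputable def levelErr (emb : X₂ →L[𝕜] X₁) (C₁ C₂ α : ℝ) : ℕ → X₂ → ℝ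
  | 0, x => (1 + |C₁|) * ‖emb x‖
  | N + 1, x => |C₂| * ((2 : ℝ) ^ N) ^ (-α) * ‖x‖

variable {C₁ C₂ α : ℝ}

theorem levelErr_nonneg (N : ℕ) (x : X₂) : 0 ≤ levelErr emb C₁ C₂ α N x := by
  cases N <;> simp only [levelErr] <;> positivity

/-- The bound at a level also covers all finer levels. At level 0 stability alone is used; at level
$M+1$ the finest projection is $P_{2^M}$, and the consistency bound decreases in the level. -/
theorem norm_sub_spatialTrunc_le (hα : 0 < α)
    (hstab : ∀ m, ∀ w : X₂, ‖P m (emb w)‖ ≤ C₁ * ‖emb w‖)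
    (hcons : ∀ m : ℕ, 1 ≤ m → ∀ w : X₂, ‖emb w - P m (emb w)‖ ≤ C₂ * (m : ℝ) ^ (-α) * ‖w‖)
    {M N : ℕ} (h : M ≤ N) (x : X₂) :
    ‖emb x - spatialTrunc emb P N x‖ ≤ levelErr emb C₁ C₂ α M x := by
  cases M with
  | zero =>
    have h1 : ‖spatialTrunc emb P N x‖ ≤ |C₁| * ‖emb x‖ := by
      cases N with
      | zero => simp only [spatialTrunc, norm_zero]; positivity
      | succ N => exact (hstab _ x).trans (mul_le_mul_of_nonneg_right (le_abs_self _) (norm_nonneg _))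
    have := norm_sub_le (emb x) (spatialTrunc emb P N x)
    simp only [levelErr]
    linarith
  | succ M =>
    cases N with
    | zero => omega
    | succ N =>
      refine (hcons (2 ^ N) Nat.one_le_two_pow x).trans ?_
      push_cast
      simp only [levelErr]
      gcongr ?_ * ‖x‖
      refine mul_le_mul (le_abs_self _) ?_ (by positivity) (abs_nonneg _)
      refine Real.rpow_le_rpow_of_nonpos (by positivity) ?_ (by linarith)
      exact pow_le_pow_right₀ (by norm_num) (by omega)

/-- The maps $P_m$ are not assumed continuous on $X^1$; stability on $X^2$ makes $P_m$ composed with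
the embedding continuous, which suffices. -/
theorem hasSum_spatialIncr (hstab : ∀ m, ∀ w : X₂, ‖P m (emb w)‖ ≤ C₁ * ‖emb w‖) {ι : Type*}
    {f : ι → X₂} {x : X₂} (h : HasSum f x) (k : ℕ) :
    HasSum (fun i => spatialIncr emb P k (f i)) (spatialIncr emb P k x) := by
  have hP : ∀ m, HasSum (fun i => P m (emb (f i))) (P m (emb x)) := by
    intro m
    refine (((P m).comp emb.toLinearMap).mkContinuous (|C₁| * ‖emb‖) fun w => ?_).hasSum h
    refine (hstab m w).trans ((mul_le_mul_of_nonneg_right (le_abs_self _) (norm_nonneg _)).trans ?_)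
    rw [mul_assoc]
    exact mul_le_mul_of_nonneg_left (emb.le_opNorm w) (abs_nonneg _)
  cases k with
  | zero => exact hP 1
  | succ k => exact (hP _).sub (hP _)

theorem sparseInterp_jacobiTensor (ha : ∀ j, -1 < a j) (hb : ∀ j, -1 < b j) (hfin : G.Finite)
    {N : MultiIdx → ℕ} (hN : ∀ k ν, (k, ν) ∈ G ↔ k < N ν) (μ : MultiIdx) (x : X₂) (y : IIinf) :
    sparseInterp emb P G (fun y => jacobiTensor a b μ y • x) y
      = ∑ ν ∈ Finset.Iic μ, jacobiIncr a b ν μ y • spatialTrunc emb P (N ν) x := by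
  classical
  rw [sparseInterp_eq_sum hfin]
  simp only [deltaTensor_jacobiTensor ha hb, spatialIncr_smul]
  rw [← Finset.sum_filter_of_ne (p := fun i => i.2 ≤ μ)]
  · rw [Finset.sum_finset_product_right' _ (Finset.Iic μ) (fun ν => Finset.range (N ν))
      (f := fun k ν => jacobiIncr a b ν μ y • spatialIncr emb P k x)]
    · refine Finset.sum_congr rfl fun ν _ => ?_
      rw [← Finset.smul_sum, sum_spatialIncr]
    · rintro ⟨k, ν⟩
      simp [hN, and_comm]
  · intro i _ hne
    by_contra h
    rw [jacobiIncr_eq_zero ha hb h, zero_smul] at hne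
    exact hne rfl

/-- The error of the sparse-grid interpolant is bounded by a weighted sum of spatial errors. -/
theorem norm_sub_sparseInterp_le {ε Cε : ℝ} (hε : 0 < ε) (hCε : IsAdmissibleConst a b ε Cε)
    (ha : ∀ j, -1 < a j) (hb : ∀ j, -1 < b j) (hα : 0 < α)
    (hstab : ∀ m, ∀ w : X₂, ‖P m (emb w)‖ ≤ C₁ * ‖emb w‖)
    (hcons : ∀ m : ℕ, 1 ≤ m → ∀ w : X₂, ‖emb w - P m (emb w)‖ ≤ C₂ * (m : ℝ) ^ (-α) * ‖w‖)
    (hfin : G.Finite) (hlow : IsLowerSet G)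
    {N : MultiIdx → ℕ} (hN : ∀ k ν, (k, ν) ∈ G ↔ k < N ν) {c : MultiIdx → X₂} {w : IIinf → X₂}
    (hw : ∀ y, HasSum (fun μ => jacobiTensor a b μ y • c μ) (w y)) {g : MultiIdx → ℝ} {B : ℝ}
    (hg : ∀ μ, pWeight (jacobiTheta0 a b + 1 + ε) (Cε + 1) μ
      * levelErr emb C₁ C₂ α (N μ) (c μ) ≤ g μ)
    (hB : HasSum g B) (y : IIinf) :
    ‖emb (w y) - sparseInterp emb P G w y‖ ≤ B := by
  -- Because `G` is a lower set, each $\nu\le\mu$ carries at least as many spatial levels as $\mu$,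
  -- so the level error at `N μ` serves for all increments of $J_\mu$.
  have hanti : ∀ ν μ, ν ≤ μ → N μ ≤ N ν := by
    intro ν μ h
    by_contra hlt
    push Not at hlt
    have h1 : (N ν, μ) ∈ G := (hN _ _).2 hlt
    exact lt_irrefl _ ((hN _ _).1 (hlow (Prod.mk_le_mk.2 ⟨le_rfl, h⟩) h1))
  have hs : HasSum (fun μ => emb (jacobiTensor a b μ y • c μ)
      - sparseInterp emb P G (fun y => jacobiTensor a b μ y • c μ) y)
      (emb (w y) - sparseInterp emb P G w y) := by
    refine (emb.hasSum (hw y)).sub ?_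
    simp only [sparseInterp_eq_sum hfin]
    exact hasSum_sum fun i _ => hasSum_spatialIncr hstab (hasSum_deltaTensor hw i.2 y) i.1
  have hterm : ∀ μ, ‖emb (jacobiTensor a b μ y • c μ)
      - sparseInterp emb P G (fun y => jacobiTensor a b μ y • c μ) y‖ ≤ g μ := by
    intro μ
    refine le_trans ?_ (hg μ)
    rw [sparseInterp_jacobiTensor ha hb hfin hN,
      show emb (jacobiTensor a b μ y • c μ) = jacobiTensor a b μ y • emb (c μ) from
        map_real_smul_of_isScalarTower emb.toLinearMap _ _,
      ← sum_jacobiIncr ha hb, Finset.sum_smul, ← Finset.sum_sub_distrib]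
    refine (norm_sum_le _ _).trans ?_
    refine le_trans ?_ (mul_le_mul_of_nonneg_right (sum_abs_jacobiIncr_le hε hCε ha hb μ y)
      (levelErr_nonneg _ _))
    rw [Finset.sum_mul]
    refine Finset.sum_le_sum fun ν hν => ?_
    rw [← smul_sub, norm_smul, Real.norm_eq_abs]
    exact mul_le_mul_of_nonneg_left (norm_sub_spatialTrunc_le hα hstab hcons
      (hanti ν μ (Finset.mem_Iic.1 hν)) _) (abs_nonneg _)
  exact hs.norm_le_of_bounded hB hterm

/-- The fibre over $\nu$ is a finite initial segment of the levels; `N ν` is the first level missing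
from it, and is 0 for an empty fibre. -/
theorem exists_level (hfin : G.Finite) (hlow : IsLowerSet G) :
    ∃ N : MultiIdx → ℕ, ∀ k ν, (k, ν) ∈ G ↔ k < N ν := by
  classical
  have hex : ∀ ν, ∃ k, (k, ν) ∉ G := by
    intro ν
    by_contra h
    push Not at h
    exact Set.infinite_univ ((hfin.preimage (f := fun k : ℕ => (k, ν))
      (Prod.mk_left_injective ν).injOn).subset fun k _ => h k)
  refine ⟨fun ν => Nat.find (hex ν), fun k ν => ⟨fun h => ?_, fun h => ?_⟩⟩
  · by_contra hk
    push Not at hk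
    exact Nat.find_spec (hex ν) (hlow (Prod.mk_le_mk.2 ⟨hk, le_rfl⟩) h)
  · by_contra hk
    exact Nat.find_min (hex ν) h hk

end Sparse

/-! ### Completeness of the tensor product Jacobi polynomials -/

section Representative

variable {a b : ℕ → ℝ}

theorem isProbabilityMeasure_jacobiProdMeasure (ha : ∀ j, -1 < a j) (hb : ∀ j, -1 < b j) :
    IsProbabilityMeasure (jacobiProdMeasure a b) := by
  have := fun j => isProbabilityMeasure_jacobiMeasure (ha j) (hb j)
  unfold jacobiProdMeasure
  infer_instance

/-- The integrand depends only on the coordinates in the union of the supports, where Fubini's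
theorem reduces the claim to univariate orthonormality. -/
theorem integral_jacobiTensor_mul (ha : ∀ j, -1 < a j) (hb : ∀ j, -1 < b j) (ν μ : MultiIdx) :
    ∫ y, jacobiTensor a b ν y * jacobiTensor a b μ y ∂jacobiProdMeasure a b
      = if ν = μ then 1 else 0 := by
  classical
  have := fun j => isProbabilityMeasure_jacobiMeasure (ha j) (hb j)
  set S := ν.support ∪ μ.support with hS
  have e : ∀ y : IIinf, jacobiTensor a b ν y * jacobiTensor a b μ y
      = (fun z : S → II => ∏ j : S, ((jacobi (a j) (b j) (ν j)).eval (z j : ℝ)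
        * (jacobi (a j) (b j) (μ j)).eval (z j : ℝ))) (S.restrict y) := by
    intro y
    rw [jacobiTensor_eq_prod ha hb (Finset.subset_union_left : ν.support ⊆ S),
      jacobiTensor_eq_prod ha hb (Finset.subset_union_right : μ.support ⊆ S),
      ← Finset.prod_mul_distrib, ← Finset.prod_coe_sort]
    rfl
  have hF : Continuous fun z : S → II => ∏ j : S, ((jacobi (a j) (b j) (ν j)).eval (z j : ℝ)
      * (jacobi (a j) (b j) (μ j)).eval (z j : ℝ)) :=
    continuous_finsetProd _ fun j _ => ((continuous_eval_coe _).comp (continuous_apply j)).mul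
      ((continuous_eval_coe _).comp (continuous_apply j))
  rw [integral_congr_ae (Filter.Eventually.of_forall e), jacobiProdMeasure]
  refine (integral_restrict_infinitePi (fun j => jacobiMeasure (a j) (b j)) (s := S)
    hF.aestronglyMeasurable).trans ?_
  rw [integral_fintype_prod_eq_prod (fun (j : S) (t : II) =>
      (jacobi (a j) (b j) (ν j)).eval (t : ℝ) * (jacobi (a j) (b j) (μ j)).eval (t : ℝ))]
  have h : ∀ j : S, ∫ t : II, (jacobi (a j) (b j) (ν j)).eval (t : ℝ)
      * (jacobi (a j) (b j) (μ j)).eval (t : ℝ) ∂jacobiMeasure (a j) (b j)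
      = if ν j = μ j then 1 else 0 := fun j => jacobiPairing_jacobi (ha j) (hb j) _ _
  simp only [h]
  split_ifs with hνμ
  · subst hνμ; simp
  · obtain ⟨j, hj⟩ := DFunLike.ne_iff.1 hνμ
    have hjS : j ∈ S := by
      by_contra hjS
      rw [hS, Finset.notMem_union, Finsupp.notMem_support_iff, Finsupp.notMem_support_iff] at hjS
      exact hj (hjS.1.trans hjS.2.symm)
    exact Finset.prod_eq_zero (Finset.mem_univ (⟨j, hjS⟩ : S)) (if_neg hj)

/-! ### Density of polynomials and the continuous representative -/

/-- The coordinate functions on the parameter domain. -/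
def coordFun (j : ℕ) : C(IIinf, ℝ) := ⟨fun y => (y j : ℝ), by fun_prop⟩

theorem exists_eq_prod_of_mem_closure {g : C(IIinf, ℝ)}
    (hg : g ∈ Submonoid.closure (Set.range coordFun)) :
    ∃ (S : Finset ℕ) (p : ℕ → ℝ[X]), (∀ j ∉ S, p j = 1) ∧
      ∀ y : IIinf, g y = ∏ j ∈ S, (p j).eval (y j : ℝ) := by
  classical
  induction hg using Submonoid.closure_induction with
  | mem g hg =>
    obtain ⟨j, rfl⟩ := hg
    refine ⟨{j}, Function.update (fun _ => 1) j X, fun i hi => ?_, fun y => ?_⟩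
    · rw [Function.update_of_ne (by simpa using hi)]
    · simp [coordFun]
  | one => exact ⟨∅, fun _ => 1, fun _ _ => rfl, fun y => by simp⟩
  | mul g h _ _ hg hh =>
    obtain ⟨S, p, hp, hg⟩ := hg
    obtain ⟨T, q, hq, hh⟩ := hh
    refine ⟨S ∪ T, p * q, fun j hj => ?_, fun y => ?_⟩
    · rw [Finset.notMem_union] at hj
      rw [Pi.mul_apply, hp j hj.1, hq j hj.2, one_mul]
    · have h1 : ∏ j ∈ S, (p j).eval (y j : ℝ) = ∏ j ∈ S ∪ T, (p j).eval (y j : ℝ) :=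
        Finset.prod_subset Finset.subset_union_left fun j _ hj => by rw [hp j hj, eval_one]
      have h2 : ∏ j ∈ T, (q j).eval (y j : ℝ) = ∏ j ∈ S ∪ T, (q j).eval (y j : ℝ) :=
        Finset.prod_subset Finset.subset_union_right fun j _ hj => by rw [hq j hj, eval_one]
      rw [ContinuousMap.mul_apply, hg, hh, h1, h2, ← Finset.prod_mul_distrib]
      simp

theorem separatesPoints_adjoin_coordFun :
    (Algebra.adjoin ℝ (Set.range coordFun)).SeparatesPoints := by
  intro x y hxy
  obtain ⟨j, hj⟩ := Function.ne_iff.1 hxy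
  exact ⟨coordFun j, ⟨coordFun j, Algebra.subset_adjoin ⟨j, rfl⟩, rfl⟩,
    fun h => hj (Subtype.ext h)⟩

variable {X : Type*} [NormedAddCommGroup X] [NormedSpace ℝ X]

theorem integrable_continuous_smul {μ : Measure IIinf} {f : IIinf → X} (hf : Integrable f μ)
    {g : IIinf → ℝ} (hg : Continuous g) : Integrable (fun y => g y • f y) μ := by
  obtain ⟨M, hM⟩ := isCompact_univ.exists_bound_of_continuousOn hg.continuousOn
  exact hf.bdd_smul M hg.aestronglyMeasurable (Filter.Eventually.of_forall fun y => hM y trivial)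

theorem gpcCoeff_sub {f g : IIinf → X} (hf : Integrable f (jacobiProdMeasure a b))
    (hg : Integrable g (jacobiProdMeasure a b)) (ν : MultiIdx) :
    gpcCoeff a b (f - g) ν = gpcCoeff a b f ν - gpcCoeff a b g ν := by
  simp only [gpcCoeff, Pi.sub_apply, smul_sub]
  exact integral_sub (integrable_continuous_smul hf (continuous_jacobiTensor a b ν))
    (integrable_continuous_smul hg (continuous_jacobiTensor a b ν))

variable [CompleteSpace X]

/-- An integrable function all of whose Jacobi coefficients vanish is zero. -/
theorem ae_eq_zero_of_gpcCoeff_eq_zero (ha : ∀ j, -1 < a j) (hb : ∀ j, -1 < b j)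
    {f : IIinf → X} (hf : Integrable f (jacobiProdMeasure a b))
    (h0 : ∀ ν, gpcCoeff a b f ν = 0) : f =ᵐ[jacobiProdMeasure a b] 0 := by
  classical
  have := isProbabilityMeasure_jacobiProdMeasure ha hb
  -- Monomials in the coordinates are finite combinations of tensor Jacobi polynomials, so `f`
  -- integrates to zero against every polynomial.
  have hadj : ∀ g ∈ Algebra.adjoin ℝ (Set.range coordFun),
      ∫ y, g y • f y ∂jacobiProdMeasure a b = 0 := by
    intro g hg
    rw [← Subalgebra.mem_toSubmodule, Algebra.adjoin_eq_span] at hg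
    refine Submodule.span_induction
      (p := fun (g : C(IIinf, ℝ)) _ => ∫ y, g y • f y ∂jacobiProdMeasure a b = 0) ?_ ?_ ?_ ?_ hg
    · intro g hg
      obtain ⟨S, p, hp, hg⟩ := exists_eq_prod_of_mem_closure hg
      -- Adding 1 to the degrees makes the support equal to `S` even where a factor is constant.
      set ν : MultiIdx := Finsupp.onFinset S (fun j => if j ∈ S then (p j).natDegree + 1 else 0)
        (fun j hj => by by_contra h; simp [h] at hj) with hν
      have hS : ν.support = S := by
        ext j; simp [hν]
      have hdeg : ∀ j, (p j).natDegree ≤ ν j := by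
        intro j
        simp only [hν, Finsupp.onFinset_apply]
        split_ifs with hj
        · omega
        · simp [hp j hj]
      obtain ⟨d, hd⟩ := exists_prod_eval_eq_sum ha hb hdeg
      rw [hS] at hd
      simp only [hg, hd, Finset.sum_smul, mul_smul]
      refine (integral_finsetSum _ fun μ _ =>
        (integrable_continuous_smul hf (continuous_jacobiTensor a b μ)).smul (d μ)).trans ?_
      refine Finset.sum_eq_zero fun μ _ => ?_
      exact (integral_smul _ _).trans (by rw [← gpcCoeff, h0, smul_zero])
    · simp
    · intro g h _ _ hg hh
      simp only [ContinuousMap.add_apply, add_smul]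
      rw [integral_add (integrable_continuous_smul hf g.continuous)
        (integrable_continuous_smul hf h.continuous), hg, hh, add_zero]
    · intro c g _ hg
      simp only [ContinuousMap.smul_apply, smul_assoc]
      rw [integral_smul, hg, smul_zero]
  -- The coordinates separate points, so the Stone-Weierstrass theorem extends the orthogonality to
  -- all continuous functions.
  have hcont : ∀ g : C(IIinf, ℝ), ∫ y, g y • f y ∂jacobiProdMeasure a b = 0 := by
    intro g
    have hle : ∀ δ > 0, ‖∫ y, g y • f y ∂jacobiProdMeasure a b‖
        ≤ δ * ∫ y, ‖f y‖ ∂jacobiProdMeasure a b := by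
      intro δ hδ
      obtain ⟨⟨h, hh⟩, hgh⟩ := ContinuousMap.exists_mem_subalgebra_near_continuousMap_of_separatesPoints
        _ separatesPoints_adjoin_coordFun g δ hδ
      have e : ∫ y, g y • f y ∂jacobiProdMeasure a b
          = ∫ y, (g y - h y) • f y ∂jacobiProdMeasure a b := by
        simp only [sub_smul]
        rw [integral_sub (integrable_continuous_smul hf g.continuous)
          (integrable_continuous_smul hf h.continuous), hadj h hh, sub_zero]
      rw [e, ← integral_const_mul]
      refine norm_integral_le_of_norm_le (hf.norm.const_mul δ) (Filter.Eventually.of_forall fun y => ?_)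
      rw [norm_smul]
      refine mul_le_mul_of_nonneg_right ?_ (norm_nonneg _)
      rw [norm_sub_rev]
      exact ((h - g).norm_coe_le_norm y).trans hgh.le
    have hI : 0 ≤ ∫ y, ‖f y‖ ∂jacobiProdMeasure a b := integral_nonneg fun _ => norm_nonneg _
    rw [← norm_le_zero_iff]
    refine le_of_forall_pos_le_add fun δ hδ => ?_
    refine (hle (δ / (∫ y, ‖f y‖ ∂jacobiProdMeasure a b + 1)) (by positivity)).trans ?_
    rw [zero_add, div_mul_eq_mul_div, div_le_iff₀ (by positivity)]
    nlinarith
  -- It suffices that integrals over closed sets vanish. The indicator of a closed set is a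
  -- pointwise limit of continuous functions with values in $[0,1]$, and $\|f\|$ dominates.
  refine ae_eq_zero_of_forall_setIntegral_isClosed_eq_zero hf fun s hs => ?_
  have hlim := tendsto_integral_of_dominated_convergence (μ := jacobiProdMeasure a b)
    (F := fun n y => ((hs.apprSeq n y : NNReal) : ℝ) • f y) (f := s.indicator f) (fun y => ‖f y‖)
    (fun n => ?_) hf.norm (fun n => Filter.Eventually.of_forall fun y => ?_)
    (Filter.Eventually.of_forall fun y => ?_)
  · rw [integral_indicator hs.measurableSet] at hlim
    refine tendsto_nhds_unique hlim ?_
    have : ∀ n, ∫ y, ((hs.apprSeq n y : NNReal) : ℝ) • f y ∂jacobiProdMeasure a b = 0 := fun n =>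
      hcont ⟨fun y => ((hs.apprSeq n y : NNReal) : ℝ),
        NNReal.continuous_coe.comp (hs.apprSeq n).continuous⟩
    simp only [this]
    exact tendsto_const_nhds
  · exact (integrable_continuous_smul hf
      (NNReal.continuous_coe.comp (hs.apprSeq n).continuous)).aestronglyMeasurable
  · rw [norm_smul, Real.norm_of_nonneg (NNReal.coe_nonneg _)]
    have := HasOuterApproxClosed.apprSeq_apply_le_one hs n y
    exact mul_le_of_le_one_left (norm_nonneg _) (by exact_mod_cast this)
  · have h1 := tendsto_pi_nhds.1 (HasOuterApproxClosed.tendsto_apprSeq hs) y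
    have h2 := ((NNReal.continuous_coe.tendsto _).comp h1).smul_const (f y)
    have e : s.indicator f y = ((s.indicator (fun _ => (1 : NNReal)) y : NNReal) : ℝ) • f y := by
      by_cases hy : y ∈ s <;> simp [hy]
    rw [e]
    exact h2

/-- The Jacobi expansion of a function with summable weighted coefficients converges to a
continuous representative. -/
theorem exists_continuous_representative {ε Cε : ℝ} (hε : 0 < ε)
    (hCε : IsAdmissibleConst a b ε Cε) (ha : ∀ j, -1 < a j) (hb : ∀ j, -1 < b j)
    {v : IIinf → X} (hv : Integrable v (jacobiProdMeasure a b))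
    (hs : Summable fun ν => pWeight (jacobiTheta0 a b + 1 + ε) (Cε + 1) ν * ‖gpcCoeff a b v ν‖) :
    ∃ vc : C(IIinf, X), vc =ᵐ[jacobiProdMeasure a b] v ∧
      ∀ y, HasSum (fun ν => jacobiTensor a b ν y • gpcCoeff a b v ν) (vc y) := by
  have := isProbabilityMeasure_jacobiProdMeasure ha hb
  have hbd : ∀ ν (y : IIinf), ‖jacobiTensor a b ν y • gpcCoeff a b v ν‖
      ≤ pWeight (jacobiTheta0 a b + 1 + ε) (Cε + 1) ν * ‖gpcCoeff a b v ν‖ := by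
    intro ν y
    rw [norm_smul, Real.norm_eq_abs]
    exact mul_le_mul_of_nonneg_right (abs_jacobiTensor_le hε hCε ha hb ν y) (norm_nonneg _)
  have hsum : ∀ y, HasSum (fun ν => jacobiTensor a b ν y • gpcCoeff a b v ν)
      (∑' ν, jacobiTensor a b ν y • gpcCoeff a b v ν) := fun y =>
    (Summable.of_norm_bounded hs fun ν => hbd ν y).hasSum
  have hcont : Continuous fun y => ∑' ν, jacobiTensor a b ν y • gpcCoeff a b v ν :=
    continuous_tsum (fun ν => (continuous_jacobiTensor a b ν).smul continuous_const) hs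
      fun ν y => hbd ν y
  refine ⟨⟨_, hcont⟩, ?_, hsum⟩
  have hvc : Integrable (fun y => ∑' ν, jacobiTensor a b ν y • gpcCoeff a b v ν)
      (jacobiProdMeasure a b) :=
    hcont.integrable_of_hasCompactSupport (HasCompactSupport.of_compactSpace _)
  -- The series is dominated by a summable family of constants, so its coefficients may be computed
  -- term by term; orthonormality leaves one term. Hence the sum and `v` have equal coefficients and
  -- agree almost everywhere.
  have hcoeff : ∀ μ, gpcCoeff a b (fun y => ∑' ν, jacobiTensor a b ν y • gpcCoeff a b v ν) μ
      = gpcCoeff a b v μ := by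
    intro μ
    have h := hasSum_integral_of_dominated_convergence (μ := jacobiProdMeasure a b)
      (F := fun ν y => jacobiTensor a b μ y • jacobiTensor a b ν y • gpcCoeff a b v ν)
      (f := fun y => jacobiTensor a b μ y • ∑' ν, jacobiTensor a b ν y • gpcCoeff a b v ν)
      (fun ν _ => pWeight (jacobiTheta0 a b + 1 + ε) (Cε + 1) μ *
        (pWeight (jacobiTheta0 a b + 1 + ε) (Cε + 1) ν * ‖gpcCoeff a b v ν‖))
      (fun ν => ((continuous_jacobiTensor a b μ).smul ((continuous_jacobiTensor a b ν).smul
        continuous_const)).aestronglyMeasurable)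
      (fun ν => Filter.Eventually.of_forall fun y => ?_)
      (Filter.Eventually.of_forall fun y => hs.mul_left _)
      (integrable_const _)
      (Filter.Eventually.of_forall fun y => (hsum y).const_smul _)
    · refine h.unique ?_
      have e : ∀ ν, ∫ y, jacobiTensor a b μ y • jacobiTensor a b ν y • gpcCoeff a b v ν
          ∂jacobiProdMeasure a b = if ν = μ then gpcCoeff a b v μ else 0 := by
        intro ν
        simp only [smul_smul]
        rw [integral_smul_const, integral_jacobiTensor_mul ha hb]
        by_cases h : μ = ν
        · subst h; simp
        · simp [h, Ne.symm h]
      simp only [e]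
      exact hasSum_ite_eq μ _
    · rw [norm_smul, Real.norm_eq_abs]
      exact mul_le_mul (abs_jacobiTensor_le hε hCε ha hb μ y) (hbd ν y) (norm_nonneg _)
        ((abs_nonneg _).trans (abs_jacobiTensor_le hε hCε ha hb μ y))
  have h0 := ae_eq_zero_of_gpcCoeff_eq_zero ha hb (hvc.sub hv) fun μ => by
    rw [gpcCoeff_sub hvc hv, hcoeff, sub_self]
  filter_upwards [h0] with y hy
  exact sub_eq_zero.1 hy

end Representative

/-! ### Summability and cardinality of the thresholded index sets -/

section Weights

variable {θ lam q : ℝ} {σ c : MultiIdx → ℝ}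

theorem WeightedSummable.rpow_weight_eq (hθ : 0 ≤ θ) (hlam : 0 ≤ lam) (hq : 0 < q)
    (h : WeightedSummable θ lam q σ c) (ν : MultiIdx) :
    (pWeight θ lam ν ^ (2 / q) * (σ ν)⁻¹) ^ q = pWeight θ lam ν ^ 2 * σ ν ^ (-q) := by
  have hp : 0 ≤ pWeight θ lam ν := zero_le_one.trans (one_le_pWeight hθ hlam ν)
  have hσ : 0 ≤ σ ν := zero_le_one.trans (h.one_lt ν).le
  rw [Real.mul_rpow (by positivity) (by positivity), ← Real.rpow_mul hp, div_mul_cancel₀ _ hq.ne',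
    Real.inv_rpow hσ, ← Real.rpow_neg hσ]
  norm_cast

theorem WeightedSummable.summable_rpow_neg (hθ : 0 ≤ θ) (hlam : 0 ≤ lam) (hq : 0 < q)
    (h : WeightedSummable θ lam q σ c) : Summable fun ν => σ ν ^ (-q) := by
  refine Summable.of_nonneg_of_le (fun ν => ?_) (fun ν => ?_) h.summable_weight
  · have := (h.one_lt ν).le; positivity
  · rw [h.rpow_weight_eq hθ hlam hq]
    have hσ : 0 ≤ σ ν := zero_le_one.trans (h.one_lt ν).le
    exact le_mul_of_one_le_left (by positivity) (one_le_pow₀ (one_le_pWeight hθ hlam ν))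

/-- Write the term as $(p_\nu\sigma_\nu^{-q/2})(\sigma_\nu c_\nu)$ and use $xy\le x^2+y^2$; both
squares are summable by assumption. -/
theorem WeightedSummable.summable_mul (hθ : 0 ≤ θ) (hlam : 0 ≤ lam) (hq : 0 < q)
    (hc : ∀ ν, 0 ≤ c ν) (h : WeightedSummable θ lam q σ c) :
    Summable fun ν => pWeight θ lam ν * (σ ν ^ (1 - q / 2) * c ν) := by
  refine Summable.of_nonneg_of_le (fun ν => ?_) (fun ν => ?_) (h.summable_weight.add h.summable_sq)
  · have h1 := (h.one_lt ν).le
    have h2 := one_le_pWeight hθ hlam ν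
    have h3 := hc ν
    positivity
  · have hσ : 0 < σ ν := zero_lt_one.trans (h.one_lt ν)
    have e1 : σ ν ^ (1 - q / 2) = σ ν ^ (-(q / 2)) * σ ν := by
      rw [← Real.rpow_add_one hσ.ne']; congr 1; ring
    have e2 : σ ν ^ (-q) = (σ ν ^ (-(q / 2))) ^ 2 := by
      rw [← Real.rpow_natCast, ← Real.rpow_mul hσ.le]; congr 1; push_cast; ring
    rw [h.rpow_weight_eq hθ hlam hq, e1, e2]
    nlinarith [sq_nonneg (pWeight θ lam ν * σ ν ^ (-(q / 2)) - σ ν * c ν),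
      sq_nonneg (pWeight θ lam ν * σ ν ^ (-(q / 2))), sq_nonneg (σ ν * c ν)]

theorem finite_rpow_le (hσ : ∀ ν, 1 < σ ν) (h : Summable fun ν => σ ν ^ (-q)) (x : ℝ) :
    {ν | σ ν ^ q ≤ x}.Finite := by
  have hx : (0 : ℝ) < (|x| + 1)⁻¹ := by positivity
  have := h.tendsto_cofinite_zero.eventually (gt_mem_nhds hx)
  refine (Filter.eventually_cofinite.1 this).subset fun ν hν => ?_
  have hν : σ ν ^ q ≤ x := hν
  have h0 : 0 < σ ν := zero_lt_one.trans (hσ ν)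
  simp only [Set.mem_ofPred_eq, not_lt]
  rw [Real.rpow_neg h0.le]
  exact inv_anti₀ (by positivity) (by linarith [le_abs_self x])

/-- Every index of `F` contributes at least $1/x$ to the series. -/
theorem card_le_of_rpow_le (hσ : ∀ ν, 1 < σ ν) (h : Summable fun ν => σ ν ^ (-q)) {x : ℝ}
    (hx : 0 < x) {F : Finset MultiIdx} (hF : ∀ ν ∈ F, σ ν ^ q ≤ x) :
    (F.card : ℝ) ≤ x * ∑' ν, σ ν ^ (-q) := by
  have h0 : ∀ ν, 0 < σ ν := fun ν => zero_lt_one.trans (hσ ν)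
  rw [← div_le_iff₀' hx]
  refine le_trans ?_ (h.sum_le_tsum F fun ν _ => (Real.rpow_pos_of_pos (h0 ν) (-q)).le)
  rw [div_eq_mul_inv, ← nsmul_eq_mul]
  refine Finset.card_nsmul_le_sum F _ _ fun ν hν => ?_
  rw [Real.rpow_neg (h0 ν).le]
  exact inv_anti₀ (Real.rpow_pos_of_pos (h0 ν) q) (hF ν hν)

end Weights

/-! ### Structure and size of the thresholded index sets -/

section Threshold

variable {α q₁ q₂ : ℝ} {σ₁ σ₂ : MultiIdx → ℝ} {ξ : ℝ}

theorem mem_thresholdSet_of_le (h : α ≤ 1 / q₂ - 1 / 2) {k : ℕ} {ν : MultiIdx} :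
    (k, ν) ∈ thresholdSet α q₁ q₂ σ₁ σ₂ ξ ↔ (2 : ℝ) ^ k * σ₂ ν ^ q₂ ≤ ξ := by
  simp only [thresholdSet, if_pos h, Set.mem_ofPred_eq]

theorem mem_thresholdSet_of_lt (h : 1 / q₂ - 1 / 2 < α) {k : ℕ} {ν : MultiIdx} :
    (k, ν) ∈ thresholdSet α q₁ q₂ σ₁ σ₂ ξ ↔
      σ₁ ν ^ q₁ ≤ ξ * Real.log ξ ^ ((1 / q₁ - 1 / 2)⁻¹) ∧
      (2 : ℝ) ^ (2 * α / (2 - q₂) * (k : ℝ)) * σ₂ ν ≤ ξ ^ (2 / (2 - q₂) * (1 / q₁ - 1 / 2)) := by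
  simp only [thresholdSet, if_neg (not_le.2 h), Set.mem_ofPred_eq]

theorem isLowerSet_thresholdSet (hα : 0 < α) (hq₁ : 0 < q₁) (hq₂' : 0 < q₂) (hq₂ : q₂ < 2)
    (h1 : ∀ ν, 1 < σ₁ ν) (h2 : ∀ ν, 1 < σ₂ ν) (m1 : Monotone σ₁) (m2 : Monotone σ₂) :
    IsLowerSet (thresholdSet α q₁ q₂ σ₁ σ₂ ξ) := by
  rintro ⟨k, ν⟩ ⟨l, μ⟩ ⟨hlk, hμν⟩ hmem
  simp only at hlk hμν
  have s1 : 0 ≤ σ₁ μ := zero_le_one.trans (h1 μ).le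
  have s2 : 0 ≤ σ₂ μ := zero_le_one.trans (h2 μ).le
  rcases le_or_gt α (1 / q₂ - 1 / 2) with h | h
  · rw [mem_thresholdSet_of_le h] at hmem ⊢
    refine le_trans (mul_le_mul (pow_le_pow_right₀ one_le_two hlk)
      (Real.rpow_le_rpow s2 (m2 hμν) hq₂'.le) (by positivity) (by positivity)) hmem
  · rw [mem_thresholdSet_of_lt h] at hmem ⊢
    refine ⟨(Real.rpow_le_rpow s1 (m1 hμν) hq₁.le).trans hmem.1, le_trans (mul_le_mul ?_
      (m2 hμν) s2 (by positivity)) hmem.2⟩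
    refine Real.rpow_le_rpow_of_exponent_le one_le_two (mul_le_mul_of_nonneg_left
      (by exact_mod_cast hlk) ?_)
    have : 0 < 2 - q₂ := by linarith
    positivity

theorem finite_of_forall_pow_le {G : Set (ℕ × MultiIdx)} {F : Set MultiIdx} (hF : F.Finite)
    (hGF : ∀ k ν, (k, ν) ∈ G → ν ∈ F) {B : ℝ} (hB : ∀ k ν, (k, ν) ∈ G → (2 : ℝ) ^ k ≤ B) :
    G.Finite := by
  refine ((Set.finite_Iio ⌈B⌉₊).prod hF).subset ?_
  rintro ⟨k, ν⟩ h
  refine ⟨?_, hGF k ν h⟩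
  have h1 : (k : ℝ) < (2 : ℝ) ^ k := by exact_mod_cast Nat.lt_two_pow_self
  exact Nat.lt_ceil.2 (h1.trans_le (hB k ν h))

/-- Over each $\nu$ the levels form an initial segment, so the geometric sum is less than twice its
last term. -/
theorem sum_two_pow_le {G : Set (ℕ × MultiIdx)} (hfin : G.Finite) (hlow : IsLowerSet G)
    {F : Finset MultiIdx} (hGF : ∀ k ν, (k, ν) ∈ G → ν ∈ F) {D : MultiIdx → ℝ}
    (hD0 : ∀ ν, 0 ≤ D ν) (hD : ∀ k ν, (k, ν) ∈ G → (2 : ℝ) ^ k ≤ D ν) :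
    ∑ i ∈ hfin.toFinset, (2 : ℝ) ^ i.1 ≤ 2 * ∑ ν ∈ F, D ν := by
  obtain ⟨N, hN⟩ := exists_level hfin hlow
  rw [Finset.sum_finset_product_right' _ F (fun ν => Finset.range (N ν))
    (f := fun k _ => (2 : ℝ) ^ k), Finset.mul_sum]
  · refine Finset.sum_le_sum fun ν _ => ?_
    rw [geom_sum_eq (by norm_num)]
    rcases h : N ν with _ | M
    · simpa using hD0 ν
    · have := hD M ν ((hN M ν).2 (by omega))
      rw [pow_succ]
      linarith
  · rintro ⟨k, ν⟩
    rw [Set.Finite.mem_toFinset, Finset.mem_range, ← hN]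
    exact ⟨fun h => ⟨hGF k ν h, h⟩, fun h => h.2⟩

end Threshold

/-! ### Error bounds in terms of the threshold -/

section Pointwise

variable {α q₁ q₂ A ξ s₁ s₂ x₁ x₂ : ℝ} {e : ℕ → ℝ} {N : ℕ}

/-- A bound valid at every level, without reference to a threshold; it serves the small $n$ for
which the asserted rate is bounded below. -/
theorem err_le_of_one_lt (hα : 0 < α) (hq₂ : q₂ < 2) (hA : 0 ≤ A) (hs₂ : 1 < s₂)
    (hx₂ : 0 ≤ x₂) (hx : x₁ ≤ A * x₂) (he₀ : e 0 ≤ A * x₁)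
    (he₁ : ∀ M, e (M + 1) ≤ A * ((2 : ℝ) ^ M) ^ (-α) * x₂) :
    e N ≤ (A * A + A) * (s₂ ^ (1 - q₂ / 2) * x₂) := by
  have h1 : 1 ≤ s₂ ^ (1 - q₂ / 2) := Real.one_le_rpow hs₂.le (by linarith)
  have h2 : x₂ ≤ s₂ ^ (1 - q₂ / 2) * x₂ := le_mul_of_one_le_left hx₂ h1
  cases N with
  | zero =>
    have := mul_le_mul_of_nonneg_left hx hA
    have h3 := mul_le_mul_of_nonneg_left h2 (mul_nonneg hA hA)
    have h4 := mul_nonneg hA (hx₂.trans h2)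
    linarith
  | succ M =>
    have h3 : ((2 : ℝ) ^ M) ^ (-α) ≤ 1 :=
      Real.rpow_le_one_of_one_le_of_nonpos (one_le_pow₀ one_le_two) (by linarith)
    have h4 := mul_le_mul_of_nonneg_left h3 (mul_nonneg hA hx₂)
    have h5 := mul_le_mul_of_nonneg_left h2 hA
    have h6 := mul_nonneg (mul_nonneg hA hA) (hx₂.trans h2)
    linarith [he₁ M]

/-- Exclusion of level `N` means $\xi<2^Ns_2^{q_2}$. Raised to the power $\alpha$ this trades
$2^{-N\alpha}$ for $\xi^{-\alpha}s_2^{q_2\alpha}$, and $q_2\alpha\le1-q_2/2$ is the case assumption.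
-/
theorem err_le_of_le (hα : 0 < α) (hq₂' : 0 < q₂) (h : α ≤ 1 / q₂ - 1 / 2)
    (hξ : 1 < ξ) (hA : 0 ≤ A) (hs₂ : 1 < s₂) (hx₂ : 0 ≤ x₂) (hx : x₁ ≤ A * x₂)
    (he₀ : e 0 ≤ A * x₁) (he₁ : ∀ M, e (M + 1) ≤ A * ((2 : ℝ) ^ M) ^ (-α) * x₂)
    (hN : ∀ k : ℕ, (2 : ℝ) ^ k * s₂ ^ q₂ ≤ ξ ↔ k < N) :
    e N ≤ (A * A + A * 2 ^ α) * ξ ^ (-α) * (s₂ ^ (1 - q₂ / 2) * x₂) := by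
  have hξ0 : 0 < ξ := by linarith
  have hs0 : 0 < s₂ := by linarith
  have hlt : ξ < 2 ^ N * s₂ ^ q₂ := by
    have := (hN N).not.2 (lt_irrefl N); push Not at this; exact this
  have hexp : q₂ * α ≤ 1 - q₂ / 2 := by
    have := mul_le_mul_of_nonneg_left h hq₂'.le
    have e : q₂ * (1 / q₂ - 1 / 2) = 1 - q₂ / 2 := by field_simp
    linarith
  have h1 : ξ ^ α ≤ ((2 : ℝ) ^ N) ^ α * s₂ ^ (1 - q₂ / 2) := by
    refine (Real.rpow_le_rpow hξ0.le hlt.le hα.le).trans ?_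
    rw [Real.mul_rpow (by positivity) (by positivity), ← Real.rpow_mul hs0.le]
    exact mul_le_mul_of_nonneg_left (Real.rpow_le_rpow_of_exponent_le hs₂.le hexp) (by positivity)
  have hξα : 0 < ξ ^ α := by positivity
  set Y := s₂ ^ (1 - q₂ / 2) * x₂ with hY
  have hY0 : 0 ≤ Y := by positivity
  rw [Real.rpow_neg hξ0.le]
  have hz : 0 ≤ (ξ ^ α)⁻¹ * Y := by positivity
  cases N with
  | zero =>
    have h2 : x₂ ≤ (ξ ^ α)⁻¹ * Y := by
      rw [inv_mul_eq_div, le_div_iff₀ hξα, hY, mul_comm]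
      have h3 := mul_le_mul_of_nonneg_right h1 hx₂
      simpa using h3
    have h3 := mul_le_mul_of_nonneg_left hx hA
    have h4 := mul_le_mul_of_nonneg_left h2 (mul_nonneg hA hA)
    have h5 : 0 ≤ A * 2 ^ α * ((ξ ^ α)⁻¹ * Y) := by positivity
    linarith
  | succ M =>
    have h2 : ((2 : ℝ) ^ M) ^ (-α) * x₂ ≤ 2 ^ α * ((ξ ^ α)⁻¹ * Y) := by
      rw [Real.rpow_neg (by positivity), inv_mul_eq_div, div_le_iff₀ (by positivity)]
      rw [pow_succ, Real.mul_rpow (by positivity) (by positivity)] at h1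
      have h3 := mul_le_mul_of_nonneg_right h1 hx₂
      have e : 2 ^ α * ((ξ ^ α)⁻¹ * Y) * ((2 : ℝ) ^ M) ^ α
        = ((2 : ℝ) ^ M) ^ α * 2 ^ α * s₂ ^ (1 - q₂ / 2) * x₂ / ξ ^ α := by
        rw [hY]; field_simp
      rw [e, le_div_iff₀ hξα, mul_comm]
      exact h3
    have h4 := mul_le_mul_of_nonneg_left h2 hA
    have h5 : 0 ≤ A * A * ((ξ ^ α)⁻¹ * Y) := by positivity
    linarith [he₁ M]

/-- If the first level is excluded by the condition on $s_1$, stability and the $X^1$ norm suffice.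
In all other cases the condition on $s_2$ fails at level `N`, since the one on $s_1$ does not
involve the level, and consistency (or $x_1\le Ax_2$ at level 0) applies. -/
theorem err_le_of_lt (hα : 0 < α) (hq₁ : 0 < q₁) (hq₁' : q₁ < 2) (hq₂ : q₂ < 2)
    (hξ : 1 < ξ) (hlog : 1 ≤ Real.log ξ) (hA : 0 ≤ A) (hs₁ : 1 < s₁) (hs₂ : 1 < s₂)
    (hx₁ : 0 ≤ x₁) (hx₂ : 0 ≤ x₂) (hx : x₁ ≤ A * x₂) (he₀ : e 0 ≤ A * x₁)
    (he₁ : ∀ M, e (M + 1) ≤ A * ((2 : ℝ) ^ M) ^ (-α) * x₂)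
    (hN : ∀ k : ℕ, (s₁ ^ q₁ ≤ ξ * Real.log ξ ^ ((1 / q₁ - 1 / 2)⁻¹) ∧
      (2 : ℝ) ^ (2 * α / (2 - q₂) * (k : ℝ)) * s₂ ≤ ξ ^ (2 / (2 - q₂) * (1 / q₁ - 1 / 2))) ↔
        k < N) :
    e N ≤ (A + A * A + A * 2 ^ α) * ξ ^ (-(1 / q₁ - 1 / 2)) *
      (s₁ ^ (1 - q₁ / 2) * x₁ + s₂ ^ (1 - q₂ / 2) * x₂) := by
  have hξ0 : 0 < ξ := by linarith
  have hs0 : 0 < s₂ := by linarith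
  have hs10 : 0 < s₁ := by linarith
  have hs : 0 < 1 / q₁ - 1 / 2 := by
    rw [sub_pos]; exact one_div_lt_one_div_of_lt hq₁ hq₁'
  have hq : 0 < 2 - q₂ := by linarith
  set s := 1 / q₁ - 1 / 2 with hsdef
  set Y₁ := s₁ ^ (1 - q₁ / 2) * x₁ with hY₁
  set Y₂ := s₂ ^ (1 - q₂ / 2) * x₂ with hY₂
  have hY₁0 : 0 ≤ Y₁ := by positivity
  have hY₂0 : 0 ≤ Y₂ := by positivity
  have hξs : 0 < ξ ^ s := by positivity
  have key : ∀ k : ℕ, ξ ^ (2 / (2 - q₂) * s) < (2 : ℝ) ^ (2 * α / (2 - q₂) * (k : ℝ)) * s₂ →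
      ξ ^ s * x₂ ≤ ((2 : ℝ) ^ k) ^ α * Y₂ := by
    intro k hk
    -- The power $1-q_2/2$ cancels the factor $2/(2-q_2)$ in $\tau$ and $\vartheta$ and leaves
    -- $2^{k\alpha}$ and $\xi^s$.
    have h1 := Real.rpow_le_rpow (by positivity) hk.le (by linarith : 0 ≤ 1 - q₂ / 2)
    rw [Real.mul_rpow (by positivity) (by positivity), ← Real.rpow_mul hξ0.le,
      ← Real.rpow_mul zero_le_two] at h1
    have e1 : 2 / (2 - q₂) * s * (1 - q₂ / 2) = s := by field_simp
    have e2 : 2 * α / (2 - q₂) * (k : ℝ) * (1 - q₂ / 2) = k * α := by field_simp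
    rw [e1, e2, Real.rpow_mul zero_le_two, Real.rpow_natCast] at h1
    have := mul_le_mul_of_nonneg_right h1 hx₂
    rw [hY₂]; linarith
  rw [Real.rpow_neg hξ0.le]
  have hz₁ : 0 ≤ (ξ ^ s)⁻¹ * Y₁ := by positivity
  have hz₂ : 0 ≤ (ξ ^ s)⁻¹ * Y₂ := by positivity
  have hAA := mul_nonneg hA hA
  have hAα : 0 ≤ A * 2 ^ α := by positivity
  have hNN := (hN N).not.2 (lt_irrefl N)
  rw [mul_assoc, mul_add]
  cases N with
  | zero =>
    rcases not_and_or.1 hNN with h1 | h1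
    · push Not at h1
      -- The logarithmic factor of the threshold enters the error only through being at least 1.
      have h2 : ξ ≤ s₁ ^ q₁ :=
        (le_mul_of_one_le_right hξ0.le (Real.one_le_rpow hlog (inv_pos.2 hs).le)).trans h1.le
      have h3 := Real.rpow_le_rpow hξ0.le h2 hs.le
      have e1 : q₁ * s = 1 - q₁ / 2 := by rw [hsdef]; field_simp
      rw [← Real.rpow_mul hs10.le, e1] at h3
      have h4 : x₁ ≤ (ξ ^ s)⁻¹ * Y₁ := by
        rw [inv_mul_eq_div, le_div_iff₀ hξs, hY₁, mul_comm]
        exact mul_le_mul_of_nonneg_right h3 hx₁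
      nlinarith [mul_le_mul_of_nonneg_left h4 hA, mul_nonneg hAA hz₁, mul_nonneg hAα hz₁,
        mul_nonneg hA hz₂, mul_nonneg hAA hz₂, mul_nonneg hAα hz₂]
    · push Not at h1
      have h4 : x₂ ≤ (ξ ^ s)⁻¹ * Y₂ := by
        rw [inv_mul_eq_div, le_div_iff₀ hξs, mul_comm]
        simpa using key 0 h1
      nlinarith [mul_le_mul_of_nonneg_left h4 hAA, mul_le_mul_of_nonneg_left hx hA,
        mul_nonneg hAA hz₁, mul_nonneg hAα hz₁, mul_nonneg hA hz₁,
        mul_nonneg hA hz₂, mul_nonneg hAα hz₂]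
  | succ M =>
    have hM := ((hN M).2 (Nat.lt_succ_self M)).1
    have h1 := not_and.1 hNN hM
    push Not at h1
    have h2 := key (M + 1) h1
    rw [pow_succ, Real.mul_rpow (by positivity) (by positivity)] at h2
    have h3 : ((2 : ℝ) ^ M) ^ (-α) * x₂ ≤ 2 ^ α * ((ξ ^ s)⁻¹ * Y₂) := by
      rw [Real.rpow_neg (by positivity), inv_mul_eq_div, div_le_iff₀ (by positivity)]
      have e : 2 ^ α * ((ξ ^ s)⁻¹ * Y₂) * ((2 : ℝ) ^ M) ^ α
        = ((2 : ℝ) ^ M) ^ α * 2 ^ α * Y₂ / ξ ^ s := by field_simp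
      rw [e, le_div_iff₀ hξs, mul_comm]
      exact h2
    nlinarith [he₁ M, mul_le_mul_of_nonneg_left h3 hA, mul_nonneg hAA hz₁, mul_nonneg hAα hz₁,
      mul_nonneg hA hz₁, mul_nonneg hA hz₂, mul_nonneg hAA hz₂]

end Pointwise

/-! ### Choice of the threshold -/

section Choice

variable {α q₁ q₂ : ℝ} {σ₁ σ₂ : MultiIdx → ℝ}

/-- By monotonicity $\sigma_{2;0}>1$ is the smallest weight, so a $\xi$ slightly above 1 excludes
every index. This handles the $n$ too small for the general choice of $\xi$. -/
theorem exists_thresholdSet_eq_empty (hα : 0 < α) (hq₁ : 0 < q₁) (hq₁' : q₁ < 2)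
    (hq₂' : 0 < q₂) (hq₂ : q₂ < 2) (h2 : ∀ ν, 1 < σ₂ ν) (m2 : Monotone σ₂) :
    ∃ ξ > 1, thresholdSet α q₁ q₂ σ₁ σ₂ ξ = ∅ := by
  have h0 := h2 0
  have hle : ∀ ν, σ₂ 0 ≤ σ₂ ν := fun ν => m2 (zero_le)
  have hpos : 0 < σ₂ 0 := by linarith
  rcases le_or_gt α (1 / q₂ - 1 / 2) with h | h
  · refine ⟨σ₂ 0 ^ (q₂ / 2), Real.one_lt_rpow h0 (by positivity), ?_⟩
    rw [Set.eq_empty_iff_forall_notMem]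
    rintro ⟨k, ν⟩ hk
    rw [mem_thresholdSet_of_le h] at hk
    have h1 : σ₂ 0 ^ (q₂ / 2) < σ₂ 0 ^ q₂ := Real.rpow_lt_rpow_of_exponent_lt h0 (by linarith)
    have h3 : σ₂ 0 ^ q₂ ≤ σ₂ ν ^ q₂ := Real.rpow_le_rpow hpos.le (hle ν) hq₂'.le
    have h4 : σ₂ ν ^ q₂ ≤ 2 ^ k * σ₂ ν ^ q₂ :=
      le_mul_of_one_le_left (by have := hpos.trans_le (hle ν); positivity)
        (one_le_pow₀ one_le_two)
    linarith
  · set ϑ := 2 / (2 - q₂) * (1 / q₁ - 1 / 2) with hϑ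
    have hs : 0 < 1 / q₁ - 1 / 2 := by
      rw [sub_pos]; exact one_div_lt_one_div_of_lt hq₁ hq₁'
    have hq : 0 < 2 - q₂ := by linarith
    have hϑ0 : 0 < ϑ := mul_pos (by positivity) hs
    refine ⟨σ₂ 0 ^ (1 / (2 * ϑ)), Real.one_lt_rpow h0 (by positivity), ?_⟩
    rw [Set.eq_empty_iff_forall_notMem]
    rintro ⟨k, ν⟩ hk
    rw [mem_thresholdSet_of_lt h] at hk
    have hk := hk.2
    rw [← hϑ, ← Real.rpow_mul hpos.le] at hk
    have e1 : 1 / (2 * ϑ) * ϑ = 1 / 2 := by field_simp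
    rw [e1] at hk
    have h1 : σ₂ 0 ^ (1 / 2 : ℝ) < σ₂ 0 ^ (1 : ℝ) :=
      Real.rpow_lt_rpow_of_exponent_lt h0 (by norm_num)
    rw [Real.rpow_one] at h1
    have h3 : (1 : ℝ) ≤ (2 : ℝ) ^ (2 * α / (2 - q₂) * (k : ℝ)) :=
      Real.one_le_rpow one_le_two (by positivity)
    have h4 : σ₂ ν ≤ (2 : ℝ) ^ (2 * α / (2 - q₂) * (k : ℝ)) * σ₂ ν :=
      le_mul_of_one_le_left (by linarith [hle ν]) h3
    linarith [hle ν]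

/-- On the set, $2^k\le\xi\sigma_{2;\nu}^{-q_2}$, and the right-hand side is summable over $\nu$. -/
theorem sum_two_pow_thresholdSet_of_le (hα : 0 < α) (hq₁ : 0 < q₁) (hq₂' : 0 < q₂)
    (hq₂ : q₂ < 2) (h1 : ∀ ν, 1 < σ₁ ν) (h2 : ∀ ν, 1 < σ₂ ν) (m1 : Monotone σ₁)
    (m2 : Monotone σ₂) (hs₂ : Summable fun ν => σ₂ ν ^ (-q₂)) (h : α ≤ 1 / q₂ - 1 / 2) {ξ : ℝ}
    (hξ : 1 < ξ) :
    ∃ hfin : (thresholdSet α q₁ q₂ σ₁ σ₂ ξ).Finite,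
      ∑ i ∈ hfin.toFinset, (2 : ℝ) ^ i.1 ≤ 2 * ξ * ∑' ν, σ₂ ν ^ (-q₂) := by
  have h0 : ∀ ν, 0 < σ₂ ν := fun ν => zero_lt_one.trans (h2 ν)
  have hF := finite_rpow_le h2 hs₂ ξ
  have hGF : ∀ k ν, (k, ν) ∈ thresholdSet α q₁ q₂ σ₁ σ₂ ξ → ν ∈ {ν | σ₂ ν ^ q₂ ≤ ξ} := by
    intro k ν hk
    rw [mem_thresholdSet_of_le h] at hk
    have := h0 ν
    exact (le_mul_of_one_le_left (by positivity) (one_le_pow₀ one_le_two)).trans hk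
  have hD : ∀ k ν, (k, ν) ∈ thresholdSet α q₁ q₂ σ₁ σ₂ ξ → (2 : ℝ) ^ k ≤ ξ * σ₂ ν ^ (-q₂) := by
    intro k ν hk
    rw [mem_thresholdSet_of_le h] at hk
    have := Real.rpow_pos_of_pos (h0 ν) q₂
    rw [Real.rpow_neg (h0 ν).le, ← div_eq_mul_inv, le_div_iff₀ this]
    exact hk
  have hfin := finite_of_forall_pow_le hF hGF (B := ξ) fun k ν hk => by
    refine (hD k ν hk).trans (mul_le_of_le_one_right (by linarith) ?_)
    exact Real.rpow_le_one_of_one_le_of_nonpos (h2 ν).le (by linarith)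
  have hlow : IsLowerSet (thresholdSet α q₁ q₂ σ₁ σ₂ ξ) :=
    isLowerSet_thresholdSet hα hq₁ hq₂' hq₂ h1 h2 m1 m2
  refine ⟨hfin, (sum_two_pow_le hfin hlow (F := hF.toFinset)
    (fun k ν hk => hF.mem_toFinset.2 (hGF k ν hk)) (fun ν => ?_) hD).trans ?_⟩
  · have := h0 ν; positivity
  · rw [← Finset.mul_sum, mul_assoc]
    have := hs₂.sum_le_tsum hF.toFinset fun ν _ => (Real.rpow_pos_of_pos (h0 ν) (-q₂)).le
    gcongr

/-- Hölder's inequality with exponents $1/r$ and $1/(1-r)$ against the constant function 1. -/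
theorem sum_rpow_le_card_rpow {ι : Type*} (F : Finset ι) {f : ι → ℝ} (hf : ∀ i, 0 ≤ f i) {r : ℝ}
    (hr0 : 0 < r) (hr1 : r < 1) :
    ∑ i ∈ F, f i ^ r ≤ (∑ i ∈ F, f i) ^ r * (F.card : ℝ) ^ (1 - r) := by
  have hpq : (1 / r).HolderConjugate (1 / (1 - r)) := by
    have hr : 0 < 1 - r := by linarith
    rw [Real.holderConjugate_iff]
    refine ⟨(one_lt_div hr0).2 hr1, ?_⟩
    rw [one_div, one_div, inv_inv, inv_inv]; ring
  have h := Real.inner_le_Lp_mul_Lq_of_nonneg F hpq (f := fun i => f i ^ r) (g := fun _ => 1)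
    (fun i _ => Real.rpow_nonneg (hf i) r) (fun _ _ => zero_le_one)
  simp only [mul_one, Real.one_rpow, Finset.sum_const, nsmul_eq_mul, one_div_one_div] at h
  refine h.trans (le_of_eq ?_)
  congr 2
  refine Finset.sum_congr rfl fun i _ => ?_
  rw [← Real.rpow_mul (hf i), mul_one_div_cancel hr0.ne', Real.rpow_one]

/-- With $r=(1/q_2-1/2)/\alpha<1$ the second condition says
$2^k\le\xi^{s/\alpha}(\sigma_{2;\nu}^{-q_2})^r$, where $s=1/q_1-1/2$. The power $r$ of a summable
family need not be summable; the first condition bounds the number of $\nu$, and Hölder's inequality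
combines the two. -/
theorem sum_two_pow_thresholdSet_of_lt (hα : 0 < α) (hq₁ : 0 < q₁)
    (hq₂' : 0 < q₂) (hq₂ : q₂ < 2) (h1 : ∀ ν, 1 < σ₁ ν) (h2 : ∀ ν, 1 < σ₂ ν) (m1 : Monotone σ₁)
    (m2 : Monotone σ₂) (hs₁ : Summable fun ν => σ₁ ν ^ (-q₁))
    (hs₂ : Summable fun ν => σ₂ ν ^ (-q₂)) (h : 1 / q₂ - 1 / 2 < α) {ξ : ℝ} (hξ : 1 < ξ) :
    ∃ hfin : (thresholdSet α q₁ q₂ σ₁ σ₂ ξ).Finite,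
      ∑ i ∈ hfin.toFinset, (2 : ℝ) ^ i.1 ≤
        2 * ((∑' ν, σ₂ ν ^ (-q₂)) ^ ((1 / q₂ - 1 / 2) / α)
          * (∑' ν, σ₁ ν ^ (-q₁)) ^ (1 - (1 / q₂ - 1 / 2) / α)) *
        (ξ ^ ((α + (1 / q₁ - 1 / q₂)) / α) *
          Real.log ξ ^ ((1 / q₁ - 1 / 2)⁻¹ * (1 - (1 / q₂ - 1 / 2) / α))) := by
  have h0 : ∀ ν, 0 < σ₂ ν := fun ν => zero_lt_one.trans (h2 ν)
  have h01 : ∀ ν, 0 < σ₁ ν := fun ν => zero_lt_one.trans (h1 ν)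
  have hξ0 : 0 < ξ := by linarith
  have hlog : 0 < Real.log ξ := Real.log_pos hξ
  have hq : 0 < 2 - q₂ := by linarith
  have ht : 0 < 1 / q₂ - 1 / 2 := by
    rw [sub_pos]; exact one_div_lt_one_div_of_lt hq₂' hq₂
  have hr0 : 0 < (1 / q₂ - 1 / 2) / α := by positivity
  have hr1 : (1 / q₂ - 1 / 2) / α < 1 := (div_lt_one hα).2 h
  set r := (1 / q₂ - 1 / 2) / α with hr
  set s := 1 / q₁ - 1 / 2 with hs
  set x := ξ * Real.log ξ ^ s⁻¹ with hx
  have hx0 : 0 < x := by positivity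
  have hF := finite_rpow_le h1 hs₁ x
  have hGF : ∀ k ν, (k, ν) ∈ thresholdSet α q₁ q₂ σ₁ σ₂ ξ → ν ∈ {ν | σ₁ ν ^ q₁ ≤ x} :=
    fun k ν hk => ((mem_thresholdSet_of_lt h).1 hk).1
  have hD : ∀ k ν, (k, ν) ∈ thresholdSet α q₁ q₂ σ₁ σ₂ ξ →
      (2 : ℝ) ^ k ≤ ξ ^ (s / α) * (σ₂ ν ^ (-q₂)) ^ r := by
    intro k ν hk
    have hk := ((mem_thresholdSet_of_lt h).1 hk).2
    have h3 := Real.rpow_le_rpow (by have := h0 ν; positivity) hk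
      (by positivity : 0 ≤ (2 - q₂) / (2 * α))
    rw [Real.mul_rpow (by positivity) (h0 ν).le, ← Real.rpow_mul hξ0.le,
      ← Real.rpow_mul zero_le_two] at h3
    have e1 : 2 / (2 - q₂) * (1 / q₁ - 1 / 2) * ((2 - q₂) / (2 * α)) = s / α := by
      rw [hs]; field_simp
    have e2 : 2 * α / (2 - q₂) * (k : ℝ) * ((2 - q₂) / (2 * α)) = k := by field_simp
    have e3 : -q₂ * r = -((2 - q₂) / (2 * α)) := by rw [hr]; field_simp
    rw [e1, e2, Real.rpow_natCast] at h3
    have hp := Real.rpow_pos_of_pos (h0 ν) ((2 - q₂) / (2 * α))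
    rw [← Real.rpow_mul (h0 ν).le, e3, Real.rpow_neg (h0 ν).le, ← div_eq_mul_inv, le_div_iff₀ hp]
    exact h3
  have hσle : ∀ ν, (σ₂ ν ^ (-q₂)) ^ r ≤ 1 := fun ν =>
    Real.rpow_le_one (Real.rpow_pos_of_pos (h0 ν) _).le
      (Real.rpow_le_one_of_one_le_of_nonpos (h2 ν).le (by linarith)) hr0.le
  have hfin := finite_of_forall_pow_le hF hGF (B := ξ ^ (s / α)) fun k ν hk =>
    (hD k ν hk).trans (mul_le_of_le_one_right (by positivity) (hσle ν))
  have hlow : IsLowerSet (thresholdSet α q₁ q₂ σ₁ σ₂ ξ) :=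
    isLowerSet_thresholdSet hα hq₁ hq₂' hq₂ h1 h2 m1 m2
  refine ⟨hfin, (sum_two_pow_le hfin hlow (F := hF.toFinset)
    (fun k ν hk => hF.mem_toFinset.2 (hGF k ν hk)) (fun ν => ?_) hD).trans ?_⟩
  · have := h0 ν; positivity
  · have hcard := card_le_of_rpow_le h1 hs₁ hx0 (F := hF.toFinset)
      fun ν hν => by simpa using hν
    have hsum := hs₂.sum_le_tsum hF.toFinset fun ν _ => (Real.rpow_pos_of_pos (h0 ν) (-q₂)).le
    have hT1 : 0 ≤ ∑' ν, σ₁ ν ^ (-q₁) := tsum_nonneg fun ν => (Real.rpow_pos_of_pos (h01 ν) _).le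
    have hT2 : 0 ≤ ∑' ν, σ₂ ν ^ (-q₂) := tsum_nonneg fun ν => (Real.rpow_pos_of_pos (h0 ν) _).le
    have hS0 : 0 ≤ ∑ ν ∈ hF.toFinset, σ₂ ν ^ (-q₂) :=
      Finset.sum_nonneg fun ν _ => (Real.rpow_pos_of_pos (h0 ν) _).le
    rw [← Finset.mul_sum]
    have hH := sum_rpow_le_card_rpow hF.toFinset (f := fun ν => σ₂ ν ^ (-q₂))
      (fun ν => (Real.rpow_pos_of_pos (h0 ν) _).le) hr0 hr1
    have hH2 : ∑ ν ∈ hF.toFinset, (σ₂ ν ^ (-q₂)) ^ r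
        ≤ (∑' ν, σ₂ ν ^ (-q₂)) ^ r * (x * ∑' ν, σ₁ ν ^ (-q₁)) ^ (1 - r) := by
      refine hH.trans (mul_le_mul (Real.rpow_le_rpow hS0 hsum hr0.le)
        (Real.rpow_le_rpow (by positivity) hcard (by linarith)) (by positivity) (by positivity))
    have e4 : (α + (1 / q₁ - 1 / q₂)) / α = s / α + (1 - r) := by
      rw [hs, hr]; field_simp; ring
    rw [e4, Real.rpow_add hξ0, Real.rpow_mul hlog.le]
    have e5 : (x * ∑' ν, σ₁ ν ^ (-q₁)) ^ (1 - r)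
        = ξ ^ (1 - r) * (Real.log ξ ^ s⁻¹) ^ (1 - r) * (∑' ν, σ₁ ν ^ (-q₁)) ^ (1 - r) := by
      rw [hx, Real.mul_rpow (by positivity) hT1, Real.mul_rpow hξ0.le (by positivity)]
    rw [e5] at hH2
    have := mul_le_mul_of_nonneg_left hH2 (by positivity : 0 ≤ 2 * ξ ^ (s / α))
    linarith

end Choice

/-! ### Thresholds that meet the budget $n$ -/

section Rates

variable {α q₁ q₂ : ℝ} {σ₁ σ₂ : MultiIdx → ℝ}

theorem exists_threshold_of_le (hα : 0 < α) (hq₁ : 0 < q₁) (hq₁' : q₁ < 2) (hq₂' : 0 < q₂)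
    (hq₂ : q₂ < 2) (h1 : ∀ ν, 1 < σ₁ ν) (h2 : ∀ ν, 1 < σ₂ ν) (m1 : Monotone σ₁)
    (m2 : Monotone σ₂) (hs₂ : Summable fun ν => σ₂ ν ^ (-q₂)) (h : α ≤ 1 / q₂ - 1 / 2) :
    ∃ C > 0, ∀ n : ℕ, 1 ≤ n → ∃ ξ > 1,
      (∃ hfin : (thresholdSet α q₁ q₂ σ₁ σ₂ ξ).Finite, ∑ i ∈ hfin.toFinset, (2 : ℝ) ^ i.1 ≤ n) ∧
      ξ ^ (-α) ≤ C * (n : ℝ) ^ (-α) := by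
  obtain ⟨ξ₀, hξ₀, hempty⟩ := exists_thresholdSet_eq_empty (σ₁ := σ₁) hα hq₁ hq₁' hq₂' hq₂ h2 m2
  set T := ∑' ν, σ₂ ν ^ (-q₂) with hT
  have hT0 : 0 ≤ T := tsum_nonneg fun ν =>
    (Real.rpow_pos_of_pos (zero_lt_one.trans (h2 ν)) _).le
  set M := 2 * T + 1 with hM
  have hM0 : 0 < M := by positivity
  refine ⟨M ^ α, by positivity, fun n hn => ?_⟩
  have hn0 : (0 : ℝ) < n := by exact_mod_cast hn
  have hrate : ∀ ξ : ℝ, n / M ≤ ξ → ξ ^ (-α) ≤ M ^ α * (n : ℝ) ^ (-α) := by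
    intro ξ hξ
    refine (Real.rpow_le_rpow_of_nonpos (by positivity) hξ (by linarith)).trans (le_of_eq ?_)
    rw [Real.div_rpow hn0.le hM0.le, Real.rpow_neg hM0.le, div_inv_eq_mul, mul_comm]
  -- If $n/M\le1$, the empty set with $\xi_0>1\ge n/M$ satisfies the same rate estimate.
  by_cases hlarge : 1 < n / M
  · obtain ⟨hfin, hsum⟩ := sum_two_pow_thresholdSet_of_le hα hq₁ hq₂' hq₂ h1 h2 m1 m2 hs₂ h hlarge
    refine ⟨n / M, hlarge, ⟨hfin, hsum.trans ?_⟩, hrate _ le_rfl⟩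
    rw [← hT, mul_right_comm, mul_div_assoc', div_le_iff₀ hM0, mul_comm]
    exact mul_le_mul_of_nonneg_left (by linarith) hn0.le
  · refine ⟨ξ₀, hξ₀, ⟨by rw [hempty]; exact Set.finite_empty, ?_⟩, hrate _ (by linarith)⟩
    refine (Finset.sum_eq_zero fun i hi => ?_).trans_le hn0.le
    rw [Set.Finite.mem_toFinset, hempty] at hi
    exact absurd hi (Set.notMem_empty i)

theorem rateKappa_mem_Ioo (hq₁ : 0 < q₁) (hq₁' : q₁ < 2) (h : 1 / q₂ - 1 / 2 < α) :
    0 < rateKappa α q₁ q₂ ∧ rateKappa α q₁ q₂ < 1 := by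
  have hs : 0 < 1 / q₁ - 1 / 2 := by
    rw [sub_pos]; exact one_div_lt_one_div_of_lt hq₁ hq₁'
  unfold rateKappa
  exact ⟨div_pos (by linarith) (by linarith), (div_lt_one (by linarith)).2 (by linarith)⟩

/-- The cost is $M\xi^a(\log\xi)^b$. Taking $\xi^a=x=n/((M+1)(\log n)^b)$ keeps it below $n$ because
$\log\xi\le\log n$, and $\xi^{-s}=x^{-\beta}$ yields $n^{-\beta}(\log n)^{b\beta}$ with
$b\beta=\kappa$. The second alternative is for small $n$, where the index set is empty. -/
theorem exists_threshold_of_lt (hα : 0 < α) (hq₁ : 0 < q₁) (hq₁₂ : q₁ ≤ q₂) (hq₂ : q₂ < 2)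
    (h1 : ∀ ν, 1 < σ₁ ν) (h2 : ∀ ν, 1 < σ₂ ν) (m1 : Monotone σ₁)
    (m2 : Monotone σ₂) (hs₁ : Summable fun ν => σ₁ ν ^ (-q₁))
    (hs₂ : Summable fun ν => σ₂ ν ^ (-q₂)) (h : 1 / q₂ - 1 / 2 < α) :
    ∃ C > 0, ∀ n : ℕ, 1 ≤ n → ∃ ξ > 1,
      (∃ hfin : (thresholdSet α q₁ q₂ σ₁ σ₂ ξ).Finite, ∑ i ∈ hfin.toFinset, (2 : ℝ) ^ i.1 ≤ n) ∧
      (2 ≤ n → (1 ≤ Real.log ξ ∧ ξ ^ (-(1 / q₁ - 1 / 2))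
          ≤ C * ((n : ℝ) ^ (-rateBeta α q₁ q₂) * Real.log n ^ rateKappa α q₁ q₂)) ∨
        1 ≤ C * ((n : ℝ) ^ (-rateBeta α q₁ q₂) * Real.log n ^ rateKappa α q₁ q₂)) := by
  have hq₂' : 0 < q₂ := hq₁.trans_le hq₁₂
  have hq₁' : q₁ < 2 := hq₁₂.trans_lt hq₂
  obtain ⟨ξ₀, hξ₀, hempty⟩ := exists_thresholdSet_eq_empty (σ₁ := σ₁) hα hq₁ hq₁' hq₂' hq₂ h2 m2
  have hs : 0 < 1 / q₁ - 1 / 2 := by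
    rw [sub_pos]; exact one_div_lt_one_div_of_lt hq₁ hq₁'
  have hδ : 0 ≤ 1 / q₁ - 1 / q₂ := by
    rw [sub_nonneg]; exact one_div_le_one_div_of_le hq₁ hq₁₂
  obtain ⟨hκ0, hκ1⟩ := rateKappa_mem_Ioo hq₁ hq₁' h
  set s := 1 / q₁ - 1 / 2 with hsdef
  set r := (1 / q₂ - 1 / 2) / α with hr
  have hr1 : r < 1 := (div_lt_one hα).2 h
  set a := (α + (1 / q₁ - 1 / q₂)) / α with ha
  have ha1 : 1 ≤ a := (one_le_div hα).2 (by linarith)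
  have ha0 : 0 < a := by linarith
  set b := s⁻¹ * (1 - r) with hb
  have hb0 : 0 < b := mul_pos (inv_pos.2 hs) (by linarith)
  set β := rateBeta α q₁ q₂ with hβ
  set κ := rateKappa α q₁ q₂ with hκ
  have hαδ : 0 < α + (1 / q₁ - 1 / q₂) := by linarith
  have eβ : s / a = β := by rw [hβ, rateBeta, ha, ← hsdef]; field_simp
  have eκ : b * β = κ := by
    rw [← eβ, hb, ha, hr, hκ, rateKappa]
    have : α + 1 / q₁ - 1 / q₂ = α + (1 / q₁ - 1 / q₂) := by ring
    rw [this]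
    field_simp
    ring
  have hβ0 : 0 < β := by rw [← eβ]; positivity
  set M := 2 * ((∑' ν, σ₂ ν ^ (-q₂)) ^ r * (∑' ν, σ₁ ν ^ (-q₁)) ^ (1 - r)) with hM
  have hM0 : 0 ≤ M := by
    have hT1 : 0 ≤ ∑' ν, σ₁ ν ^ (-q₁) := tsum_nonneg fun ν =>
      (Real.rpow_pos_of_pos (zero_lt_one.trans (h1 ν)) _).le
    have hT2 : 0 ≤ ∑' ν, σ₂ ν ^ (-q₂) := tsum_nonneg fun ν =>
      (Real.rpow_pos_of_pos (zero_lt_one.trans (h2 ν)) _).le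
    positivity
  have hM1 : 0 < M + 1 := by linarith
  -- Beyond `N₀` the quantity $x$ is at least $e^a$, that is $\log\xi\ge1$, and $\log n\ge1$ gives
  -- $x\le n$.
  obtain ⟨N₀, hN₀⟩ : ∃ N₀ : ℕ, ∀ n : ℕ, N₀ ≤ n → 1 ≤ Real.log n ∧
      Real.exp a * (M + 1) * Real.log n ^ b ≤ n := by
    have hc : 0 < (Real.exp a * (M + 1))⁻¹ := by positivity
    have hl := (isLittleO_log_rpow_rpow_atTop b zero_lt_one).def hc
    have h3 := (Real.tendsto_log_atTop.eventually_ge_atTop 1).and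
      (hl.and (Filter.eventually_ge_atTop 0))
    obtain ⟨N₀, hN₀⟩ := Filter.eventually_atTop.1 (tendsto_natCast_atTop_atTop.eventually h3)
    refine ⟨N₀, fun n hn => ?_⟩
    obtain ⟨g1, g2, g3⟩ := hN₀ n hn
    refine ⟨g1, ?_⟩
    rw [Real.rpow_one, Real.norm_of_nonneg (by positivity), Real.norm_of_nonneg g3,
      inv_mul_eq_div, le_div_iff₀ (by positivity)] at g2
    linarith
  -- The first summand is the constant for $n\ge N_0$; the second makes the bound at least 1 for
  -- $2\le n<N_0$.
  set C := (M + 1) ^ β + (N₀ : ℝ) ^ β / Real.log 2 ^ κ with hC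
  have hlog2 : 0 < Real.log 2 := Real.log_pos one_lt_two
  have hC0 : 0 < C := by positivity
  refine ⟨C, hC0, fun n hn => ?_⟩
  have hn0 : (0 : ℝ) < n := by exact_mod_cast hn
  by_cases hlarge : N₀ ≤ n
  · obtain ⟨hl1, hl2⟩ := hN₀ n hlarge
    have hl0 : 0 < Real.log n := by linarith
    set x := (n : ℝ) / ((M + 1) * Real.log n ^ b) with hx
    have hx0 : 0 < x := by positivity
    have hxe : Real.exp a ≤ x := by
      rw [hx, le_div_iff₀ (by positivity)]; linarith
    have hxn : x ≤ n := by
      refine div_le_self hn0.le ?_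
      exact one_le_mul_of_one_le_of_one_le (by linarith) (Real.one_le_rpow hl1 hb0.le)
    have hx1 : 1 ≤ x := (Real.one_le_exp ha0.le).trans hxe
    have hlogξ : Real.log (x ^ a⁻¹) = a⁻¹ * Real.log x := Real.log_rpow hx0 _
    have hge : 1 ≤ Real.log (x ^ a⁻¹) := by
      rw [hlogξ, inv_mul_eq_div, le_div_iff₀ ha0, one_mul]
      exact (Real.le_log_iff_exp_le hx0).2 hxe
    have hξ0 : 0 < x ^ a⁻¹ := by positivity
    have hξ1 : 1 < x ^ a⁻¹ := by
      by_contra hcon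
      have := Real.log_nonpos hξ0.le (not_lt.1 hcon)
      linarith
    have hle : Real.log (x ^ a⁻¹) ≤ Real.log n := by
      rw [hlogξ]
      refine (mul_le_of_le_one_left (Real.log_nonneg hx1) (inv_le_one_of_one_le₀ ha1)).trans ?_
      exact Real.log_le_log hx0 hxn
    obtain ⟨hfin, hsum⟩ := sum_two_pow_thresholdSet_of_lt hα hq₁ hq₂' hq₂ h1 h2 m1 m2 hs₁ hs₂ h hξ1
    refine ⟨x ^ a⁻¹, hξ1, ⟨hfin, hsum.trans ?_⟩, fun _ => Or.inl ⟨hge, ?_⟩⟩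
    · rw [← hr, ← hM, ← ha, ← hsdef, ← hb, ← Real.rpow_mul hx0.le, inv_mul_cancel₀ ha0.ne',
        Real.rpow_one]
      have g1 : Real.log (x ^ a⁻¹) ^ b ≤ Real.log n ^ b :=
        Real.rpow_le_rpow (by linarith) hle hb0.le
      calc M * (x * Real.log (x ^ a⁻¹) ^ b) ≤ (M + 1) * (x * Real.log n ^ b) := by
            refine mul_le_mul (by linarith) (mul_le_mul_of_nonneg_left g1 hx0.le) ?_ hM1.le
            have : 0 < Real.log (x ^ a⁻¹) := by linarith
            positivity
        _ = n := by rw [hx]; field_simp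
    · rw [← Real.rpow_mul hx0.le]
      have e1 : a⁻¹ * -s = -β := by rw [← eβ]; field_simp
      rw [e1, hx, Real.div_rpow hn0.le (by positivity), Real.mul_rpow hM1.le (by positivity),
        ← Real.rpow_mul hl0.le, mul_neg, eκ, Real.rpow_neg hM1.le, Real.rpow_neg hl0.le,
        ← mul_inv, div_inv_eq_mul]
      have : (M + 1) ^ β ≤ C := by rw [hC]; linarith [show 0 ≤ (N₀ : ℝ) ^ β / Real.log 2 ^ κ by positivity]
      have h5 := mul_le_mul_of_nonneg_right this
        (by positivity : 0 ≤ (n : ℝ) ^ (-β) * Real.log n ^ κ)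
      linarith
  · refine ⟨ξ₀, hξ₀, ⟨by rw [hempty]; exact Set.finite_empty, ?_⟩, fun hn2 => Or.inr ?_⟩
    · refine (Finset.sum_eq_zero fun i hi => ?_).trans_le hn0.le
      rw [Set.Finite.mem_toFinset, hempty] at hi
      exact absurd hi (Set.notMem_empty i)
    · have hnN : (n : ℝ) ≤ N₀ := by exact_mod_cast (not_le.1 hlarge).le
      have hN0 : (0 : ℝ) < N₀ := by linarith
      have g1 : (N₀ : ℝ) ^ (-β) ≤ (n : ℝ) ^ (-β) :=
        Real.rpow_le_rpow_of_nonpos hn0 hnN (by linarith)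
      have g2 : Real.log 2 ^ κ ≤ Real.log n ^ κ :=
        Real.rpow_le_rpow hlog2.le (Real.log_le_log two_pos (by exact_mod_cast hn2)) hκ0.le
      have g3 : (N₀ : ℝ) ^ β / Real.log 2 ^ κ ≤ C := by
        rw [hC]; linarith [show 0 ≤ (M + 1) ^ β by positivity]
      have g4 : (N₀ : ℝ) ^ β / Real.log 2 ^ κ * ((N₀ : ℝ) ^ (-β) * Real.log 2 ^ κ) = 1 := by
        rw [Real.rpow_neg hN0.le]
        have := Real.rpow_pos_of_pos hN0 β
        have := Real.rpow_pos_of_pos hlog2 κ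
        field_simp
      rw [← g4]
      refine mul_le_mul g3 (mul_le_mul g1 g2 (by positivity) (by positivity)) (by positivity) hC0.le

end Rates

section Combined

variable {α q₁ q₂ : ℝ} {σ₁ σ₂ : MultiIdx → ℝ}

/-- Thresholds for which the cardinality weighted with the spatial dimensions is at most `n` and
all errors obey the asserted rates. -/
theorem exists_threshold (hα : 0 < α) (hq₁ : 0 < q₁) (hq₁₂ : q₁ ≤ q₂) (hq₂ : q₂ < 2)
    (h1 : ∀ ν, 1 < σ₁ ν) (h2 : ∀ ν, 1 < σ₂ ν) (m1 : Monotone σ₁)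
    (m2 : Monotone σ₂) (hs₁ : Summable fun ν => σ₁ ν ^ (-q₁))
    (hs₂ : Summable fun ν => σ₂ ν ^ (-q₂)) {A : ℝ} (hA : 0 < A) {x₁ x₂ : MultiIdx → ℝ}
    (hx₁ : ∀ ν, 0 ≤ x₁ ν) (hx₂ : ∀ ν, 0 ≤ x₂ ν) (hx : ∀ ν, x₁ ν ≤ A * x₂ ν)
    {e : ℕ → MultiIdx → ℝ} (he₀ : ∀ ν, e 0 ν ≤ A * x₁ ν)
    (he₁ : ∀ M ν, e (M + 1) ν ≤ A * ((2 : ℝ) ^ M) ^ (-α) * x₂ ν) :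
    ∃ ξ : ℕ → ℝ, (∀ n : ℕ, 1 ≤ n → 1 < ξ n ∧
      ∃ hfin : (thresholdSet α q₁ q₂ σ₁ σ₂ (ξ n)).Finite,
        ∑ i ∈ hfin.toFinset, (2 : ℝ) ^ i.1 ≤ n) ∧
      ∃ K > 0, ∀ n : ℕ, 1 ≤ n → ∀ N : MultiIdx → ℕ,
        (∀ k ν, (k, ν) ∈ thresholdSet α q₁ q₂ σ₁ σ₂ (ξ n) ↔ k < N ν) → ∀ ν,
        (α ≤ 1 / q₂ - 1 / 2 → e (N ν) ν ≤ K * (n : ℝ) ^ (-α) *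
          (σ₁ ν ^ (1 - q₁ / 2) * x₁ ν + σ₂ ν ^ (1 - q₂ / 2) * x₂ ν)) ∧
        (1 / q₂ - 1 / 2 < α → 2 ≤ n →
          e (N ν) ν ≤ K * ((n : ℝ) ^ (-rateBeta α q₁ q₂) * Real.log n ^ rateKappa α q₁ q₂) *
          (σ₁ ν ^ (1 - q₁ / 2) * x₁ ν + σ₂ ν ^ (1 - q₂ / 2) * x₂ ν)) := by
  have hq₂' : 0 < q₂ := hq₁.trans_le hq₁₂
  have hq₁' : q₁ < 2 := hq₁₂.trans_lt hq₂
  have hY₁ : ∀ ν, 0 ≤ σ₁ ν ^ (1 - q₁ / 2) * x₁ ν := fun ν =>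
    mul_nonneg (Real.rpow_nonneg (zero_le_one.trans (h1 ν).le) _) (hx₁ ν)
  have hY₂ : ∀ ν, 0 ≤ σ₂ ν ^ (1 - q₂ / 2) * x₂ ν := fun ν =>
    mul_nonneg (Real.rpow_nonneg (zero_le_one.trans (h2 ν).le) _) (hx₂ ν)
  -- Passes from a bound by a power $t$ of the threshold to the rate $u$ in $n$.
  have hscale : ∀ {E D t C u Y Y' : ℝ}, E ≤ D * t * Y → t ≤ C * u → 0 ≤ D → 0 ≤ Y → Y ≤ Y' →
      0 ≤ C * u → E ≤ D * C * u * Y' := by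
    intro E D t C u Y Y' hE ht hD hY hYY hCu
    have g1 := mul_le_mul_of_nonneg_left ht hD
    have g2 := mul_le_mul_of_nonneg_right g1 hY
    have g3 := mul_le_mul_of_nonneg_left hYY (mul_nonneg hD hCu)
    linarith
  rcases le_or_gt α (1 / q₂ - 1 / 2) with h | h
  · obtain ⟨C, hC, hex⟩ := exists_threshold_of_le hα hq₁ hq₁' hq₂' hq₂ h1 h2 m1 m2 hs₂ h
    choose! ξ hξ hfin hrate using hex
    refine ⟨ξ, fun n hn => ⟨hξ n hn, hfin n hn⟩, (A * A + A * 2 ^ α) * C, by positivity,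
      fun n hn N hN ν => ⟨fun _ => ?_, fun h' => absurd h (not_le.2 h')⟩⟩
    refine hscale (err_le_of_le (e := fun k => e k ν) hα hq₂' h (hξ n hn) hA.le (h2 ν) (hx₂ ν)
      (hx ν) (he₀ ν) (fun M => he₁ M ν)
      fun k => (mem_thresholdSet_of_le h).symm.trans (hN k ν)) (hrate n hn) (by positivity) (hY₂ ν)
      (by linarith [hY₁ ν]) (by positivity)
  · obtain ⟨C, hC, hex⟩ := exists_threshold_of_lt hα hq₁ hq₁₂ hq₂ h1 h2 m1 m2 hs₁ hs₂ h
    choose! ξ hξ hfin hrate using hex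
    refine ⟨ξ, fun n hn => ⟨hξ n hn, hfin n hn⟩, (A + A * A + A * 2 ^ α) * C, by positivity,
      fun n hn N hN ν => ⟨fun h' => absurd h' (not_le.2 h), fun _ hn2 => ?_⟩⟩
    have hlog : 0 ≤ Real.log n := Real.log_nonneg (by exact_mod_cast hn)
    rcases hrate n hn hn2 with ⟨hl, hr⟩ | hr
    · exact hscale (err_le_of_lt (e := fun k => e k ν) hα hq₁ hq₁' hq₂ (hξ n hn) hl hA.le (h1 ν)
        (h2 ν) (hx₁ ν) (hx₂ ν) (hx ν) (he₀ ν) (fun M => he₁ M ν)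
        fun k => (mem_thresholdSet_of_lt h).symm.trans (hN k ν)) hr (by positivity)
        (add_nonneg (hY₁ ν) (hY₂ ν)) le_rfl (by positivity)
    · refine hscale (D := A + A * A + A * 2 ^ α) (t := 1) ?_ hr (by positivity) (hY₂ ν)
        (by linarith [hY₁ ν]) (by positivity)
      refine (err_le_of_one_lt (e := fun k => e k ν) hα hq₂ hA.le (h2 ν) (hx₂ ν) (hx ν) (he₀ ν)
        fun M => he₁ M ν).trans (mul_le_mul_of_nonneg_right ?_ (hY₂ ν))
      have : 0 < A * 2 ^ α := by positivity
      linarith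

end Combined

/-! ### Assembly of the main theorem -/

theorem mainTheorem1
    {𝕜 : Type*} [RCLike 𝕜]
    -- the Hilbert spaces `X₁ ⊇ X₂` (over the reals or the complex numbers)
    {X₁ : Type*} [NormedAddCommGroup X₁] [InnerProductSpace 𝕜 X₁] [CompleteSpace X₁]
    [NormedSpace ℝ X₁] [IsScalarTower ℝ 𝕜 X₁]
    {X₂ : Type*} [NormedAddCommGroup X₂] [InnerProductSpace 𝕜 X₂] [CompleteSpace X₂]
    [NormedSpace ℝ X₂] [IsScalarTower ℝ 𝕜 X₂]
    (emb : X₂ →L[𝕜] X₁) (hemb : Function.Injective emb)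
    -- the Jacobi parameters: bounded sequences with infimum larger than `-1`
    (a b : ℕ → ℝ)
    (ha : ∃ a₀ > (-1 : ℝ), ∀ j, a₀ ≤ a j) (hb : ∃ b₀ > (-1 : ℝ), ∀ j, b₀ ≤ b j)
    (ha' : BddAbove (Set.range a)) (hb' : BddAbove (Set.range b))
    -- the constants `ε` and `C_ε`
    (ε Cε : ℝ) (hε : 0 < ε) (hCε : IsAdmissibleConst a b ε Cε)
    -- stable and consistent spatial approximation with rate `α`
    (V : ℕ → Submodule 𝕜 X₁) (hV0 : V 0 = ⊥)
    (hV : ∀ m, FiniteDimensional 𝕜 (V m) ∧ Module.finrank 𝕜 (V m) ≤ m)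
    (P : ℕ → X₁ →ₗ[𝕜] X₁) (hP : ∀ m w, P m w ∈ V m)
    (α : ℝ) (hα : 0 < α) (C₁ C₂ : ℝ)
    (hstab : ∀ m, ∀ w : X₂, ‖P m (emb w)‖ ≤ C₁ * ‖emb w‖)
    (hcons : ∀ m : ℕ, 1 ≤ m → ∀ w : X₂,
      ‖emb w - P m (emb w)‖ ≤ C₂ * (m : ℝ) ^ (-α) * ‖w‖)
    -- the target function and the double-weighted summability of its coefficients
    (v : IIinf → X₂) (hv : MemLp v 2 (jacobiProdMeasure a b))
    (q₁ q₂ : ℝ) (hq₁ : 0 < q₁) (hq₁₂ : q₁ ≤ q₂) (hq₂ : q₂ < 2)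
    (σ₁ σ₂ : MultiIdx → ℝ)
    (hσ₁ : WeightedSummable (jacobiTheta0 a b + 1 + ε) (Cε + 1) q₁ σ₁
      fun ν => ‖emb (gpcCoeff a b v ν)‖)
    (hσ₂ : WeightedSummable (jacobiTheta0 a b + 1 + ε) (Cε + 1) q₂ σ₂
      fun ν => ‖gpcCoeff a b v ν‖) :
    -- `vc` is the continuous representative of `v`
    ∃ vc : C(IIinf, X₂), vc =ᵐ[jacobiProdMeasure a b] v ∧
    ∃ ξ : ℕ → ℝ,
      (∀ n : ℕ, 1 ≤ n →
        1 < ξ n ∧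
        (thresholdSet α q₁ q₂ σ₁ σ₂ (ξ n)).Finite ∧
        FiniteDimensional 𝕜 (approxSpace a b V (thresholdSet α q₁ q₂ σ₁ σ₂ (ξ n))) ∧
        Module.finrank 𝕜 (approxSpace a b V (thresholdSet α q₁ q₂ σ₁ σ₂ (ξ n))) ≤ n ∧
        ∀ w : C(IIinf, X₂),
          sparseInterp emb P (thresholdSet α q₁ q₂ σ₁ σ₂ (ξ n)) w ∈
            approxSpace a b V (thresholdSet α q₁ q₂ σ₁ σ₂ (ξ n))) ∧
      ∃ C : ℝ, 0 < C ∧ ∀ p : ENNReal, 0 < p → p ≤ 2 → ∀ n : ℕ, 1 ≤ n →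
        (α ≤ 1 / q₂ - 1 / 2 →
          eLpNorm (fun y => emb (v y) -
              sparseInterp emb P (thresholdSet α q₁ q₂ σ₁ σ₂ (ξ n)) vc y)
            p (jacobiProdMeasure a b)
          ≤ ENNReal.ofReal (C * (n : ℝ) ^ (-α))) ∧
        (1 / q₂ - 1 / 2 < α →
          0 < rateKappa α q₁ q₂ ∧ rateKappa α q₁ q₂ < 1 ∧
          (2 ≤ n →
            eLpNorm (fun y => emb (v y) -
                sparseInterp emb P (thresholdSet α q₁ q₂ σ₁ σ₂ (ξ n)) vc y)
              p (jacobiProdMeasure a b)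
            ≤ ENNReal.ofReal (C *
                ((n : ℝ) ^ (-rateBeta α q₁ q₂) * Real.log n ^ rateKappa α q₁ q₂)))) := by

  obtain ⟨a₀, ha₀, ha⟩ := ha
  obtain ⟨b₀, hb₀, hb⟩ := hb
  have ha : ∀ j, -1 < a j := fun j => ha₀.trans_le (ha j)
  have hb : ∀ j, -1 < b j := fun j => hb₀.trans_le (hb j)
  have hprob := isProbabilityMeasure_jacobiProdMeasure ha hb
  have hθ : 0 ≤ jacobiTheta0 a b + 1 + ε := by linarith [jacobiTheta0_nonneg a b]
  have hlam : 0 ≤ Cε + 1 := by linarith [hCε.1]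
  have hq₂' : 0 < q₂ := hq₁.trans_le hq₁₂
  have hq₁' : q₁ < 2 := hq₁₂.trans_lt hq₂
  have hsum₁ := hσ₁.summable_mul hθ hlam hq₁ fun ν => norm_nonneg _
  have hsum₂ := hσ₂.summable_mul hθ hlam hq₂' fun ν => norm_nonneg _
  have hvint : Integrable v (jacobiProdMeasure a b) := hv.integrable one_le_two
  have hsum : Summable fun ν => pWeight (jacobiTheta0 a b + 1 + ε) (Cε + 1) ν
      * ‖gpcCoeff a b v ν‖ := by
    refine Summable.of_nonneg_of_le (fun ν => ?_) (fun ν => ?_) hsum₂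
    · have := one_le_pWeight hθ hlam ν
      positivity
    · have h1 := one_le_pWeight hθ hlam ν
      refine mul_le_mul_of_nonneg_left (le_mul_of_one_le_left (norm_nonneg _) ?_) (by linarith)
      exact Real.one_le_rpow (hσ₂.one_lt ν).le (by linarith)
  obtain ⟨vc, hvc, hexp⟩ := exists_continuous_representative hε hCε ha hb hvint hsum
  refine ⟨vc, hvc, ?_⟩
  -- One constant dominates the stability and consistency constants in `levelErr` and the norm of
  -- the embedding.
  have hA : 0 < 1 + |C₁| + |C₂| + ‖emb‖ := by positivity
  obtain ⟨ξ, hξ, K, hK, hrate⟩ := exists_threshold hα hq₁ hq₁₂ hq₂ hσ₁.one_lt hσ₂.one_lt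
    hσ₁.increasing hσ₂.increasing (hσ₁.summable_rpow_neg hθ hlam hq₁)
    (hσ₂.summable_rpow_neg hθ hlam hq₂') hA
    (x₁ := fun ν => ‖emb (gpcCoeff a b v ν)‖) (x₂ := fun ν => ‖gpcCoeff a b v ν‖)
    (e := fun N ν => levelErr emb C₁ C₂ α N (gpcCoeff a b v ν))
    (fun ν => norm_nonneg _) (fun ν => norm_nonneg _)
    (fun ν => (emb.le_opNorm _).trans (mul_le_mul_of_nonneg_right
      (by linarith [abs_nonneg C₁, abs_nonneg C₂]) (norm_nonneg _)))
    (fun ν => mul_le_mul_of_nonneg_right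
      (by linarith [norm_nonneg emb, abs_nonneg C₂]) (norm_nonneg _))
    (fun M ν => by
      simp only [levelErr]
      gcongr
      linarith [norm_nonneg emb, abs_nonneg C₁])
  have hlow : ∀ n, IsLowerSet (thresholdSet α q₁ q₂ σ₁ σ₂ (ξ n)) := fun n =>
    isLowerSet_thresholdSet hα hq₁ hq₂' hq₂ hσ₁.one_lt hσ₂.one_lt hσ₁.increasing hσ₂.increasing
  refine ⟨ξ, fun n hn => ?_, ?_⟩
  · obtain ⟨h1, hfin, hdim⟩ := hξ n hn
    obtain ⟨hfd, hrank⟩ := finrank_approxSpace_le (a := a) (b := b) hV hfin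
    refine ⟨h1, hfin, hfd, hrank.trans ?_, fun w =>
      sparseInterp_mem_approxSpace ha hb hP hfin (hlow n) w⟩
    exact_mod_cast hdim
  · have hB := ((hsum₁.add hsum₂).hasSum)
    set B := ∑' ν, (pWeight (jacobiTheta0 a b + 1 + ε) (Cε + 1) ν *
        (σ₁ ν ^ (1 - q₁ / 2) * ‖emb (gpcCoeff a b v ν)‖) +
      pWeight (jacobiTheta0 a b + 1 + ε) (Cε + 1) ν *
        (σ₂ ν ^ (1 - q₂ / 2) * ‖gpcCoeff a b v ν‖)) with hBdef
    have hB0 : 0 ≤ B := by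
      refine tsum_nonneg fun ν => ?_
      have g1 := one_le_pWeight hθ hlam ν
      have g2 := (hσ₁.one_lt ν).le
      have g3 := (hσ₂.one_lt ν).le
      positivity
    -- Any rate `R` for the level errors becomes the same rate for the interpolant, since the
    -- weighted coefficient norms sum to `B`. The bound is uniform in $y$, hence free of $p$.
    have herr : ∀ n, 1 ≤ n → ∀ R : ℝ, 0 ≤ R →
        (∀ N : MultiIdx → ℕ, (∀ k ν, (k, ν) ∈ thresholdSet α q₁ q₂ σ₁ σ₂ (ξ n) ↔ k < N ν) →
          ∀ ν, levelErr emb C₁ C₂ α (N ν) (gpcCoeff a b v ν) ≤ K * R *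
            (σ₁ ν ^ (1 - q₁ / 2) * ‖emb (gpcCoeff a b v ν)‖
              + σ₂ ν ^ (1 - q₂ / 2) * ‖gpcCoeff a b v ν‖)) →
        ∀ p : ENNReal, eLpNorm (fun y => emb (v y) -
          sparseInterp emb P (thresholdSet α q₁ q₂ σ₁ σ₂ (ξ n)) vc y) p (jacobiProdMeasure a b)
          ≤ ENNReal.ofReal (K * (B + 1) * R) := by
      intro n hn R hR hle p
      obtain ⟨-, hfin, -⟩ := hξ n hn
      obtain ⟨N, hN⟩ := exists_level hfin (hlow n)
      have hpt := norm_sub_sparseInterp_le hε hCε ha hb hα hstab hcons hfin (hlow n) hN hexp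
        (fun ν => ?_) (hB.mul_left (K * R))
      · refine (eLpNorm_le_of_ae_bound (C := K * R * B) ?_).trans ?_
        · filter_upwards [hvc] with y hy
          rw [← hy]
          exact hpt y
        · rw [measure_univ, ENNReal.one_rpow, one_mul]
          refine ENNReal.ofReal_le_ofReal ?_
          have := mul_nonneg hK.le hR
          linarith
      · have g1 := one_le_pWeight hθ hlam ν
        have g2 := mul_le_mul_of_nonneg_left (hle N hN ν) (zero_le_one.trans g1)
        linarith
    -- `B` vanishes with `v`; the added 1 keeps the constant positive.
    refine ⟨K * (B + 1), by positivity, fun p _ _ n hn => ⟨fun h => ?_, fun h => ?_⟩⟩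
    · exact herr n hn _ (by positivity) (fun N hN ν => (hrate n hn N hN ν).1 h) p
    · obtain ⟨hκ0, hκ1⟩ := rateKappa_mem_Ioo hq₁ hq₁' h
      refine ⟨hκ0, hκ1, fun hn2 => ?_⟩
      have hlog : 0 ≤ Real.log n := Real.log_nonneg (by exact_mod_cast hn)
      exact herr n hn _ (by positivity) (fun N hN ν => (hrate n hn N hN ν).2 h hn2) p
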